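/- Assume the Elliott--Halberstam Conjecture in the following form: for any fixed real numbers $A>0$ and $\epsilon>0$, $$\sum_{d\leqslant x^{1-\epsilon}}\ \sup_{2\leqslant y\leqslant x}\left|\pi(y;d,1)-\frac{\mathrm{li}\,y}{\varphi(d)}\right|\ll_{A,\epsilon}\frac{x}{(\log x)^A}\qquad(x\to\infty),$$ where $d$ runs over positive integers, $y$ over real numbers, $\pi(y;d,1)$ is the number of primes $p\leqslant y$ with $p\equiv 1\pmod d$, $\varphi$ is Euler's totient function, and $\mathrm{li}\,y=\int_2^y\frac{dt}{\log t}$. Then $$\sum_{p,q\leqslant x}\frac{1}{[p-1,q-1]}\sim 2\,\frac{\zeta(2)\zeta(3)}{\zeta(6)}\log x\qquad\text{as } x\to\infty,$$ where the sum is over all ordered pairs of primes $p,q$ with $p\leqslant x$ and $q\leqslant x$, $[a,b]$ denotes the least common multiple of $a$ and $b$, and $\zeta$ is the Riemann zeta function. -/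

import Mathlib

open Filter Asymptotics

noncomputable section

/-- `π(y; d, a)`: the number of primes `p ≤ y` with `p ≡ a (mod d)`. -/
def primeCountingAP (y : ℝ) (d a : ℕ) : ℕ :=
  ((Nat.primesLE ⌊y⌋₊).filter fun p => p ≡ a [MOD d]).card

/-- The logarithmic integral `li y = ∫_2^y dt / log t`. -/
def li (y : ℝ) : ℝ :=
  ∫ t in (2 : ℝ)..y, 1 / Real.log t

/-- `sup_{2 ≤ y ≤ x} |π(y; d, 1) - li y / φ(d)|`. For `x ≥ 2` and `d ≥ 1` this is the supremum of a
nonempty bounded set of reals. The lower bound `2 ≤ y` is there because `li` diverges at `1`. -/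
def maxDiscrepancy (x : ℝ) (d : ℕ) : ℝ :=
  ⨆ y : Set.Icc (2 : ℝ) x, |(primeCountingAP y d 1 : ℝ) - li y / (Nat.totient d : ℝ)|

/-- The Elliott–Halberstam Conjecture (for the residue class `1`): for all fixed `A, ε > 0`,
`∑_{d ≤ x^{1-ε}} max_{y ≤ x} |π(y; d, 1) - li y / φ(d)| ≪_{A, ε} x / (log x)^A`. -/
def ElliottHalberstam : Prop :=
  ∀ A ε : ℝ, 0 < A → 0 < ε →
    (fun x : ℝ => ∑ d ∈ Finset.Icc 1 ⌊x ^ (1 - ε)⌋₊, maxDiscrepancy x d)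
      =O[atTop] fun x : ℝ => x / Real.log x ^ A

/-- `∑_{p, q ≤ x} 1 / [p - 1, q - 1]`, over ordered pairs of primes. -/
def lcmSum (x : ℝ) : ℝ :=
  ∑ p ∈ Nat.primesLE ⌊x⌋₊, ∑ q ∈ Nat.primesLE ⌊x⌋₊, 1 / (Nat.lcm (p - 1) (q - 1) : ℝ)

end

/-! ### Selberg's upper bound sieve. -/

section SelbergBound

open Finset BoundingSieve
open scoped ArithmeticFunction.Moebius

/-! Since `gcd a b` is the sum of `φ(d)` over the common divisors `d`, the reciprocal `1/[p-1, q-1]`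
is a sum over `d` of `φ(d)` times a factor in `p` alone and a factor in `q` alone. Hence for `x =
2^J` the sum is a weighted mean square `∑ φ(d) S(d)^2`, where `S(d)` is the sum of `1/(p-1)` over
primes `p ≤ x` with `p ≡ 1 (mod d)` (`lcmSum_two_pow`). The primes are cut into dyadic blocks `(2^j,
2^(j+1)]`, and for small `ε` a block with `j ≥ 1` is far from `d` when `d ≤ 2^(j(1-ε))`, near
otherwise.

Far blocks: Elliott–Halberstam and partial summation show that block `j` contributes
`log((j+1)/j)/φ(d)` to `S(d)`, with a total error whose weighted mean square is bounded in `J`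
(`sum_totient_mul_farSum_sub_sq_le`).

Near blocks: here the conjecture says nothing, but `p = dk + 1` with `k` at most about `2^(2εi)`
when `d` has size `2^i`. Opening the square leads to counting the `d` for which `dk + 1` and `dl +
1` are both prime, and Selberg's sieve bounds this within a constant, on average over `k, l`. Each
dyadic range of `d` contributes `O(ε)`, so the near part is `O(εJ) + O_ε(1)` with the first constant
independent of `ε` (`sum_totient_mul_nearSum_sq_le`).

Main term: opening the square of the model gives `∑ a_i a_j T(min(i, j))` with `a_i = log((i+1)/i)`
and `T(m)` the sum of `1/φ(d)` over `d ≤ 2^(m(1-ε))`. Now `T(m) ~ c(1-ε) m log 2`, where `c = ∑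
μ(e)^2/(e φ(e)) = ζ(2)ζ(3)/ζ(6)` by Euler products, and `∑ a_i a_j min(i, j) = ∑ log(J/m)^2 ~ 2J`
because the integral of `log^2` over `(0, 1)` is `2`. Letting `J → ∞` and then `ε → 0` settles `x =
2^J`; monotonicity covers all `x`. -/

theorem sum_divisors_moebius_real (n : ℕ) :
    ∑ d ∈ n.divisors, ((μ d : ℤ) : ℝ) = if n = 1 then 1 else 0 := by
  have h := congrArg (fun f : ArithmeticFunction ℝ => f n)
    (ArithmeticFunction.coe_zeta_mul_coe_moebius (R := ℝ))
  simp only [ArithmeticFunction.coe_zeta_mul_apply, ArithmeticFunction.one_apply] at h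
  simpa using h

/-- Put `d = lc`: as `f` is squarefree, `l` and `c` are coprime and `μ(l)` factors out of a full
Möbius sum. This dual Möbius inversion recovers the diagonal variables from Selberg's weights. -/
theorem sum_moebius_between {P l f : ℕ} (hP : P ≠ 0) (hf : f ∣ P) (hsq : Squarefree f) :
    ∑ d ∈ P.divisors, (if l ∣ d ∧ d ∣ f then ((μ d : ℤ) : ℝ) else 0) =
      if l = f then ((μ l : ℤ) : ℝ) else 0 := by
  have hf0 : f ≠ 0 := ne_zero_of_dvd_ne_zero hP hf
  by_cases hl : l ∣ f
  · obtain ⟨m, rfl⟩ := hl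
    have hl0 : l ≠ 0 := left_ne_zero_of_mul hf0
    have hm0 : m ≠ 0 := right_ne_zero_of_mul hf0
    have hcop : l.Coprime m := (Nat.squarefree_mul_iff.mp hsq).1
    have himg : P.divisors.filter (fun d => l ∣ d ∧ d ∣ l * m) = m.divisors.image (l * ·) := by
      ext d
      simp only [mem_filter, Nat.mem_divisors, mem_image]
      constructor
      · rintro ⟨_, ⟨c, rfl⟩, h2⟩
        exact ⟨c, ⟨(Nat.mul_dvd_mul_iff_left (Nat.pos_of_ne_zero hl0)).mp h2, hm0⟩, rfl⟩
      · rintro ⟨c, ⟨hc, _⟩, rfl⟩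
        exact ⟨⟨(mul_dvd_mul_left l hc).trans hf, hP⟩, dvd_mul_right _ _, mul_dvd_mul_left l hc⟩
    rw [← sum_filter, himg, sum_image (fun a _ b _ h => Nat.eq_of_mul_eq_mul_left
      (Nat.pos_of_ne_zero hl0) h)]
    have : ∀ c ∈ m.divisors, ((μ (l * c) : ℤ) : ℝ) = ((μ l : ℤ) : ℝ) * ((μ c : ℤ) : ℝ) := by
      intro c hc
      rw [ArithmeticFunction.isMultiplicative_moebius.map_mul_of_coprime
        (hcop.coprime_dvd_right (Nat.dvd_of_mem_divisors hc))]
      push_cast; ring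
    rw [sum_congr rfl this, ← mul_sum, sum_divisors_moebius_real m]
    by_cases h1 : m = 1
    · simp [h1]
    · have : l ≠ l * m := by
        intro h
        exact h1 (Nat.eq_of_mul_eq_mul_left (Nat.pos_of_ne_zero hl0) (by rw [← h, mul_one]))
      rw [if_neg h1, if_neg this, mul_zero]
  · rw [if_neg (by rintro rfl; exact hl dvd_rfl)]
    refine sum_eq_zero fun d _ => if_neg ?_
    rintro ⟨h1, h2⟩
    exact hl (h1.trans h2)

/-- The squarefree moduli up to `R` used by the sieve. -/
def sieveModuli (s : BoundingSieve) (R : ℕ) : Finset ℕ := s.prodPrimes.divisors.filter (· ≤ R)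

theorem mem_sieveModuli {s : BoundingSieve} {R d : ℕ} :
    d ∈ sieveModuli s R ↔ d ∣ s.prodPrimes ∧ d ≤ R := by
  simp [sieveModuli, Nat.mem_divisors, s.prodPrimes_ne_zero]

/-- The sum `∑ g(l)` over the sieve moduli, whose inverse is Selberg's main term. -/
noncomputable def selbergSum (s : BoundingSieve) (R : ℕ) : ℝ :=
  ∑ l ∈ sieveModuli s R, s.selbergTerms l

theorem selbergTerms_nonneg_of_mem {s : BoundingSieve} {R l : ℕ} (hl : l ∈ sieveModuli s R) :
    0 < s.selbergTerms l := selbergTerms_pos (mem_sieveModuli.mp hl).1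

theorem selbergSum_pos (s : BoundingSieve) {R : ℕ} (hR : 1 ≤ R) : 0 < selbergSum s R :=
  sum_pos (fun _ hl => selbergTerms_nonneg_of_mem hl) ⟨1, mem_sieveModuli.mpr ⟨one_dvd _, hR⟩⟩

/-- Selberg's optimal weights. -/
noncomputable def selbergWeight (s : BoundingSieve) (R d : ℕ) : ℝ :=
  (μ d : ℤ) * (s.nu d)⁻¹ * (∑ f ∈ sieveModuli s R, if d ∣ f then s.selbergTerms f else 0) /
    selbergSum s R

theorem selbergWeight_one (s : BoundingSieve) {R : ℕ} (hR : 1 ≤ R) : selbergWeight s R 1 = 1 := by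
  have := (selbergSum_pos s hR).ne'
  simp only [selbergWeight, one_dvd, if_true, s.nu_mult.map_one]
  rw [← selbergSum]
  simp [this]

theorem selbergWeight_eq_zero {s : BoundingSieve} {R d : ℕ} (hd : R < d) :
    selbergWeight s R d = 0 := by
  have : (∑ f ∈ sieveModuli s R, if d ∣ f then s.selbergTerms f else 0) = 0 := by
    refine sum_eq_zero fun f hf => if_neg fun h => ?_
    have h2 := mem_sieveModuli.mp hf
    have := Nat.le_of_dvd (Nat.pos_of_ne_zero (ne_zero_of_dvd_ne_zero s.prodPrimes_ne_zero h2.1)) h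
    omega
  simp [selbergWeight, this]

/-- The numerator is a partial sum of the positive terms of `selbergSum`. The classical bound `1` is
not needed, because the level will be a small power of the length of the interval. -/
theorem abs_selbergWeight_le {s : BoundingSieve} {R d : ℕ} (hR : 1 ≤ R) (hd : d ∣ s.prodPrimes) :
    |selbergWeight s R d| ≤ (s.nu d)⁻¹ := by
  have hL := selbergSum_pos s hR
  have hnu := nu_pos_of_dvd_prodPrimes hd
  have h0 : 0 ≤ ∑ f ∈ sieveModuli s R, if d ∣ f then s.selbergTerms f else 0 :=
    sum_nonneg fun f hf => by
      split_ifs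
      exacts [(selbergTerms_nonneg_of_mem hf).le, le_rfl]
  have h1 : (∑ f ∈ sieveModuli s R, if d ∣ f then s.selbergTerms f else 0) ≤ selbergSum s R :=
    sum_le_sum fun f hf => by
      split_ifs
      exacts [le_rfl, (selbergTerms_nonneg_of_mem hf).le]
  have hmu : |((μ d : ℤ) : ℝ)| ≤ 1 := by exact_mod_cast ArithmeticFunction.abs_moebius_le_one
  rw [selbergWeight, abs_div, abs_mul, abs_mul, abs_of_pos hL, abs_of_nonneg h0,
    abs_of_pos (inv_pos.mpr hnu), div_le_iff₀ hL]
  calc |((μ d : ℤ) : ℝ)| * (s.nu d)⁻¹ * _ ≤ 1 * (s.nu d)⁻¹ * selbergSum s R := by gcongr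
    _ = _ := by ring

/-- In the variables `y_l = ∑_{l ∣ d} ν(d) w(d)` the main term is the diagonal form `∑ y_l^2 /
g(l)`. The weights are designed so that `y_l = μ(l) g(l) / L` for `l ≤ R` and `0` beyond, with `L =
selbergSum s R`; the form then equals `L / L^2`. -/
theorem mainSum_selbergWeight (s : BoundingSieve) {R : ℕ} (hR : 1 ≤ R) :
    s.mainSum (lambdaSquared (selbergWeight s R)) = (selbergSum s R)⁻¹ := by
  have hL := (selbergSum_pos s hR).ne'
  have hy : ∀ l ∈ s.prodPrimes.divisors,
      (∑ d ∈ s.prodPrimes.divisors, if l ∣ d then s.nu d * selbergWeight s R d else 0) =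
        if l ≤ R then (μ l : ℤ) * s.selbergTerms l / selbergSum s R else 0 := by
    intro l hl
    have hlP := Nat.dvd_of_mem_divisors hl
    calc (∑ d ∈ s.prodPrimes.divisors, if l ∣ d then s.nu d * selbergWeight s R d else 0)
        = ∑ d ∈ s.prodPrimes.divisors, ∑ f ∈ sieveModuli s R,
          (if l ∣ d ∧ d ∣ f then ((μ d : ℤ) : ℝ) else 0) * s.selbergTerms f / selbergSum s R := by
          refine sum_congr rfl fun d hd => ?_
          have hnu : s.nu d ≠ 0 := nu_ne_zero (Nat.dvd_of_mem_divisors hd)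
          by_cases h : l ∣ d
          · simp only [h, if_true, true_and, selbergWeight]
            rw [mul_div_assoc', ← mul_assoc, ← mul_assoc, mul_comm (s.nu d),
              mul_assoc (_ : ℝ) (s.nu d), mul_inv_cancel₀ hnu, mul_one, mul_sum, sum_div]
            refine sum_congr rfl fun f _ => ?_
            split_ifs <;> simp
          · simp [h]
      _ = ∑ f ∈ sieveModuli s R, (if l = f then ((μ l : ℤ) : ℝ) else 0) *
            s.selbergTerms f / selbergSum s R := by
          rw [sum_comm]
          refine sum_congr rfl fun f hf => ?_
          have hfP := (mem_sieveModuli.mp hf).1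
          rw [← sum_div, ← sum_mul, sum_moebius_between s.prodPrimes_ne_zero hfP
            (squarefree_of_dvd_prodPrimes hfP)]
      _ = _ := by
          have : ∀ f ∈ sieveModuli s R, (if l = f then ((μ l : ℤ) : ℝ) else 0) *
              s.selbergTerms f / selbergSum s R =
              if l = f then (μ l : ℤ) * s.selbergTerms f / selbergSum s R else 0 := by
            intro f _
            split_ifs <;> simp
          rw [sum_congr rfl this,
            sum_ite_eq _ l (fun f => ((μ l : ℤ) : ℝ) * s.selbergTerms f / selbergSum s R)]
          simp only [mem_sieveModuli, hlP, true_and]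
  rw [mainSum_lambdaSquared_eq_sum_mul_sum_sq]
  calc _ = ∑ l ∈ s.prodPrimes.divisors,
        if l ≤ R then s.selbergTerms l / selbergSum s R ^ 2 else 0 := by
        refine sum_congr rfl fun l hl => ?_
        have hlP := Nat.dvd_of_mem_divisors hl
        rw [hy l hl]
        split_ifs
        · have hmu : ((μ l : ℤ) : ℝ) ^ 2 = 1 := by
            exact_mod_cast (ArithmeticFunction.moebius_sq_eq_one_of_squarefree
              (squarefree_of_dvd_prodPrimes hlP))
          have hg := (selbergTerms_pos hlP).ne'
          rw [div_pow, mul_pow, hmu]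
          field_simp
        · simp
    _ = selbergSum s R / selbergSum s R ^ 2 := by
        rw [← sum_filter, ← sum_div]; rfl
    _ = _ := by field_simp

theorem errSum_lambdaSquared_le (s : BoundingSieve) (w : ℕ → ℝ) :
    s.errSum (lambdaSquared w) ≤ ∑ d₁ ∈ s.prodPrimes.divisors, ∑ d₂ ∈ s.prodPrimes.divisors,
      |w d₁| * |w d₂| * |s.rem (d₁.lcm d₂)| := by
  calc s.errSum (lambdaSquared w)
      ≤ ∑ d ∈ s.prodPrimes.divisors, ∑ d₁ ∈ s.prodPrimes.divisors, ∑ d₂ ∈ s.prodPrimes.divisors,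
        if d = d₁.lcm d₂ then |w d₁| * |w d₂| * |s.rem (d₁.lcm d₂)| else 0 := by
        refine sum_le_sum fun d hd => ?_
        have hsub : d.divisors ⊆ s.prodPrimes.divisors :=
          Nat.divisors_subset_of_dvd s.prodPrimes_ne_zero (Nat.dvd_of_mem_divisors hd)
        have hnn : ∀ d₁ d₂ : ℕ, 0 ≤ (if d = d₁.lcm d₂ then
            |w d₁| * |w d₂| * |s.rem (d₁.lcm d₂)| else 0) := by
          intro d₁ d₂
          split_ifs <;> positivity
        calc |lambdaSquared w d| * |s.rem d|
            ≤ (∑ d₁ ∈ d.divisors, ∑ d₂ ∈ d.divisors,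
                |if d = d₁.lcm d₂ then w d₁ * w d₂ else 0|) * |s.rem d| := by
              gcongr
              exact (abs_sum_le_sum_abs _ _).trans (sum_le_sum fun _ _ => abs_sum_le_sum_abs _ _)
          _ = ∑ d₁ ∈ d.divisors, ∑ d₂ ∈ d.divisors,
                if d = d₁.lcm d₂ then |w d₁| * |w d₂| * |s.rem (d₁.lcm d₂)| else 0 := by
              rw [sum_mul]
              refine sum_congr rfl fun d₁ _ => ?_
              rw [sum_mul]
              refine sum_congr rfl fun d₂ _ => ?_
              split_ifs with h
              · rw [abs_mul, ← h]
              · simp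
          _ ≤ ∑ d₁ ∈ d.divisors, ∑ d₂ ∈ s.prodPrimes.divisors,
                if d = d₁.lcm d₂ then |w d₁| * |w d₂| * |s.rem (d₁.lcm d₂)| else 0 :=
              sum_le_sum fun d₁ _ => sum_le_sum_of_subset_of_nonneg hsub fun _ _ _ => hnn _ _
          _ ≤ _ := sum_le_sum_of_subset_of_nonneg hsub fun _ _ _ => sum_nonneg fun _ _ => hnn _ _
    _ = _ := by
        rw [sum_comm]
        refine sum_congr rfl fun d₁ h₁ => ?_
        rw [sum_comm]
        refine sum_congr rfl fun d₂ h₂ => ?_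
        rw [sum_ite_eq' _ (d₁.lcm d₂) (fun _ => |w d₁| * |w d₂| * |s.rem (d₁.lcm d₂)|), if_pos]
        exact Nat.mem_divisors.mpr ⟨Nat.lcm_dvd (Nat.dvd_of_mem_divisors h₁)
          (Nat.dvd_of_mem_divisors h₂), s.prodPrimes_ne_zero⟩

/-- **Selberg's upper bound sieve** with a crude remainder. -/
theorem siftedSum_le_selberg (s : BoundingSieve) {R : ℕ} (hR : 1 ≤ R) :
    s.siftedSum ≤ s.totalMass / selbergSum s R +
      ∑ d₁ ∈ sieveModuli s R, ∑ d₂ ∈ sieveModuli s R,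
        (s.nu d₁)⁻¹ * (s.nu d₂)⁻¹ * |s.rem (d₁.lcm d₂)| := by
  have h := siftedSum_le_mainSum_errSum_of_upperMoebius (s := s) _
    (upperMoebius_lambdaSquared (selbergWeight s R) (selbergWeight_one s hR))
  rw [mainSum_selbergWeight s hR, ← div_eq_mul_inv] at h
  refine h.trans (add_le_add_right ((errSum_lambdaSquared_le s _).trans ?_) _)
  have hz : ∀ d : ℕ, d ∈ s.prodPrimes.divisors → d ∉ sieveModuli s R →
      selbergWeight s R d = 0 := fun d h1 h2 => selbergWeight_eq_zero (by
    by_contra! hle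
    exact h2 (mem_sieveModuli.mpr ⟨Nat.dvd_of_mem_divisors h1, hle⟩))
  have hsub : sieveModuli s R ⊆ s.prodPrimes.divisors := filter_subset _ _
  rw [← sum_subset hsub fun d h1 h2 => by simp [hz d h1 h2]]
  refine sum_le_sum fun d₁ h₁ => ?_
  rw [← sum_subset hsub fun d h1 h2 => by simp [hz d h1 h2]]
  refine sum_le_sum fun d₂ h₂ => ?_
  have hν : 0 < s.nu d₁ := nu_pos_of_dvd_prodPrimes (mem_sieveModuli.mp h₁).1
  gcongr
  · exact abs_selbergWeight_le hR (mem_sieveModuli.mp h₁).1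
  · exact abs_selbergWeight_le hR (mem_sieveModuli.mp h₂).1

end SelbergBound

/-! ### Lower bounds for sums of `1/n` and `τ(n)/n` over squarefree `n` coprime to a modulus. -/

section CoprimeHarmonic

open Finset

theorem sum_le_sum_of_injOn_of_le {ι κ : Type*} [DecidableEq κ] {s : Finset ι} {t : Finset κ}
    {f : ι → ℝ} {g : κ → ℝ} (i : ι → κ) (hi : ∀ x ∈ s, i x ∈ t) (hinj : Set.InjOn i s)
    (hfg : ∀ x ∈ s, f x ≤ g (i x)) (hg : ∀ y ∈ t, 0 ≤ g y) : ∑ x ∈ s, f x ≤ ∑ y ∈ t, g y := by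
  calc ∑ x ∈ s, f x ≤ ∑ x ∈ s, g (i x) := sum_le_sum hfg
    _ = ∑ y ∈ s.image i, g y := (sum_image hinj).symm
    _ ≤ _ := sum_le_sum_of_subset_of_nonneg (image_subset_iff.mpr hi) fun y hy _ => hg y hy

theorem sum_Icc_inv_sq_le_two (n : ℕ) : ∑ s ∈ Icc 1 n, (1 : ℝ) / (s : ℝ) ^ 2 ≤ 2 := by
  -- The term `-1/n` makes the induction telescope; at `n = 0` it is `0` by convention.
  have : ∑ s ∈ Icc 1 n, (1 : ℝ) / (s : ℝ) ^ 2 ≤ 2 - 1 / n := by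
    induction n with
    | zero => simp
    | succ n ih =>
      rw [sum_Icc_succ_top (by omega)]
      rcases Nat.eq_zero_or_pos n with rfl | hn
      · norm_num
      have hn' : (0 : ℝ) < n := by exact_mod_cast hn
      have : (1 : ℝ) / ((n + 1 : ℕ) : ℝ) ^ 2 ≤ 1 / n - 1 / ((n + 1 : ℕ) : ℝ) := by
        push_cast
        rw [div_sub_div _ _ hn'.ne' (by positivity), div_le_div_iff₀ (by positivity) (by positivity)]
        nlinarith
      linarith
  have h0 : (0 : ℝ) ≤ 1 / n := by positivity
  linarith

/-- Induction on the set of primes. The integers surviving so far are closed under division by `q`,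
so `n ↦ n / q` shows that the multiples of `q` carry at most the share `1/q` of the sum. -/
theorem prod_mul_sum_inv_le (S : Finset ℕ) (hS : ∀ p ∈ S, p.Prime) (y : ℕ) :
    (∏ p ∈ S, (1 - 1 / (p : ℝ))) * ∑ n ∈ Icc 1 y, (1 : ℝ) / n ≤
      ∑ n ∈ Icc 1 y with ∀ p ∈ S, ¬ p ∣ n, (1 : ℝ) / n := by
  induction S using Finset.induction_on with
  | empty => simp
  | insert q S hq ih =>
    have hqp : q.Prime := hS q (mem_insert_self _ _)
    have hq0 : (0 : ℝ) < q := by exact_mod_cast hqp.pos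
    have hq1 : 1 / (q : ℝ) ≤ 1 := by
      rw [div_le_one hq0]; exact_mod_cast hqp.one_le
    have ih' := ih fun p hp => hS p (mem_insert_of_mem hp)
    set A := (Icc 1 y).filter fun n => ∀ p ∈ S, ¬ p ∣ n with hA
    have hsplit : ∑ n ∈ A, (1 : ℝ) / n =
        ∑ n ∈ A with q ∣ n, (1 : ℝ) / n + ∑ n ∈ A with ¬ q ∣ n, (1 : ℝ) / n :=
      (sum_filter_add_sum_filter_not A (fun n => q ∣ n) _).symm
    have hfil : (Icc 1 y).filter (fun n => ∀ p ∈ insert q S, ¬ p ∣ n) =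
        A.filter fun n => ¬ q ∣ n := by
      ext n
      simp only [hA, mem_filter, mem_insert, forall_eq_or_imp]
      tauto
    have hle : ∑ n ∈ A with q ∣ n, (1 : ℝ) / n ≤ 1 / q * ∑ n ∈ A, (1 : ℝ) / n := by
      rw [mul_sum]
      refine sum_le_sum_of_injOn_of_le (fun n => n / q) ?_ ?_ ?_ ?_
      · intro n hn
        simp only [hA, mem_filter, mem_Icc] at hn ⊢
        obtain ⟨⟨⟨h1, h2⟩, h3⟩, h4⟩ := hn
        refine ⟨⟨Nat.div_pos (Nat.le_of_dvd h1 h4) hqp.pos, (Nat.div_le_self _ _).trans h2⟩, ?_⟩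
        intro p hp hdvd
        exact h3 p hp (hdvd.trans (Nat.div_dvd_of_dvd h4))
      · intro a ha b hb hab
        have ha' := (mem_filter.mp ha).2
        have hb' := (mem_filter.mp hb).2
        exact (Nat.div_left_inj ha' hb').mp hab
      · intro n hn
        rw [Nat.cast_div (mem_filter.mp hn).2 hq0.ne']
        apply le_of_eq
        field_simp
      · intro n _; positivity
    rw [hfil, prod_insert hq]
    nlinarith [mul_le_mul_of_nonneg_left ih' (sub_nonneg.mpr hq1)]

/-- Writing `n = b^2 a` with `a` squarefree separates a factor `∑ 1/b^2 ≤ 2`. -/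
theorem sum_inv_le_two_mul_sum_squarefree (S : Finset ℕ) (y : ℕ) :
    ∑ n ∈ Icc 1 y with ∀ p ∈ S, ¬ p ∣ n, (1 : ℝ) / n ≤
      2 * ∑ n ∈ Icc 1 y with Squarefree n ∧ ∀ p ∈ S, ¬ p ∣ n, (1 : ℝ) / n := by
  have hex : ∀ n : ℕ, ∃ ab : ℕ × ℕ, ab.2 ^ 2 * ab.1 = n ∧ Squarefree ab.1 := fun n => by
    obtain ⟨a, b, h1, h2⟩ := Nat.sq_mul_squarefree n
    exact ⟨(a, b), h1, h2⟩
  choose i hi1 hi2 using hex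
  calc _ ≤ ∑ x ∈ ((Icc 1 y).filter fun n => Squarefree n ∧ ∀ p ∈ S, ¬ p ∣ n) ×ˢ Icc 1 y,
        (1 : ℝ) / x.1 * (1 / (x.2 : ℝ) ^ 2) := by
        refine sum_le_sum_of_injOn_of_le i ?_ ?_ ?_ ?_
        · intro n hn
          simp only [mem_filter, mem_Icc, mem_product] at hn ⊢
          obtain ⟨⟨h1, h2⟩, h3⟩ := hn
          have e := hi1 n
          have ha : (i n).1 ∣ n := ⟨_, by rw [mul_comm]; exact e.symm⟩
          have hb : (i n).2 ∣ n := ⟨(i n).2 * (i n).1, by rw [← mul_assoc, ← sq]; exact e.symm⟩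
          exact ⟨⟨⟨Nat.pos_of_dvd_of_pos ha h1, (Nat.le_of_dvd h1 ha).trans h2⟩, hi2 n,
            fun p hp hd => h3 p hp (hd.trans ha)⟩,
            Nat.pos_of_dvd_of_pos hb h1, (Nat.le_of_dvd h1 hb).trans h2⟩
        · intro a _ b _ hab
          rw [← hi1 a, ← hi1 b, hab]
        · intro n hn
          apply le_of_eq
          nth_rw 1 [← hi1 n]
          push_cast
          rw [one_div_mul_one_div, mul_comm]
        · intro x _; positivity
    _ = (∑ n ∈ Icc 1 y with Squarefree n ∧ ∀ p ∈ S, ¬ p ∣ n, (1 : ℝ) / n) *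
          ∑ s ∈ Icc 1 y, (1 : ℝ) / (s : ℝ) ^ 2 := by rw [sum_product, sum_mul_sum]
    _ ≤ _ := by
        rw [mul_comm]
        exact mul_le_mul_of_nonneg_right (sum_Icc_inv_sq_le_two y)
          (sum_nonneg fun _ _ => by positivity)

/-- With `g = gcd a b`, send the pair `(a, b)` to `g`, to `m = (a/g)(b/g)` and to the divisor `a/g`
of `m`. This is injective, `1/(ab) = 1/g^2 · 1/m`, and `m` is squarefree because `a/g` and `b/g` are
coprime. Summing over the divisor gives `τ(m)`, over `g` at most `2`. -/
theorem sq_sum_squarefree_inv_le (S : Finset ℕ) (hS : ∀ p ∈ S, p.Prime) (Q : ℕ) :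
    (∑ n ∈ Icc 1 Q with Squarefree n ∧ ∀ p ∈ S, ¬ p ∣ n, (1 : ℝ) / n) ^ 2 ≤
      2 * ∑ m ∈ Icc 1 (Q ^ 2) with Squarefree m ∧ ∀ p ∈ S, ¬ p ∣ m,
        (m.divisors.card : ℝ) / m := by
  set A := (Icc 1 Q).filter fun n => Squarefree n ∧ ∀ p ∈ S, ¬ p ∣ n with hA
  set M := (Icc 1 (Q ^ 2)).filter fun n => Squarefree n ∧ ∀ p ∈ S, ¬ p ∣ n with hM
  calc (∑ n ∈ A, (1 : ℝ) / n) ^ 2 = ∑ x ∈ A ×ˢ A, (1 : ℝ) / x.1 * (1 / x.2) := by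
        rw [sq, sum_mul_sum, sum_product]
    _ ≤ ∑ x ∈ Icc 1 Q ×ˢ (M.sigma fun m => m.divisors),
          (1 / (x.1 : ℝ) ^ 2) * (1 / (x.2.1 : ℝ)) := by
        refine sum_le_sum_of_injOn_of_le
          (fun x => (x.1.gcd x.2, ⟨x.1 / x.1.gcd x.2 * (x.2 / x.1.gcd x.2), x.1 / x.1.gcd x.2⟩))
          ?_ ?_ ?_ ?_
        · rintro ⟨a, b⟩ h
          simp only [hA, hM, mem_product, mem_filter, mem_Icc, mem_sigma, Nat.mem_divisors] at h ⊢
          obtain ⟨⟨⟨ha1, ha2⟩, ha3, ha4⟩, ⟨hb1, hb2⟩, hb3, hb4⟩ := h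
          have hg := Nat.gcd_pos_of_pos_left b ha1
          have hga := Nat.gcd_dvd_left a b
          have hgb := Nat.gcd_dvd_right a b
          have hda := Nat.div_dvd_of_dvd hga
          have hdb := Nat.div_dvd_of_dvd hgb
          have ha0 : 0 < a / a.gcd b := Nat.div_pos (Nat.le_of_dvd ha1 hga) hg
          have hb0 : 0 < b / a.gcd b := Nat.div_pos (Nat.le_of_dvd hb1 hgb) hg
          refine ⟨⟨hg, (Nat.le_of_dvd ha1 hga).trans ha2⟩, ⟨⟨Nat.mul_pos ha0 hb0, ?_⟩, ?_, ?_⟩,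
            dvd_mul_right _ _, (Nat.mul_pos ha0 hb0).ne'⟩
          · rw [sq]
            exact Nat.mul_le_mul ((Nat.div_le_self _ _).trans ha2) ((Nat.div_le_self _ _).trans hb2)
          · exact (Nat.squarefree_mul (Nat.coprime_div_gcd_div_gcd hg)).mpr
              ⟨ha3.squarefree_of_dvd hda, hb3.squarefree_of_dvd hdb⟩
          · intro p hp hd
            rcases (hS p hp).dvd_mul.mp hd with h | h
            · exact ha4 p hp (h.trans hda)
            · exact hb4 p hp (h.trans hdb)
        · rintro ⟨a, b⟩ h ⟨a', b'⟩ h' he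
          simp only [coe_product, Set.mem_prod, mem_coe, hA, mem_filter, mem_Icc] at h h'
          simp only [Prod.mk.injEq, Sigma.mk.injEq, heq_eq_eq] at he
          obtain ⟨e1, e2, e3⟩ := he
          have ea : a = a' := by
            rw [← Nat.div_mul_cancel (Nat.gcd_dvd_left a b), e3, e1,
              Nat.div_mul_cancel (Nat.gcd_dvd_left a' b')]
          have ha0 : 0 < a' / a'.gcd b' := Nat.div_pos (Nat.le_of_dvd h'.1.1.1
            (Nat.gcd_dvd_left a' b')) (Nat.gcd_pos_of_pos_left _ h'.1.1.1)
          have e4 : b / a.gcd b = b' / a'.gcd b' := by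
            rw [e3] at e2
            exact Nat.eq_of_mul_eq_mul_left ha0 e2
          have eb : b = b' := by
            rw [← Nat.div_mul_cancel (Nat.gcd_dvd_right a b), e4, e1,
              Nat.div_mul_cancel (Nat.gcd_dvd_right a' b')]
          rw [ea, eb]
        · rintro ⟨a, b⟩ h
          simp only [hA, mem_product, mem_filter, mem_Icc] at h
          have hg : (0 : ℝ) < a.gcd b := by exact_mod_cast Nat.gcd_pos_of_pos_left b h.1.1.1
          apply le_of_eq
          simp only
          rw [Nat.cast_mul, Nat.cast_div (Nat.gcd_dvd_left a b) hg.ne',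
            Nat.cast_div (Nat.gcd_dvd_right a b) hg.ne']
          have ha : (0 : ℝ) < a := by exact_mod_cast h.1.1.1
          have hb : (0 : ℝ) < b := by exact_mod_cast h.2.1.1
          field_simp
        · intro x _; positivity
    _ = (∑ s ∈ Icc 1 Q, (1 : ℝ) / (s : ℝ) ^ 2) * ∑ m ∈ M, (m.divisors.card : ℝ) / m := by
        rw [sum_product, sum_mul_sum]
        refine sum_congr rfl fun s _ => ?_
        rw [sum_sigma]
        refine sum_congr rfl fun m _ => ?_
        simp only [sum_const, nsmul_eq_mul]
        ring
    _ ≤ _ := mul_le_mul_of_nonneg_right (sum_Icc_inv_sq_le_two Q)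
          (sum_nonneg fun _ _ => by positivity)

theorem log_le_sum_Icc_inv (n : ℕ) : Real.log n ≤ ∑ k ∈ Icc 1 n, (1 : ℝ) / k := by
  rcases Nat.eq_zero_or_pos n with rfl | hn
  · simp
  have h := log_add_one_le_harmonic n
  rw [harmonic_eq_sum_Icc] at h
  push_cast at h
  simp only [one_div]
  refine le_trans (Real.log_le_log (by exact_mod_cast hn) ?_) h
  linarith

theorem sum_Icc_inv_le (n : ℕ) : ∑ k ∈ Icc 1 n, (1 : ℝ) / k ≤ 1 + Real.log n := by
  have h := harmonic_le_one_add_log n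
  rw [harmonic_eq_sum_Icc] at h
  push_cast at h
  simpa only [one_div] using h

/-- `κ(n) = n / φ(n)`, as a product over the primes dividing `n`. -/
noncomputable def totientRatio (n : ℕ) : ℝ := ∏ p ∈ n.primeFactors, (1 - 1 / (p : ℝ))⁻¹

theorem one_sub_inv_prime_pos {p : ℕ} (hp : p.Prime) : 0 < 1 - 1 / (p : ℝ) := by
  have : (1 : ℝ) < p := by exact_mod_cast hp.one_lt
  rw [sub_pos, div_lt_one (by linarith)]
  exact this

theorem one_le_inv_one_sub_inv_prime {p : ℕ} (hp : p.Prime) : 1 ≤ (1 - 1 / (p : ℝ))⁻¹ := by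
  refine (one_le_inv₀ (one_sub_inv_prime_pos hp)).mpr ?_
  have : (0 : ℝ) ≤ 1 / p := by positivity
  linarith

theorem one_le_prod_real {ι : Type*} {s : Finset ι} {f : ι → ℝ} (h : ∀ i ∈ s, 1 ≤ f i) :
    1 ≤ ∏ i ∈ s, f i :=
  prod_induction f (1 ≤ ·) (fun _ _ => one_le_mul_of_one_le_of_one_le) le_rfl h

theorem one_le_totientRatio (n : ℕ) : 1 ≤ totientRatio n :=
  one_le_prod_real fun _ hp => one_le_inv_one_sub_inv_prime (Nat.prime_of_mem_primeFactors hp)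

theorem totientRatio_mul_le {a b : ℕ} (ha : a ≠ 0) (hb : b ≠ 0) :
    totientRatio (a * b) ≤ totientRatio a * totientRatio b := by
  rw [totientRatio, Nat.primeFactors_mul ha hb, totientRatio, totientRatio,
    ← prod_union_inter]
  refine le_mul_of_one_le_right ?_ ?_
  · exact prod_nonneg fun p hp => by
      rcases mem_union.mp hp with h | h <;>
      exact zero_le_one.trans (one_le_inv_one_sub_inv_prime (Nat.prime_of_mem_primeFactors h))
  · exact one_le_prod_real fun p hp => one_le_inv_one_sub_inv_prime
      (Nat.prime_of_mem_primeFactors (mem_inter.mp hp).1)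

/-- Lower bound for the Selberg sum in dimension two. Coprimality to `D` costs `totientRatio D`,
squarefreeness a factor `2`, both before squaring; the passage to `τ(m)/m` costs another `2`, hence
the `8`. -/
theorem sq_log_le_sum_card_divisors_div {D : ℕ} (Q : ℕ) :
    Real.log Q ^ 2 / (8 * totientRatio D ^ 2) ≤
      ∑ m ∈ Icc 1 (Q ^ 2) with Squarefree m ∧ ∀ p ∈ D.primeFactors, ¬ p ∣ m,
        (m.divisors.card : ℝ) / m := by
  have hS : ∀ p ∈ D.primeFactors, p.Prime := fun p => Nat.prime_of_mem_primeFactors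
  have h1 := prod_mul_sum_inv_le _ hS Q
  have h2 := sum_inv_le_two_mul_sum_squarefree D.primeFactors Q
  have h3 := sq_sum_squarefree_inv_le _ hS Q
  have h4 := log_le_sum_Icc_inv Q
  have hk : 0 < totientRatio D := zero_lt_one.trans_le (one_le_totientRatio D)
  have hprod : ∏ p ∈ D.primeFactors, (1 - 1 / (p : ℝ)) = (totientRatio D)⁻¹ := by
    rw [totientRatio, prod_inv_distrib, inv_inv]
  rw [hprod] at h1
  have h5 : Real.log Q / totientRatio D ≤
      2 * ∑ n ∈ Icc 1 Q with Squarefree n ∧ ∀ p ∈ D.primeFactors, ¬ p ∣ n, (1 : ℝ) / n := by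
    refine le_trans ?_ (h1.trans h2)
    rw [div_eq_inv_mul]
    gcongr
  have h6 : 0 ≤ Real.log Q / totientRatio D := div_nonneg (Real.log_natCast_nonneg Q) hk.le
  have h7 := pow_le_pow_left₀ h6 h5 2
  rw [div_pow, mul_pow] at h7
  have h8 : Real.log Q ^ 2 / (8 * totientRatio D ^ 2) =
      (Real.log Q ^ 2 / totientRatio D ^ 2) / 8 := by field_simp
  rw [h8]
  linarith

end CoprimeHarmonic

/-! ### Sieving the product `(dk + 1)(dl + 1)`. -/

section LinearFormsSieve

open Finset BoundingSieve

/-- The density `τ(n) / n` of the sieve for a product of two linear forms. -/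
noncomputable def divisorDensity : ArithmeticFunction ℝ :=
  ⟨fun n => (n.divisors.card : ℝ) / n, by simp⟩

theorem divisorDensity_apply (n : ℕ) : divisorDensity n = (n.divisors.card : ℝ) / n := rfl

theorem divisorDensity_isMultiplicative : divisorDensity.IsMultiplicative := by
  refine ArithmeticFunction.IsMultiplicative.iff_ne_zero.mpr ⟨by simp [divisorDensity_apply], ?_⟩
  intro m n hm hn h
  rw [divisorDensity_apply, divisorDensity_apply, divisorDensity_apply, h.card_divisors_mul]
  push_cast
  rw [mul_div_mul_comm]

/-- The product of the primes up to `R` that do not divide `D`. -/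
noncomputable def primeProductAvoiding (D R : ℕ) : ℕ :=
  ∏ p ∈ (Icc 1 R).filter (fun p => p.Prime ∧ ¬ p ∣ D), p

theorem squarefree_primeProductAvoiding (D R : ℕ) : Squarefree (primeProductAvoiding D R) := by
  refine Finset.squarefree_prod_of_pairwise_isCoprime ?_ ?_
  · intro p hp q hq hpq
    simp only [coe_filter, Set.mem_ofPred_eq] at hp hq
    exact Nat.coprime_iff_isRelPrime.mp ((Nat.coprime_primes hp.2.1 hq.2.1).mpr hpq)
  · intro p hp
    exact (mem_filter.mp hp).2.1.prime.squarefree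

theorem prime_dvd_primeProductAvoiding {D R p : ℕ} (hp : p.Prime) :
    p ∣ primeProductAvoiding D R ↔ p ≤ R ∧ ¬ p ∣ D := by
  rw [primeProductAvoiding, hp.prime.dvd_finsetProd_iff]
  constructor
  · rintro ⟨q, hq, hpq⟩
    have hq' := mem_filter.mp hq
    rw [(Nat.prime_dvd_prime_iff_eq hp hq'.2.1).mp hpq]
    exact ⟨(mem_Icc.mp hq'.1).2, hq'.2.2⟩
  · rintro ⟨h1, h2⟩
    exact ⟨p, mem_filter.mpr ⟨mem_Icc.mpr ⟨hp.one_le, h1⟩, hp, h2⟩, dvd_rfl⟩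

theorem two_dvd_mul_mul_sub (k l : ℕ) : 2 ∣ k * l * (l - k) := by
  rcases Nat.even_or_odd k with hk | hk
  · exact ((even_iff_two_dvd.mp hk).mul_right l).mul_right _
  rcases Nat.even_or_odd l with hl | hl
  · exact ((even_iff_two_dvd.mp hl).mul_left k).mul_right _
  · exact (even_iff_two_dvd.mp (Nat.Odd.sub_odd hl hk)).mul_left _

/-- The sieve for `(kd + 1)(ld + 1)`, `N ≤ d < 2N`, by the primes up to `Q ^ 2`. -/
noncomputable def linearFormsSieve (k l N Q : ℕ) : BoundingSieve where
  support := (Ico N (2 * N)).image fun d => (d * k + 1) * (d * l + 1)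
  prodPrimes := primeProductAvoiding (k * l * (l - k)) (Q ^ 2)
  prodPrimes_squarefree := squarefree_primeProductAvoiding _ _
  weights := 1
  weights_nonneg := fun _ => zero_le_one
  totalMass := N
  nu := divisorDensity
  nu_mult := divisorDensity_isMultiplicative
  nu_pos_of_prime := fun p hp _ => by
    have := hp.pos
    rw [divisorDensity_apply]
    have : 0 < p.divisors.card := card_pos.mpr ⟨1, Nat.one_mem_divisors.mpr hp.ne_zero⟩
    positivity
  nu_lt_one_of_prime := fun p hp hpd => by
    have hp2 : p ≠ 2 := by
      rintro rfl
      exact ((prime_dvd_primeProductAvoiding hp).mp hpd).2 (two_dvd_mul_mul_sub k l)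
    have h3 : (2 : ℝ) < p := by exact_mod_cast lt_of_le_of_ne hp.two_le hp2.symm
    rw [divisorDensity_apply, hp.divisors, card_pair hp.ne_one.symm, div_lt_one (by linarith)]
    exact_mod_cast h3

/-- Allows the sieve to run over the set of values with weight `1`, no value arising twice. -/
theorem linearForms_injective {k l : ℕ} (hk : 0 < k) :
    Function.Injective fun d : ℕ => (d * k + 1) * (d * l + 1) := by
  refine StrictMono.injective fun a b hab => ?_
  have h1 : a * k + 1 < b * k + 1 := by
    have := Nat.mul_lt_mul_of_pos_right hab hk
    omega
  have h2 : a * l + 1 ≤ b * l + 1 := by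
    have := Nat.mul_le_mul_right l hab.le
    omega
  exact Nat.mul_lt_mul_of_lt_of_le h1 h2 (by omega)

theorem abs_card_Ico_modEq_sub_le (N c : ℕ) {m : ℕ} (hm : 0 < m) :
    |(((Ico N (2 * N)).filter fun d => d ≡ c [MOD m]).card : ℝ) - N / m| ≤ 1 := by
  have h := Nat.Ico_filter_modEq_card N (2 * N) hm c
  have hm' : (0 : ℚ) < m := by exact_mod_cast hm
  set n := ((Ico N (2 * N)).filter fun d => d ≡ c [MOD m]).card
  have key : |(n : ℚ) - N / m| ≤ 1 := by
    have hn : (n : ℚ) = max ((⌈(((2 * N : ℕ) : ℚ) - c) / m⌉ : ℚ) - ⌈((N : ℚ) - c) / m⌉) 0 := by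
      exact_mod_cast h
    have e : (((2 * N : ℕ) : ℚ) - c) / m = ((N : ℚ) - c) / m + N / m := by
      push_cast; field_simp; ring
    have a1 := Int.le_ceil ((((2 * N : ℕ) : ℚ) - c) / m)
    have a2 := Int.ceil_lt_add_one ((((2 * N : ℕ) : ℚ) - c) / m)
    have b1 := Int.le_ceil (((N : ℚ) - c) / m)
    have b2 := Int.ceil_lt_add_one (((N : ℚ) - c) / m)
    have hN : (0 : ℚ) ≤ N / m := by positivity
    rw [abs_le, hn]
    constructor
    · have := le_max_left ((⌈(((2 * N : ℕ) : ℚ) - c) / m⌉ : ℚ) - ⌈((N : ℚ) - c) / m⌉) 0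
      linarith
    · rcases max_cases ((⌈(((2 * N : ℕ) : ℚ) - c) / m⌉ : ℚ) - ⌈((N : ℚ) - c) / m⌉) 0 with h | h <;>
      linarith [h.1]
  have h2 : ((|(n : ℚ) - N / m| : ℚ) : ℝ) ≤ ((1 : ℚ) : ℝ) := Rat.cast_le.mpr key
  push_cast at h2
  exact h2

theorem exists_dvd_mul_add_one_iff {k u : ℕ} (hu : 0 < u) (h : k.Coprime u) :
    ∃ c : ℕ, ∀ d : ℕ, u ∣ d * k + 1 ↔ d ≡ c [MOD u] := by
  have : NeZero u := ⟨hu.ne'⟩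
  have hk := ZMod.coe_mul_inv_eq_one k h
  refine ⟨(-(k : ZMod u)⁻¹).val, fun d => ?_⟩
  rw [← ZMod.natCast_eq_zero_iff, ← ZMod.natCast_eq_natCast_iff, ZMod.natCast_zmod_val]
  push_cast
  constructor
  · intro hd
    calc (d : ZMod u) = (d * k + 1) * (k : ZMod u)⁻¹ - (k : ZMod u)⁻¹ -
          d * ((k : ZMod u) * (k : ZMod u)⁻¹ - 1) := by ring
      _ = _ := by rw [hd, hk]; ring
  · intro hd
    rw [hd, neg_mul, mul_comm, hk]; ring

theorem abs_card_linearForms_sub_le (N : ℕ) {k l u v : ℕ} (hu : 0 < u) (hv : 0 < v)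
    (huv : u.Coprime v) (hk : k.Coprime u) (hl : l.Coprime v) :
    |(((Ico N (2 * N)).filter fun d => u ∣ d * k + 1 ∧ v ∣ d * l + 1).card : ℝ) -
      N / (u * v : ℕ)| ≤ 1 := by
  obtain ⟨a, ha⟩ := exists_dvd_mul_add_one_iff hu hk
  obtain ⟨b, hb⟩ := exists_dvd_mul_add_one_iff hv hl
  have hc := (Nat.chineseRemainder huv a b).2
  have : ((Ico N (2 * N)).filter fun d => u ∣ d * k + 1 ∧ v ∣ d * l + 1) =
      (Ico N (2 * N)).filter fun d => d ≡ (Nat.chineseRemainder huv a b) [MOD u * v] := by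
    refine filter_congr fun d _ => ?_
    rw [ha, hb, ← Nat.modEq_and_modEq_iff_modEq_mul huv]
    exact ⟨fun h => ⟨h.1.trans hc.1.symm, h.2.trans hc.2.symm⟩,
      fun h => ⟨h.1.trans hc.1, h.2.trans hc.2⟩⟩
  rw [this]
  exact abs_card_Ico_modEq_sub_le N _ (Nat.mul_pos hu hv)

/-- When no prime of `m` divides both `x` and `y`, the divisibility `m ∣ x * y` splits in exactly
one way as `u ∣ x`, `m / u ∣ y`, namely with `u = gcd m x`. -/
theorem sum_divisors_ite_dvd_and_div_dvd {m x y : ℕ} (hm : 0 < m)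
    (h : ∀ q : ℕ, q.Prime → q ∣ m → q ∣ x → ¬ q ∣ y) :
    ∑ u ∈ m.divisors, (if u ∣ x ∧ m / u ∣ y then (1 : ℝ) else 0) =
      if m ∣ x * y then 1 else 0 := by
  have hcop : ∀ a b : ℕ, a ∣ m → a ∣ y → b ∣ x → a.Coprime b := fun a b h1 h2 h3 =>
    Nat.Coprime.symm <| Nat.coprime_of_dvd fun q hq hqb hqa =>
      h q hq (hqa.trans h1) (hqb.trans h3) (hqa.trans h2)
  split_ifs with hd
  · have hg := Nat.gcd_pos_of_pos_left x hm
    rw [sum_eq_single (m.gcd x)]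
    · refine if_pos ⟨Nat.gcd_dvd_right _ _, ?_⟩
      have h1 : m / m.gcd x ∣ (x / m.gcd x) * y := by
        rw [Nat.div_mul_right_comm (Nat.gcd_dvd_right m x)]
        exact Nat.div_dvd_div (Nat.gcd_dvd_left m x) hd
      exact (Nat.coprime_div_gcd_div_gcd hg).dvd_of_dvd_mul_left h1
    · intro u hu hne
      refine if_neg fun ⟨h1, h2⟩ => hne ?_
      have hum := Nat.dvd_of_mem_divisors hu
      refine Nat.dvd_antisymm (Nat.dvd_gcd hum h1) ?_
      have h3 : (m.gcd x) ∣ u * (m / u) := by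
        rw [Nat.mul_div_cancel' hum]; exact Nat.gcd_dvd_left _ _
      exact (hcop _ _ (Nat.div_dvd_of_dvd hum) h2
        (Nat.gcd_dvd_right m x)).symm.dvd_of_dvd_mul_right h3
    · intro h; exact absurd (Nat.mem_divisors.mpr ⟨Nat.gcd_dvd_left _ _, hm.ne'⟩) h
  · refine sum_eq_zero fun u hu => if_neg fun ⟨h1, h2⟩ => hd ?_
    rw [← Nat.mul_div_cancel' (Nat.dvd_of_mem_divisors hu)]
    exact mul_dvd_mul h1 h2

theorem coprime_of_dvd_primeProductAvoiding {D R m a : ℕ} (hm : m ∣ primeProductAvoiding D R)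
    (ha : a ∣ D) : a.Coprime m :=
  Nat.coprime_of_dvd fun _ hq hqa hqm =>
    ((prime_dvd_primeProductAvoiding hq).mp (hqm.trans hm)).2 (hqa.trans ha)

/-- A prime dividing both forms divides `l(dk + 1) - k(dl + 1) = l - k`, so it is not a sieving
prime. The condition `m ∣ (dk + 1)(dl + 1)` is therefore a disjoint union over `u ∣ m` of conditions
that are single residue classes modulo `m`. Each class has error at most `1`, and `τ(m) ≤ m`. -/
theorem abs_rem_linearFormsSieve_le {k l N Q m : ℕ} (hk : 0 < k)
    (hm : m ∣ (linearFormsSieve k l N Q).prodPrimes) :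
    |(linearFormsSieve k l N Q).rem m| ≤ m := by
  have hm' : m ∣ primeProductAvoiding (k * l * (l - k)) (Q ^ 2) := hm
  have hsq := squarefree_of_dvd_prodPrimes hm
  have hm0 : 0 < m := Nat.pos_of_ne_zero hsq.ne_zero
  have hq : ∀ d q : ℕ, q.Prime → q ∣ m → q ∣ d * k + 1 → ¬ q ∣ d * l + 1 := by
    intro d q hq hqm h1 h2
    have h3 : q ∣ l * (d * k + 1) - k * (d * l + 1) :=
      Nat.dvd_sub (h1.mul_left l) (h2.mul_left k)
    have h4 : l * (d * k + 1) - k * (d * l + 1) = l - k := by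
      rw [show l * (d * k + 1) = k * (d * l) + l by ring,
        show k * (d * l + 1) = k * (d * l) + k by ring, Nat.add_sub_add_left]
    rw [h4] at h3
    exact ((prime_dvd_primeProductAvoiding hq).mp (hqm.trans hm')).2 (h3.mul_left _)
  have hmult : (linearFormsSieve k l N Q).multSum m =
      ∑ u ∈ m.divisors,
        (((Ico N (2 * N)).filter fun d => u ∣ d * k + 1 ∧ m / u ∣ d * l + 1).card : ℝ) := by
    simp only [multSum, linearFormsSieve, Pi.one_apply]
    rw [sum_image fun a _ b _ h => linearForms_injective hk h]
    calc _ = ∑ d ∈ Ico N (2 * N), ∑ u ∈ m.divisors,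
          (if u ∣ d * k + 1 ∧ m / u ∣ d * l + 1 then (1 : ℝ) else 0) :=
          sum_congr rfl fun d _ => (sum_divisors_ite_dvd_and_div_dvd hm0 (hq d)).symm
      _ = _ := by
          rw [sum_comm]
          refine sum_congr rfl fun u _ => ?_
          rw [sum_boole]
  have hnu : (linearFormsSieve k l N Q).nu m * (linearFormsSieve k l N Q).totalMass =
      ∑ u ∈ m.divisors, (N : ℝ) / m := by
    simp only [linearFormsSieve, divisorDensity_apply, sum_const, nsmul_eq_mul]
    ring
  rw [rem, hmult, hnu, ← sum_sub_distrib]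
  refine (abs_sum_le_sum_abs _ _).trans ?_
  calc _ ≤ ∑ u ∈ m.divisors, (1 : ℝ) := by
        refine sum_le_sum fun u hu => ?_
        have hum := Nat.dvd_of_mem_divisors hu
        have hprod : u * (m / u) = m := Nat.mul_div_cancel' hum
        have hu0 := Nat.pos_of_dvd_of_pos hum hm0
        have hv0 := Nat.div_pos (Nat.le_of_dvd hm0 hum) hu0
        have := abs_card_linearForms_sub_le N hu0 hv0
          (Nat.coprime_of_squarefree_mul (hprod.symm ▸ hsq))
          (coprime_of_dvd_primeProductAvoiding (hum.trans hm')
            ((dvd_mul_right k l).mul_right (l - k)))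
          (coprime_of_dvd_primeProductAvoiding ((Nat.div_dvd_of_dvd hum).trans hm')
            ((dvd_mul_left l k).mul_right (l - k)))
        rwa [hprod] at this
    _ = m.divisors.card := by simp
    _ ≤ m := by exact_mod_cast Nat.card_divisors_le_self m

theorem nu_le_selbergTerms {s : BoundingSieve} {m : ℕ} (hm : m ∣ s.prodPrimes) :
    s.nu m ≤ s.selbergTerms m := by
  rw [selbergTerms_apply]
  refine le_mul_of_one_le_right (nu_pos_of_dvd_prodPrimes hm).le (one_le_prod_real fun p hp => ?_)
  have hp' := Nat.prime_of_mem_primeFactors hp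
  have hd := (Nat.dvd_of_mem_primeFactors hp).trans hm
  have h1 := s.nu_pos_of_prime p hp' hd
  have h2 := s.nu_lt_one_of_prime p hp' hd
  exact (one_le_inv₀ (by linarith)).mpr (by linarith)

theorem le_selbergSum_linearFormsSieve {k l N Q : ℕ} (hk : 0 < k) (hkl : k < l) :
    Real.log Q ^ 2 / (8 * totientRatio (k * l * (l - k)) ^ 2) ≤
      selbergSum (linearFormsSieve k l N Q) (Q ^ 2) := by
  have hD : k * l * (l - k) ≠ 0 :=
    (Nat.mul_pos (Nat.mul_pos hk (by omega)) (by omega)).ne'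
  refine (sq_log_le_sum_card_divisors_div Q).trans ?_
  calc _ ≤ ∑ m ∈ sieveModuli (linearFormsSieve k l N Q) (Q ^ 2),
        (m.divisors.card : ℝ) / m := by
        refine sum_le_sum_of_subset_of_nonneg (fun m hm => ?_) fun _ _ _ => by positivity
        simp only [mem_filter, mem_Icc] at hm
        obtain ⟨⟨h1, h2⟩, h3, h4⟩ := hm
        refine mem_sieveModuli.mpr ⟨?_, h2⟩
        rw [← Nat.prod_primeFactors_of_squarefree h3]
        change ∏ p ∈ m.primeFactors, p ∣ primeProductAvoiding (k * l * (l - k)) (Q ^ 2)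
        rw [primeProductAvoiding]
        refine prod_dvd_prod_of_subset _ _ (fun p : ℕ => p) fun p hp => ?_
        have hp' := Nat.prime_of_mem_primeFactors hp
        have hpm := Nat.dvd_of_mem_primeFactors hp
        exact mem_filter.mpr ⟨mem_Icc.mpr ⟨hp'.one_le, (Nat.le_of_dvd h1 hpm).trans h2⟩, hp',
          fun hd => h4 p (Nat.mem_primeFactors.mpr ⟨hp', hd, hD⟩) hpm⟩
    _ ≤ _ := sum_le_sum fun m hm => nu_le_selbergTerms (mem_sieveModuli.mp hm).1

/-- An upper bound of the right order for the number of `d ∈ [N, 2N)` such that `dk + 1` and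
`dl + 1` are both prime. -/
theorem card_both_prime_le {k l N Q : ℕ} (hk : 0 < k) (hkl : k < l) (hQ : 2 ≤ Q)
    (hQN : Q ^ 2 ≤ N) :
    (((Ico N (2 * N)).filter fun d => (d * k + 1).Prime ∧ (d * l + 1).Prime).card : ℝ) ≤
      8 * N * totientRatio (k * l * (l - k)) ^ 2 / Real.log Q ^ 2 + (Q : ℝ) ^ 12 := by
  set s := linearFormsSieve k l N Q with hs
  have hQ2 : 1 ≤ Q ^ 2 := Nat.one_le_pow _ _ (by omega)
  have hlog : 0 < Real.log Q := Real.log_pos (by exact_mod_cast hQ)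
  have hκ := zero_lt_one.trans_le (one_le_totientRatio (k * l * (l - k)))
  have h1 : (((Ico N (2 * N)).filter fun d =>
      (d * k + 1).Prime ∧ (d * l + 1).Prime).card : ℝ) ≤ s.siftedSum := by
    have hsift : s.siftedSum = ∑ n ∈ (Ico N (2 * N)).image fun d => (d * k + 1) * (d * l + 1),
        (if (primeProductAvoiding (k * l * (l - k)) (Q ^ 2)).Coprime n then (1 : ℝ) else 0) := rfl
    rw [hsift, sum_image fun a _ b _ h => linearForms_injective hk h, ← sum_boole]
    refine sum_le_sum fun d hd => ?_
    have hdN := (mem_Ico.mp hd).1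
    by_cases hp : (d * k + 1).Prime ∧ (d * l + 1).Prime
    · rw [if_pos hp, if_pos]
      -- A prime `da + 1` exceeds `N ≥ Q^2`, so it is not a sieving prime and survives the sieve.
      have hbig : ∀ a : ℕ, 0 < a → (d * a + 1).Prime →
          (primeProductAvoiding (k * l * (l - k)) (Q ^ 2)).Coprime (d * a + 1) := by
        intro a ha hpa
        refine ((Nat.Prime.coprime_iff_not_dvd hpa).mpr fun hdv => ?_).symm
        have := ((prime_dvd_primeProductAvoiding hpa).mp hdv).1
        have := Nat.le_mul_of_pos_right d ha
        omega
      exact Nat.Coprime.mul_right (hbig k hk hp.1) (hbig l (by omega) hp.2)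
    · rw [if_neg hp]
      split_ifs <;> simp
  have h2 : (N : ℝ) / selbergSum s (Q ^ 2) ≤
      8 * N * totientRatio (k * l * (l - k)) ^ 2 / Real.log Q ^ 2 := by
    have hL := le_selbergSum_linearFormsSieve (N := N) (Q := Q) hk hkl
    have : 8 * N * totientRatio (k * l * (l - k)) ^ 2 / Real.log Q ^ 2 =
      N / (Real.log Q ^ 2 / (8 * totientRatio (k * l * (l - k)) ^ 2)) := by field_simp
    rw [this]
    exact div_le_div_of_nonneg_left (Nat.cast_nonneg N) (by positivity) hL
  -- At most `Q^2 · Q^2` pairs, each with weights at most `Q^2 · Q^2` and remainder at most `d₁ d₂ ≤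
  -- Q^4`.
  have h3 : ∑ d₁ ∈ sieveModuli s (Q ^ 2), ∑ d₂ ∈ sieveModuli s (Q ^ 2),
      (s.nu d₁)⁻¹ * (s.nu d₂)⁻¹ * |s.rem (d₁.lcm d₂)| ≤ (Q : ℝ) ^ 12 := by
    have hinv : ∀ d ∈ sieveModuli s (Q ^ 2), (s.nu d)⁻¹ ≤ (Q : ℝ) ^ 2 := by
      intro d hd
      have hd' := mem_sieveModuli.mp hd
      have hd0 : d ≠ 0 := ne_zero_of_dvd_ne_zero s.prodPrimes_ne_zero hd'.1
      have hc : (1 : ℝ) ≤ d.divisors.card := by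
        exact_mod_cast card_pos.mpr ⟨1, Nat.one_mem_divisors.mpr hd0⟩
      have : s.nu d = (d.divisors.card : ℝ) / d := rfl
      rw [this, inv_div]
      exact (div_le_self (Nat.cast_nonneg d) hc).trans (by exact_mod_cast hd'.2)
    have hcard : ((sieveModuli s (Q ^ 2)).card : ℝ) ≤ (Q : ℝ) ^ 2 := by
      have : sieveModuli s (Q ^ 2) ⊆ Icc 1 (Q ^ 2) := fun d hd => by
        have hd' := mem_sieveModuli.mp hd
        exact mem_Icc.mpr ⟨Nat.pos_of_ne_zero
          (ne_zero_of_dvd_ne_zero s.prodPrimes_ne_zero hd'.1), hd'.2⟩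
      have := card_le_card this
      rw [Nat.card_Icc, Nat.add_sub_cancel] at this
      exact_mod_cast this
    have hinv0 : ∀ d ∈ sieveModuli s (Q ^ 2), 0 ≤ (s.nu d)⁻¹ := fun d hd =>
      (inv_pos.mpr (nu_pos_of_dvd_prodPrimes (mem_sieveModuli.mp hd).1)).le
    calc _ ≤ ∑ d₁ ∈ sieveModuli s (Q ^ 2), ∑ d₂ ∈ sieveModuli s (Q ^ 2), (Q : ℝ) ^ 8 := by
          refine sum_le_sum fun d₁ h₁ => sum_le_sum fun d₂ h₂ => ?_
          have e₁ := mem_sieveModuli.mp h₁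
          have e₂ := mem_sieveModuli.mp h₂
          have hrem : |s.rem (d₁.lcm d₂)| ≤ (Q : ℝ) ^ 4 := by
            refine (abs_rem_linearFormsSieve_le hk (Nat.lcm_dvd e₁.1 e₂.1)).trans ?_
            have hd0 : d₁ ≠ 0 := ne_zero_of_dvd_ne_zero s.prodPrimes_ne_zero e₁.1
            have hd0' : d₂ ≠ 0 := ne_zero_of_dvd_ne_zero s.prodPrimes_ne_zero e₂.1
            have : d₁.lcm d₂ ≤ d₁ * d₂ := Nat.le_of_dvd
              (Nat.mul_pos (Nat.pos_of_ne_zero hd0) (Nat.pos_of_ne_zero hd0'))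
              (Nat.lcm_dvd (dvd_mul_right _ _) (dvd_mul_left _ _))
            have h5 : d₁.lcm d₂ ≤ Q ^ 4 := this.trans
              ((Nat.mul_le_mul e₁.2 e₂.2).trans (by rw [← pow_add]))
            exact_mod_cast h5
          calc _ ≤ (Q : ℝ) ^ 2 * (Q : ℝ) ^ 2 * (Q : ℝ) ^ 4 :=
                mul_le_mul (mul_le_mul (hinv _ h₁) (hinv _ h₂) (hinv0 _ h₂) (by positivity)) hrem
                  (abs_nonneg _) (by positivity)
            _ = _ := by ring
      _ = ((sieveModuli s (Q ^ 2)).card : ℝ) * (((sieveModuli s (Q ^ 2)).card : ℝ) *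
            (Q : ℝ) ^ 8) := by simp only [sum_const, nsmul_eq_mul]
      _ ≤ (Q : ℝ) ^ 2 * ((Q : ℝ) ^ 2 * (Q : ℝ) ^ 8) := by gcongr
      _ = _ := by ring
  have h4 := siftedSum_le_selberg s hQ2
  have hmass : s.totalMass = N := rfl
  rw [hmass] at h4
  linarith

end LinearFormsSieve

/-! ### Moments of `n / φ(n)`. -/

section TotientRatioMoments

open Finset

theorem prod_primeFactors_one_add (g : ℕ → ℝ) {n : ℕ} (hn : n ≠ 0) :
    ∏ p ∈ n.primeFactors, (1 + g p) =
      ∑ e ∈ n.divisors with Squarefree e, ∏ p ∈ e.primeFactors, g p := by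
  rw [prod_one_add]
  refine sum_nbij' (fun t => ∏ p ∈ t, p) (fun e => e.primeFactors) ?_ ?_ ?_ ?_ ?_
  · intro t ht
    have ht' := mem_powerset.mp ht
    have hp : ∀ p ∈ t, p.Prime := fun p h => Nat.prime_of_mem_primeFactors (ht' h)
    refine mem_filter.mpr ⟨Nat.mem_divisors.mpr ⟨?_, hn⟩, ?_⟩
    · exact (prod_dvd_prod_of_subset _ _ (fun p : ℕ => p) ht').trans (Nat.prod_primeFactors_dvd n)
    · refine Finset.squarefree_prod_of_pairwise_isCoprime ?_ fun p h => (hp p h).prime.squarefree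
      intro p h q h' hpq
      exact Nat.coprime_iff_isRelPrime.mp ((Nat.coprime_primes (hp p h) (hp q h')).mpr hpq)
  · intro e he
    exact mem_powerset.mpr (Nat.primeFactors_mono
      (Nat.dvd_of_mem_divisors (mem_filter.mp he).1) hn)
  · intro t ht
    exact Nat.primeFactors_prod fun p h =>
      Nat.prime_of_mem_primeFactors (mem_powerset.mp ht h)
  · intro e he
    exact Nat.prod_primeFactors_of_squarefree (mem_filter.mp he).2
  · intro t ht
    rw [Nat.primeFactors_prod fun p h => Nat.prime_of_mem_primeFactors (mem_powerset.mp ht h)]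

theorem prod_rpow_primeFactors {e : ℕ} (he : Squarefree e) (s : ℝ) :
    ∏ p ∈ e.primeFactors, (p : ℝ) ^ s = (e : ℝ) ^ s := by
  rw [Real.finsetProd_rpow _ _ fun p _ => Nat.cast_nonneg p]
  rw [← Nat.cast_prod, Nat.prod_primeFactors_of_squarefree he]

/-- The local factor `(1 - 1/p)^(-6)` is `1 + O(1/p)`, hence at most `1 + p^(-1/2)` for large `p`;
each of the primes below a bound `B` costs at most `2^6`. The expanded product is a sum over
squarefree divisors. The exponent `6` is what separating three squared factors requires. -/
theorem totientRatio_pow_six_le :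
    ∃ C : ℝ, 0 < C ∧ ∀ n : ℕ, n ≠ 0 →
      totientRatio n ^ 6 ≤ C * ∑ e ∈ n.divisors, (e : ℝ) ^ (-(1 / 2) : ℝ) := by
  -- `126 = 2(2^6 - 1)`: with `u = 2/p ≤ 1` one has `(1 + u)^6 ≤ 1 + 63u`.
  have hlim : Tendsto (fun p : ℕ => ((126 : ℝ) / (p : ℝ) ^ (1 / 2 : ℝ))) atTop (nhds 0) :=
    ((tendsto_rpow_atTop (by norm_num : (0 : ℝ) < 1 / 2)).comp
      tendsto_natCast_atTop_atTop).const_div_atTop 126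
  obtain ⟨B, hB⟩ := eventually_atTop.mp (hlim.eventually_le_const (zero_lt_one (α := ℝ)))
  have hfac : ∀ p : ℕ, p.Prime → ((1 - 1 / (p : ℝ))⁻¹) ^ 6 ≤
      (if p < B then 64 else 1) * (1 + (p : ℝ) ^ (-(1 / 2) : ℝ)) := by
    intro p hp
    have hp0 : (0 : ℝ) < p := by exact_mod_cast hp.pos
    have hp2 : 1 / (p : ℝ) ≤ 1 / 2 :=
      one_div_le_one_div_of_le two_pos (by exact_mod_cast hp.two_le)
    set x := 1 / (p : ℝ) with hx
    have hx0 : 0 ≤ x := by positivity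
    have h1 : (1 - x)⁻¹ ≤ 1 + 2 * x := by
      rw [inv_le_iff_one_le_mul₀ (by linarith)]
      nlinarith
    have h1' : 0 ≤ (1 - x)⁻¹ := inv_nonneg.mpr (by linarith)
    have hr : (0 : ℝ) ≤ (p : ℝ) ^ (-(1 / 2) : ℝ) := by positivity
    have h2 : ((1 - x)⁻¹) ^ 6 ≤ (1 + 2 * x) ^ 6 := pow_le_pow_left₀ h1' h1 6
    split_ifs with hpB
    · have : (1 + 2 * x) ^ 6 ≤ 2 ^ 6 := pow_le_pow_left₀ (by linarith) (by linarith) 6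
      linarith
    · have h3 : (1 + 2 * x) ^ 6 ≤ 1 + 126 * x := by
        have hu : (2 * x) ≤ 1 := by linarith
        have hu0 : 0 ≤ 2 * x := by linarith
        have hpow : ∀ k : ℕ, (2 * x) ^ (k + 1) ≤ 2 * x := fun k => by
          rw [pow_succ]
          exact mul_le_of_le_one_left hu0 (pow_le_one₀ hu0 hu)
        have e : (1 + 2 * x) ^ 6 = 1 + 6 * (2 * x) + 15 * (2 * x) ^ 2 + 20 * (2 * x) ^ 3 +
          15 * (2 * x) ^ 4 + 6 * (2 * x) ^ 5 + (2 * x) ^ 6 := by ring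
        rw [e]
        have p2 : (2 * x) ^ 2 ≤ 2 * x := hpow 1
        have p3 : (2 * x) ^ 3 ≤ 2 * x := hpow 2
        have p4 : (2 * x) ^ 4 ≤ 2 * x := hpow 3
        have p5 : (2 * x) ^ 5 ≤ 2 * x := hpow 4
        have p6 : (2 * x) ^ 6 ≤ 2 * x := hpow 5
        linarith
      have h4 := hB p (not_lt.mp hpB)
      have h5 : 126 * x = 126 / (p : ℝ) ^ (1 / 2 : ℝ) * (p : ℝ) ^ (-(1 / 2) : ℝ) := by
        rw [div_mul_eq_mul_div, eq_div_iff (by positivity), hx, mul_assoc, Real.rpow_neg hp0.le]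
        have : (p : ℝ) = (p : ℝ) ^ (1 / 2 : ℝ) * (p : ℝ) ^ (1 / 2 : ℝ) := by
          rw [← Real.rpow_add hp0]; norm_num
        have h6 : 0 < (p : ℝ) ^ (1 / 2 : ℝ) := by positivity
        congr 1
        rw [one_div, inv_mul_eq_iff_eq_mul₀ hp0.ne']
        nth_rw 2 [this]
        field_simp
      have h6 : 126 * x ≤ (p : ℝ) ^ (-(1 / 2) : ℝ) := by
        rw [h5]; exact mul_le_of_le_one_left hr h4
      linarith
  refine ⟨64 ^ B, by positivity, fun n hn => ?_⟩
  calc totientRatio n ^ 6 = ∏ p ∈ n.primeFactors, ((1 - 1 / (p : ℝ))⁻¹) ^ 6 := by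
        rw [totientRatio, prod_pow]
    _ ≤ ∏ p ∈ n.primeFactors, ((if p < B then 64 else 1) * (1 + (p : ℝ) ^ (-(1 / 2) : ℝ))) :=
        prod_le_prod (fun p hp => by
          have := one_le_inv_one_sub_inv_prime (Nat.prime_of_mem_primeFactors hp)
          positivity) fun p hp => hfac p (Nat.prime_of_mem_primeFactors hp)
    _ = 64 ^ (n.primeFactors.filter (· < B)).card *
          ∏ p ∈ n.primeFactors, (1 + (p : ℝ) ^ (-(1 / 2) : ℝ)) := by
        rw [prod_mul_distrib, prod_ite]; simp
    _ ≤ 64 ^ B * ∑ e ∈ n.divisors, (e : ℝ) ^ (-(1 / 2) : ℝ) := by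
        rw [prod_primeFactors_one_add (fun p => (p : ℝ) ^ (-(1 / 2) : ℝ)) hn]
        have h1 : (n.primeFactors.filter (· < B)).card ≤ B := by
          have : n.primeFactors.filter (· < B) ⊆ range B := fun p hp =>
            mem_range.mpr (mem_filter.mp hp).2
          simpa using card_le_card this
        refine mul_le_mul (pow_le_pow_right₀ (by norm_num) h1) ?_
          (sum_nonneg fun e _ => prod_nonneg fun p _ => by positivity) (by positivity)
        · calc _ = ∑ e ∈ n.divisors with Squarefree e, (e : ℝ) ^ (-(1 / 2) : ℝ) :=
                sum_congr rfl fun e he => prod_rpow_primeFactors (mem_filter.mp he).2 _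
            _ ≤ _ := sum_le_sum_of_subset_of_nonneg (filter_subset _ _)
                fun _ _ _ => by positivity

/-- Boundedness on logarithmic average: after exchanging sums and writing `n = em`, the sum over `e`
is dominated by the convergent `∑ e^(-3/2)`. -/
theorem sum_Icc_totientRatio_pow_six_div_le :
    ∃ C : ℝ, 0 < C ∧ ∀ K : ℕ,
      ∑ n ∈ Icc 1 K, totientRatio n ^ 6 / n ≤ C * ∑ n ∈ Icc 1 K, (1 : ℝ) / n := by
  obtain ⟨C, hC, h⟩ := totientRatio_pow_six_le
  have hsum : Summable fun e : ℕ => (e : ℝ) ^ (-(3 / 2) : ℝ) :=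
    Real.summable_nat_rpow.mpr (by norm_num)
  refine ⟨C * (∑' e : ℕ, (e : ℝ) ^ (-(3 / 2) : ℝ) + 1), mul_pos hC (add_pos_of_nonneg_of_pos
    (tsum_nonneg fun _ => by positivity) one_pos), fun K => ?_⟩
  have hH : 0 ≤ ∑ n ∈ Icc 1 K, (1 : ℝ) / n := sum_nonneg fun _ _ => by positivity
  calc ∑ n ∈ Icc 1 K, totientRatio n ^ 6 / n
      ≤ ∑ n ∈ Icc 1 K, C * ∑ e ∈ n.divisors, (e : ℝ) ^ (-(1 / 2) : ℝ) / n := by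
        refine sum_le_sum fun n hn => ?_
        rw [← sum_div, ← mul_div_assoc]
        exact div_le_div_of_nonneg_right (h n (by have := (mem_Icc.mp hn).1; omega))
          (Nat.cast_nonneg n)
    _ = C * ∑ x ∈ (Icc 1 K).sigma fun n => n.divisors,
          (x.2 : ℝ) ^ (-(1 / 2) : ℝ) / x.1 := by rw [← mul_sum, sum_sigma]
    _ ≤ C * ∑ x ∈ Icc 1 K ×ˢ Icc 1 K, (x.1 : ℝ) ^ (-(3 / 2) : ℝ) * (1 / x.2) := by
        refine mul_le_mul_of_nonneg_left ?_ hC.le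
        refine sum_le_sum_of_injOn_of_le (fun x => (x.2, x.1 / x.2)) ?_ ?_ ?_ ?_
        · rintro ⟨n, e⟩ hx
          simp only [mem_sigma, mem_Icc, Nat.mem_divisors, mem_product] at hx ⊢
          obtain ⟨⟨h1, h2⟩, h3, _⟩ := hx
          have he := Nat.pos_of_dvd_of_pos h3 h1
          exact ⟨⟨he, (Nat.le_of_dvd h1 h3).trans h2⟩, Nat.div_pos (Nat.le_of_dvd h1 h3) he,
            (Nat.div_le_self _ _).trans h2⟩
        · rintro ⟨n, e⟩ hx ⟨n', e'⟩ hx' heq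
          simp only [coe_sigma, Set.mem_sigma_iff, mem_coe, Nat.mem_divisors] at hx hx'
          simp only [Prod.mk.injEq] at heq
          obtain ⟨rfl, h2⟩ := heq
          rw [(Nat.div_left_inj hx.2.1 hx'.2.1).mp h2]
        · rintro ⟨n, e⟩ hx
          simp only [mem_sigma, mem_Icc, Nat.mem_divisors] at hx
          obtain ⟨⟨h1, h2⟩, h3, _⟩ := hx
          have he := Nat.pos_of_dvd_of_pos h3 h1
          have he' : (0 : ℝ) < e := by exact_mod_cast he
          have hn' : (0 : ℝ) < n := by exact_mod_cast h1
          apply le_of_eq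
          simp only
          rw [Nat.cast_div h3 he'.ne', show (-(1 / 2) : ℝ) = -(3 / 2) + 1 by norm_num,
            Real.rpow_add he', Real.rpow_one]
          field_simp
        · intro x _; positivity
    _ = C * ((∑ e ∈ Icc 1 K, (e : ℝ) ^ (-(3 / 2) : ℝ)) * ∑ n ∈ Icc 1 K, (1 : ℝ) / n) := by
        rw [sum_product, sum_mul_sum]
    _ ≤ C * ((∑' e : ℕ, (e : ℝ) ^ (-(3 / 2) : ℝ) + 1) * ∑ n ∈ Icc 1 K, (1 : ℝ) / n) := by
        have := hsum.sum_le_tsum (Icc 1 K) fun _ _ => by positivity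
        gcongr
        linarith
    _ = _ := by ring

/-- The pairs `k < l ≤ K` of positive integers. -/
def orderedPairs (K : ℕ) : Finset (ℕ × ℕ) := (Icc 1 K ×ˢ Icc 1 K).filter fun x => x.1 < x.2

theorem sq_mul_sq_mul_sq_le (x y z : ℝ) :
    x ^ 2 * y ^ 2 * z ^ 2 ≤ x ^ 6 + y ^ 6 + z ^ 6 := by
  have key : ∀ a b c m : ℝ, 0 ≤ a → 0 ≤ b → 0 ≤ c → a ≤ m → b ≤ m → c ≤ m →
      a * b * c ≤ m ^ 3 := by
    intro a b c m ha hb hc h1 h2 h3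
    calc a * b * c ≤ m * m * m := mul_le_mul (mul_le_mul h1 h2 hb (ha.trans h1)) h3 hc
          (mul_nonneg (ha.trans h1) (ha.trans h1))
      _ = m ^ 3 := by ring
  have hx := sq_nonneg x
  have hy := sq_nonneg y
  have hz := sq_nonneg z
  have ex : (x ^ 2) ^ 3 = x ^ 6 := by ring
  have ey : (y ^ 2) ^ 3 = y ^ 6 := by ring
  have ez : (z ^ 2) ^ 3 = z ^ 6 := by ring
  have px : 0 ≤ x ^ 6 := ex ▸ pow_nonneg hx 3
  have py : 0 ≤ y ^ 6 := ey ▸ pow_nonneg hy 3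
  have pz : 0 ≤ z ^ 6 := ez ▸ pow_nonneg hz 3
  rcases le_total (x ^ 2) (y ^ 2) with h1 | h1
  · rcases le_total (y ^ 2) (z ^ 2) with h2 | h2
    · linarith [key _ _ _ _ hx hy hz (h1.trans h2) h2 le_rfl]
    · linarith [key _ _ _ _ hx hy hz h1 le_rfl h2]
  · rcases le_total (x ^ 2) (z ^ 2) with h2 | h2
    · linarith [key _ _ _ _ hx hy hz h2 (h1.trans h2) le_rfl]
    · linarith [key _ _ _ _ hx hy hz le_rfl h1 h2]

/-- By submultiplicativity and `sq_mul_sq_mul_sq_le` the weight is at most the sum of the sixth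
powers at `k`, `l` and `l - k`, which turns the double sum into three products of single sums. -/
theorem sum_orderedPairs_totientRatio_le :
    ∃ C : ℝ, 0 < C ∧ ∀ K : ℕ, 1 ≤ K →
      ∑ x ∈ orderedPairs K, totientRatio (x.1 * x.2 * (x.2 - x.1)) ^ 2 / (x.1 * x.2) ≤
        C * (1 + Real.log K) ^ 2 := by
  obtain ⟨C, hC, h⟩ := sum_Icc_totientRatio_pow_six_div_le
  refine ⟨3 * C, by positivity, fun K hK => ?_⟩
  set H := ∑ n ∈ Icc 1 K, (1 : ℝ) / n with hH
  set G := ∑ n ∈ Icc 1 K, totientRatio n ^ 6 / n with hG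
  have hG0 : 0 ≤ G := sum_nonneg fun n _ => by
    have := one_le_totientRatio n
    positivity
  have hH0 : 0 ≤ H := sum_nonneg fun n _ => by positivity
  have hnn : ∀ n : ℕ, 0 ≤ totientRatio n := fun n => zero_le_one.trans (one_le_totientRatio n)
  have hGH : G * H = ∑ x ∈ Icc 1 K ×ˢ Icc 1 K, totientRatio x.1 ^ 6 / x.1 * (1 / x.2) := by
    rw [hG, hH, sum_mul_sum, sum_product]
  have t1 : ∑ x ∈ orderedPairs K, totientRatio x.1 ^ 6 / x.1 * (1 / x.2) ≤ G * H := by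
    rw [hGH]
    refine sum_le_sum_of_subset_of_nonneg (filter_subset _ _) fun x _ _ => ?_
    have := hnn x.1
    positivity
  have t2 : ∑ x ∈ orderedPairs K, totientRatio x.2 ^ 6 / x.2 * (1 / x.1) ≤ G * H := by
    rw [hGH]
    refine sum_le_sum_of_injOn_of_le Prod.swap ?_ (Prod.swap_injective.injOn) ?_ ?_
    · intro x hx
      have := mem_product.mp (mem_filter.mp hx).1
      exact mem_product.mpr ⟨this.2, this.1⟩
    · intro x _; exact le_rfl
    · intro x _
      have := hnn x.1
      positivity
  have t3 : ∑ x ∈ orderedPairs K, totientRatio (x.2 - x.1) ^ 6 / x.2 * (1 / x.1) ≤ G * H := by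
    rw [hGH]
    -- The pair `(k, l)` is replaced by `(l - k, k)`, using `1/l ≤ 1/(l - k)`.
    refine sum_le_sum_of_injOn_of_le (fun x => (x.2 - x.1, x.1)) ?_ ?_ ?_ ?_
    · intro x hx
      simp only [orderedPairs, mem_filter, mem_product, mem_Icc] at hx ⊢
      omega
    · intro x hx y hy hxy
      have hx' := (mem_filter.mp (mem_coe.mp hx)).2
      have hy' := (mem_filter.mp (mem_coe.mp hy)).2
      simp only [Prod.mk.injEq] at hxy
      ext <;> omega
    · intro x hx
      have hx' := (mem_filter.mp hx).2
      have hpos : (0 : ℝ) < ((x.2 - x.1 : ℕ) : ℝ) := by exact_mod_cast Nat.sub_pos_of_lt hx'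
      have hle : ((x.2 - x.1 : ℕ) : ℝ) ≤ x.2 := by exact_mod_cast Nat.sub_le _ _
      have := hnn (x.2 - x.1)
      gcongr
    · intro x _
      have := hnn x.1
      positivity
  have hK0 : H ≤ 1 + Real.log K := sum_Icc_inv_le K
  calc _ ≤ ∑ x ∈ orderedPairs K, (totientRatio x.1 ^ 6 / x.1 * (1 / x.2) +
        totientRatio x.2 ^ 6 / x.2 * (1 / x.1) +
        totientRatio (x.2 - x.1) ^ 6 / x.2 * (1 / x.1)) := by
        refine sum_le_sum fun x hx => ?_
        simp only [orderedPairs, mem_filter, mem_product, mem_Icc] at hx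
        have h1 : (0 : ℝ) < x.1 := by exact_mod_cast hx.1.1.1
        have h2 : (0 : ℝ) < x.2 := by exact_mod_cast hx.1.2.1
        have e : totientRatio x.1 ^ 6 / x.1 * (1 / x.2) +
            totientRatio x.2 ^ 6 / x.2 * (1 / x.1) +
            totientRatio (x.2 - x.1) ^ 6 / x.2 * (1 / x.1) =
            (totientRatio x.1 ^ 6 + totientRatio x.2 ^ 6 + totientRatio (x.2 - x.1) ^ 6) /
              (x.1 * x.2) := by field_simp
        rw [e]
        refine div_le_div_of_nonneg_right ?_ (by positivity)
        refine le_trans ?_ (sq_mul_sq_mul_sq_le _ _ _)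
        rw [← mul_pow, ← mul_pow]
        refine pow_le_pow_left₀ (hnn _) ?_ 2
        refine (totientRatio_mul_le (Nat.mul_pos hx.1.1.1 hx.1.2.1).ne' (by omega)).trans ?_
        exact mul_le_mul_of_nonneg_right (totientRatio_mul_le (by omega) (by omega)) (hnn _)
    _ ≤ 3 * (G * H) := by
        rw [sum_add_distrib, sum_add_distrib]
        linarith
    _ ≤ 3 * (C * H * H) := by
        have := h K
        gcongr
    _ = 3 * C * H ^ 2 := by ring
    _ ≤ _ := by gcongr

end TotientRatioMoments

/-! ### Mean squares over cofactors in a dyadic range of moduli. -/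

section NearPairs

open Finset

theorem primeCounting_le_div_log {x : ℝ} (hx : 1 < x) :
    (Nat.primeCounting ⌊x⌋₊ : ℝ) ≤ 8 * x / Real.log x := by
  have h := Chebyshev.pi_le_log4_mul_div hx
  have hlog : 0 < Real.log x := Real.log_pos hx
  have h4 : Real.log 4 ≤ 3 := by
    have := Real.log_le_sub_one_of_pos (show (0 : ℝ) < 4 by norm_num)
    linarith
  have hs : 0 < √x := Real.sqrt_pos.mpr (by linarith)
  have hsq : √x * √x = x := Real.mul_self_sqrt (by linarith)
  have hl : Real.log x ≤ 2 * √x := by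
    have h1 := Real.log_le_sub_one_of_pos hs
    rw [Real.log_sqrt (by linarith)] at h1
    linarith
  rw [Real.log_sqrt (by linarith)] at h
  have h1 : Real.log 4 * x / (Real.log x / 2) ≤ 6 * x / Real.log x := by
    rw [div_div_eq_mul_div]
    gcongr ?_ / _
    nlinarith
  have h2 : √x ≤ 2 * x / Real.log x := by
    rw [le_div_iff₀ hlog]
    nlinarith
  have h3 : 8 * x / Real.log x = 6 * x / Real.log x + 2 * x / Real.log x := by ring
  linarith

/-- Chebyshev's bound for all primes up to `2^(i+1) k`, forgetting the congruence modulo `k`. The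
lost factor is harmless: the diagonal terms carry `1/k^2`, and `∑ 1/k` remains. -/
theorem card_prime_mul_add_one_le (i : ℕ) {k : ℕ} (hk : 0 < k) :
    (((Ico (2 ^ i) (2 * 2 ^ i)).filter fun d => (d * k + 1).Prime).card : ℝ) ≤
      32 * 2 ^ i * k / (i + 1) := by
  have h1 : ((Ico (2 ^ i) (2 * 2 ^ i)).filter fun d => (d * k + 1).Prime).card ≤
      Nat.primeCounting (2 ^ (i + 1) * k) := by
    rw [← Nat.primesLE_card_eq_primeCounting]
    refine card_le_card_of_injOn (fun d => d * k + 1) (fun d hd => ?_) fun a _ b _ hab => ?_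
    · have hd' := mem_filter.mp hd
      have h2 := (mem_Ico.mp hd'.1).2
      refine Nat.mem_primesLE.mpr ⟨?_, hd'.2⟩
      have : (d + 1) * k ≤ 2 ^ (i + 1) * k := Nat.mul_le_mul_right k (by rw [pow_succ]; omega)
      nlinarith
    · exact Nat.eq_of_mul_eq_mul_right hk (Nat.succ_injective hab)
  have hk1 : (1 : ℝ) ≤ k := by exact_mod_cast hk
  have hp : (1 : ℝ) ≤ 2 ^ i := one_le_pow₀ (by norm_num)
  have hx : (1 : ℝ) < 2 ^ (i + 1) * k := by
    rw [pow_succ]; nlinarith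
  have h2 := primeCounting_le_div_log hx
  have hfl : ⌊(2 : ℝ) ^ (i + 1) * k⌋₊ = 2 ^ (i + 1) * k := by
    rw [show (2 : ℝ) ^ (i + 1) * k = ((2 ^ (i + 1) * k : ℕ) : ℝ) by push_cast; rfl,
      Nat.floor_natCast]
  rw [hfl] at h2
  have hlog : ((i : ℝ) + 1) / 2 ≤ Real.log (2 ^ (i + 1) * k) := by
    rw [Real.log_mul (by positivity) (by linarith), Real.log_pow]
    have := Real.log_two_gt_d9
    have := Real.log_nonneg hk1
    push_cast
    nlinarith
  calc _ ≤ (Nat.primeCounting (2 ^ (i + 1) * k) : ℝ) := by exact_mod_cast h1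
    _ ≤ _ := h2
    _ ≤ 8 * (2 ^ (i + 1) * k) / (((i : ℝ) + 1) / 2) :=
        div_le_div_of_nonneg_left (by positivity) (by positivity) hlog
    _ = _ := by rw [pow_succ]; field_simp; ring

theorem sq_sum_eq_diag_add_orderedPairs (K : ℕ) (f : ℕ → ℝ) :
    (∑ k ∈ Icc 1 K, f k) ^ 2 =
      ∑ k ∈ Icc 1 K, f k ^ 2 + 2 * ∑ x ∈ orderedPairs K, f x.1 * f x.2 := by
  have hswap : ∑ x ∈ (Icc 1 K ×ˢ Icc 1 K).filter (fun x => x.2 < x.1), f x.1 * f x.2 =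
      ∑ x ∈ orderedPairs K, f x.1 * f x.2 := by
    refine sum_nbij' Prod.swap Prod.swap ?_ ?_ ?_ ?_ ?_
    · intro x hx; simp only [orderedPairs, mem_filter, mem_product] at hx ⊢; exact
        ⟨⟨hx.1.2, hx.1.1⟩, hx.2⟩
    · intro x hx; simp only [orderedPairs, mem_filter, mem_product] at hx ⊢; exact
        ⟨⟨hx.1.2, hx.1.1⟩, hx.2⟩
    · intro x _; simp
    · intro x _; simp
    · intro x _; simp [mul_comm]
  have hdiag : ∑ x ∈ (Icc 1 K ×ˢ Icc 1 K).filter (fun x => x.1 = x.2), f x.1 * f x.2 =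
      ∑ k ∈ Icc 1 K, f k ^ 2 := by
    refine sum_nbij' (fun x => x.1) (fun k => (k, k)) ?_ ?_ ?_ ?_ ?_
    · intro x hx; exact (mem_product.mp (mem_filter.mp hx).1).1
    · intro k hk; exact mem_filter.mpr ⟨mem_product.mpr ⟨hk, hk⟩, rfl⟩
    · intro x hx; ext
      · rfl
      · exact (mem_filter.mp hx).2
    · intro k _; rfl
    · intro x hx; rw [(mem_filter.mp hx).2, sq]
  have e1 := sum_filter_add_sum_filter_not (Icc 1 K ×ˢ Icc 1 K) (fun x => x.1 < x.2)
    (fun x => f x.1 * f x.2)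
  have e2 := sum_filter_add_sum_filter_not ((Icc 1 K ×ˢ Icc 1 K).filter (fun x => ¬ x.1 < x.2))
    (fun x => x.1 = x.2) (fun x => f x.1 * f x.2)
  have f1 : ((Icc 1 K ×ˢ Icc 1 K).filter (fun x => ¬ x.1 < x.2)).filter (fun x => x.1 = x.2) =
      (Icc 1 K ×ˢ Icc 1 K).filter (fun x => x.1 = x.2) := by
    rw [filter_filter]; exact filter_congr fun x _ => by omega
  have f2 : ((Icc 1 K ×ˢ Icc 1 K).filter (fun x => ¬ x.1 < x.2)).filter (fun x => ¬ x.1 = x.2) =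
      (Icc 1 K ×ˢ Icc 1 K).filter (fun x => x.2 < x.1) := by
    rw [filter_filter]; exact filter_congr fun x _ => by omega
  rw [f1, f2, hswap, hdiag] at e2
  rw [sq, sum_mul_sum, ← sum_product', ← e1, ← e2, orderedPairs]
  ring

/-- The contribution of `2^i ≤ d < 2^(i+1)` and cofactors `k ≤ K` to the mean square. -/
noncomputable def dyadicCofactorSum (i K : ℕ) : ℝ :=
  ∑ d ∈ Ico ((2 : ℕ) ^ i) (2 * 2 ^ i),
    1 / (d : ℝ) * (∑ k ∈ Icc 1 K, if (d * k + 1).Prime then 1 / (k : ℝ) else 0) ^ 2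

/-- After opening the square, the diagonal `k = l` is bounded by Chebyshev and gives the linear
term; the pairs `k < l` are bounded by the sieve, averaged with `sum_orderedPairs_totientRatio_le`,
and give the quadratic term. -/
theorem dyadicCofactorSum_le :
    ∃ C : ℝ, 0 < C ∧ ∀ i K : ℕ, 16 ≤ i → 1 ≤ K →
      dyadicCofactorSum i K ≤ C * ((1 + Real.log K) / i + ((1 + Real.log K) / i) ^ 2) := by
  obtain ⟨C, hC, hpairs⟩ := sum_orderedPairs_totientRatio_le
  refine ⟨32 + 2 * (8 * 64 ^ 2 * C + 1024), by positivity, fun i K hi hK => ?_⟩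
  have hi0 : (0 : ℝ) < i := by exact_mod_cast (by omega : 0 < i)
  have hlogK : 0 ≤ Real.log K := Real.log_natCast_nonneg K
  -- With `Q = 2^q` and `16q ≤ i`, the sieve error `Q^12` is smaller than `2^i` by a factor `16^q`,
  -- which beats `i^2`; yet `log Q ≥ i/64`, so the sieve still saves `i^2`.
  set q := i / 16 with hq
  set Q := 2 ^ q with hQ
  have hq1 : 1 ≤ q := by omega
  have hqi : (i : ℝ) / 32 ≤ q := by
    have : i ≤ 32 * q := by omega
    have : (i : ℝ) ≤ 32 * q := by exact_mod_cast this
    linarith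
  have hQ2 : 2 ≤ Q := by
    calc 2 = 2 ^ 1 := rfl
      _ ≤ 2 ^ q := Nat.pow_le_pow_right (by norm_num) hq1
  have hQi : Q ^ 2 ≤ 2 ^ i := by
    rw [hQ, ← pow_mul]
    exact Nat.pow_le_pow_right (by norm_num) (by omega)
  have hlogQ : (i : ℝ) / 64 ≤ Real.log Q := by
    rw [hQ]
    push_cast
    rw [Real.log_pow]
    have := Real.log_two_gt_d9
    nlinarith
  have hQ12 : (Q : ℝ) ^ 12 ≤ 2 ^ i * (1024 / (i : ℝ) ^ 2) := by
    have h1 : (q : ℝ) ^ 2 ≤ 16 ^ q := by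
      have : q ≤ 4 ^ q := (Nat.lt_pow_self (by norm_num)).le
      have h' : (q : ℝ) ≤ 4 ^ q := by exact_mod_cast this
      calc (q : ℝ) ^ 2 ≤ (4 ^ q) ^ 2 := by gcongr
        _ = 16 ^ q := by rw [← pow_mul, mul_comm, pow_mul]; norm_num
    have h2 : (Q : ℝ) ^ 12 * 16 ^ q ≤ 2 ^ i := by
      rw [hQ]
      push_cast
      rw [show (16 : ℝ) = 2 ^ 4 by norm_num, ← pow_mul, ← pow_mul, ← pow_add]
      exact pow_le_pow_right₀ (by norm_num) (by omega)
    have h3 : (i : ℝ) ^ 2 ≤ 1024 * 16 ^ q := by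
      calc (i : ℝ) ^ 2 ≤ (32 * q) ^ 2 := by gcongr; linarith
        _ = 1024 * (q : ℝ) ^ 2 := by ring
        _ ≤ _ := by gcongr
    rw [mul_div_assoc', le_div_iff₀ (by positivity)]
    calc (Q : ℝ) ^ 12 * (i : ℝ) ^ 2 ≤ (Q : ℝ) ^ 12 * (1024 * 16 ^ q) := by gcongr
      _ = 1024 * ((Q : ℝ) ^ 12 * 16 ^ q) := by ring
      _ ≤ 1024 * 2 ^ i := by gcongr
      _ = _ := by ring
  have hexp : dyadicCofactorSum i K ≤ 1 / 2 ^ i *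
      (∑ k ∈ Icc 1 K, 1 / (k : ℝ) ^ 2 *
        (((Ico (2 ^ i) (2 * 2 ^ i)).filter fun d => (d * k + 1).Prime).card : ℝ) +
       2 * ∑ x ∈ orderedPairs K, 1 / ((x.1 : ℝ) * x.2) *
        (((Ico (2 ^ i) (2 * 2 ^ i)).filter fun d =>
          (d * x.1 + 1).Prime ∧ (d * x.2 + 1).Prime).card : ℝ)) := by
    calc dyadicCofactorSum i K ≤ ∑ d ∈ Ico ((2 : ℕ) ^ i) (2 * 2 ^ i), 1 / 2 ^ i *
          (∑ k ∈ Icc 1 K, 1 / (k : ℝ) ^ 2 * (if (d * k + 1).Prime then 1 else 0) +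
          2 * ∑ x ∈ orderedPairs K, 1 / ((x.1 : ℝ) * x.2) *
            (if (d * x.1 + 1).Prime ∧ (d * x.2 + 1).Prime then 1 else 0)) := by
          refine sum_le_sum fun d hd => ?_
          have hd1 : (2 : ℝ) ^ i ≤ d := by exact_mod_cast (mem_Ico.mp hd).1
          refine mul_le_mul (one_div_le_one_div_of_le (by positivity) hd1) (le_of_eq ?_)
            (sq_nonneg _) (by positivity)
          rw [sq_sum_eq_diag_add_orderedPairs]
          congr 1
          · refine sum_congr rfl fun k _ => ?_
            split_ifs <;> simp
          · congr 1
            refine sum_congr rfl fun x _ => ?_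
            by_cases h1 : (d * x.1 + 1).Prime <;> by_cases h2 : (d * x.2 + 1).Prime <;>
              simp [h1, h2, mul_comm]
      _ = _ := by
          rw [← mul_sum, sum_add_distrib, sum_comm, ← mul_sum,
            sum_comm (s := Ico ((2 : ℕ) ^ i) (2 * 2 ^ i)) (t := orderedPairs K)]
          simp only [← mul_sum, sum_boole]
  refine hexp.trans ?_
  have hp : (0 : ℝ) < 2 ^ i := by positivity
  have hdiag : ∑ k ∈ Icc 1 K, 1 / (k : ℝ) ^ 2 *
        (((Ico (2 ^ i) (2 * 2 ^ i)).filter fun d => (d * k + 1).Prime).card : ℝ) ≤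
      2 ^ i * (32 * ((1 + Real.log K) / i)) := by
    calc _ ≤ ∑ k ∈ Icc 1 K, 32 * 2 ^ i / i * (1 / (k : ℝ)) := by
          refine sum_le_sum fun k hk => ?_
          have hk' := (mem_Icc.mp hk).1
          have hk0 : (0 : ℝ) < k := by exact_mod_cast hk'
          calc _ ≤ 1 / (k : ℝ) ^ 2 * (32 * 2 ^ i * k / (i + 1)) := by
                gcongr; exact card_prime_mul_add_one_le i hk'
            _ ≤ 1 / (k : ℝ) ^ 2 * (32 * 2 ^ i * k / i) := by gcongr; linarith
            _ = _ := by field_simp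
      _ = 32 * 2 ^ i / i * ∑ k ∈ Icc 1 K, (1 / (k : ℝ)) := by rw [mul_sum]
      _ ≤ 32 * 2 ^ i / i * (1 + Real.log K) := by gcongr; exact sum_Icc_inv_le K
      _ = _ := by ring
  have hoff : ∑ x ∈ orderedPairs K, 1 / ((x.1 : ℝ) * x.2) *
        (((Ico (2 ^ i) (2 * 2 ^ i)).filter fun d =>
          (d * x.1 + 1).Prime ∧ (d * x.2 + 1).Prime).card : ℝ) ≤
      2 ^ i * ((8 * 64 ^ 2 * C + 1024) * ((1 + Real.log K) / i) ^ 2) := by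
    have hcard : ∀ x ∈ orderedPairs K, (((Ico (2 ^ i) (2 * 2 ^ i)).filter fun d =>
          (d * x.1 + 1).Prime ∧ (d * x.2 + 1).Prime).card : ℝ) ≤
        2 ^ i * (8 * 64 ^ 2 / (i : ℝ) ^ 2) * totientRatio (x.1 * x.2 * (x.2 - x.1)) ^ 2 +
          2 ^ i * (1024 / (i : ℝ) ^ 2) := by
      intro x hx
      simp only [orderedPairs, mem_filter, mem_product, mem_Icc] at hx
      refine (card_both_prime_le (Q := Q) hx.1.1.1 hx.2 hQ2 hQi).trans (add_le_add ?_ hQ12)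
      push_cast
      calc _ ≤ 8 * 2 ^ i * totientRatio (x.1 * x.2 * (x.2 - x.1)) ^ 2 / ((i : ℝ) / 64) ^ 2 := by
            gcongr
        _ = _ := by field_simp
    calc _ ≤ ∑ x ∈ orderedPairs K, (2 ^ i * (8 * 64 ^ 2 / (i : ℝ) ^ 2) *
          (totientRatio (x.1 * x.2 * (x.2 - x.1)) ^ 2 / (x.1 * x.2)) +
          2 ^ i * (1024 / (i : ℝ) ^ 2) * (1 / x.1 * (1 / x.2))) := by
          refine sum_le_sum fun x hx => ?_
          refine (mul_le_mul_of_nonneg_left (hcard x hx) (by positivity)).trans (le_of_eq ?_)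
          ring
      _ = 2 ^ i * (8 * 64 ^ 2 / (i : ℝ) ^ 2) * ∑ x ∈ orderedPairs K,
            (totientRatio (x.1 * x.2 * (x.2 - x.1)) ^ 2 / (x.1 * x.2)) +
          2 ^ i * (1024 / (i : ℝ) ^ 2) * ∑ x ∈ orderedPairs K, (1 / (x.1 : ℝ) * (1 / x.2)) := by
          rw [sum_add_distrib, mul_sum, mul_sum]
      _ ≤ 2 ^ i * (8 * 64 ^ 2 / (i : ℝ) ^ 2) * (C * (1 + Real.log K) ^ 2) +
          2 ^ i * (1024 / (i : ℝ) ^ 2) * (1 + Real.log K) ^ 2 := by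
          have h1 := hpairs K hK
          have h2 : ∑ x ∈ orderedPairs K, (1 / (x.1 : ℝ) * (1 / x.2)) ≤ (1 + Real.log K) ^ 2 := by
            calc _ ≤ ∑ x ∈ Icc 1 K ×ˢ Icc 1 K, (1 / (x.1 : ℝ) * (1 / x.2)) :=
                  sum_le_sum_of_subset_of_nonneg (filter_subset _ _)
                    fun _ _ _ => by positivity
              _ = (∑ k ∈ Icc 1 K, 1 / (k : ℝ)) ^ 2 := by rw [sum_product, sq, sum_mul_sum]
              _ ≤ _ := pow_le_pow_left₀ (sum_nonneg fun _ _ => by positivity)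
                  (sum_Icc_inv_le K) 2
          gcongr
      _ = _ := by field_simp
  calc _ ≤ 1 / 2 ^ i * (2 ^ i * (32 * ((1 + Real.log K) / i)) +
        2 * (2 ^ i * ((8 * 64 ^ 2 * C + 1024) * ((1 + Real.log K) / i) ^ 2))) := by gcongr
    _ = 32 * ((1 + Real.log K) / i) +
        2 * (8 * 64 ^ 2 * C + 1024) * ((1 + Real.log K) / i) ^ 2 := by field_simp
    _ ≤ _ := by
        have h1 : 0 ≤ (1 + Real.log K) / i := by positivity
        nlinarith [mul_nonneg (by positivity : (0 : ℝ) ≤ 2 * (8 * 64 ^ 2 * C + 1024)) h1,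
          sq_nonneg ((1 + Real.log K) / i)]

end NearPairs

/-! ### The contribution of blocks close to the modulus. -/

section NearPart

open Finset

/-- `∑ 1/(p-1)` over the primes `p ≡ 1 (mod d)` in the dyadic block `(2^j, 2^(j+1)]`. -/
noncomputable def blockSum (j d : ℕ) : ℝ :=
  ∑ p ∈ (Ioc (2 ^ j) (2 ^ (j + 1))).filter (fun p => p.Prime ∧ d ∣ p - 1), 1 / ((p : ℝ) - 1)

/-- The block `j` is far from the modulus `d`: `d` is at most `2^(j(1-ε))`. -/
def IsFarBlock (ε : ℝ) (d j : ℕ) : Prop := 1 ≤ j ∧ (d : ℝ) ≤ (2 : ℝ) ^ ((j : ℝ) * (1 - ε))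

open Classical in
/-- The part of `∑ 1/(p-1)`, `p ≡ 1 (mod d)`, from the blocks close to `d`. -/
noncomputable def nearSum (ε : ℝ) (J d : ℕ) : ℝ :=
  ∑ j ∈ range J with ¬ IsFarBlock ε d j, blockSum j d

open Classical in
/-- The part of `∑ 1/(p-1)`, `p ≡ 1 (mod d)`, from the blocks far from `d`. -/
noncomputable def farSum (ε : ℝ) (J d : ℕ) : ℝ :=
  ∑ j ∈ range J with IsFarBlock ε d j, blockSum j d

theorem blockSum_nonneg (j d : ℕ) : 0 ≤ blockSum j d :=
  sum_nonneg fun p hp => by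
    have : (1 : ℝ) ≤ p := by exact_mod_cast (mem_filter.mp hp).2.1.one_le
    exact div_nonneg zero_le_one (by linarith)

theorem nearSum_nonneg (ε : ℝ) (J d : ℕ) : 0 ≤ nearSum ε J d :=
  sum_nonneg fun _ _ => blockSum_nonneg _ _

/-- The bound for the cofactor `(p-1)/d` when `p` is close to `d < 2^(i+1)`. -/
noncomputable def cofactorBound (ε : ℝ) (i : ℕ) : ℕ :=
  ⌊2 * (2 : ℝ) ^ (2 * ε * ((i : ℝ) + 1))⌋₊

theorem one_le_cofactorBound {ε : ℝ} (hε : 0 ≤ ε) (i : ℕ) : 1 ≤ cofactorBound ε i := by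
  refine Nat.le_floor ?_
  have : (1 : ℝ) ≤ (2 : ℝ) ^ (2 * ε * ((i : ℝ) + 1)) :=
    Real.one_le_rpow (by norm_num) (by positivity)
  push_cast
  linarith

theorem log_cofactorBound_le {ε : ℝ} (hε : 0 ≤ ε) (i : ℕ) :
    Real.log (cofactorBound ε i) ≤ 1 + 2 * ε * ((i : ℝ) + 1) := by
  have h1 : (cofactorBound ε i : ℝ) ≤ 2 * (2 : ℝ) ^ (2 * ε * ((i : ℝ) + 1)) :=
    Nat.floor_le (by positivity)
  have h0 : (0 : ℝ) < cofactorBound ε i := by exact_mod_cast one_le_cofactorBound hε i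
  have h2 := Real.log_le_log h0 h1
  rw [Real.log_mul (by norm_num) (by positivity), Real.log_rpow two_pos] at h2
  have h3 := Real.log_two_lt_d9
  have h4 : 0 ≤ 2 * ε * ((i : ℝ) + 1) := by positivity
  nlinarith

/-- From `2^(j(1-ε)) < d < 2^(i+1)` and `ε ≤ 1/2` follows `j ≤ 2(i+1)`; then `dk < 2^(j+1)` gives `k
≤ 2 · 2^(jε) ≤ 2 · 2^(2ε(i+1))`. -/
theorem cofactor_le {ε : ℝ} (hε : 0 ≤ ε) (hε2 : ε ≤ 1 / 2) {i j d k : ℕ}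
    (hd1 : 0 < d) (hd2 : d < 2 * 2 ^ i) (hfar : ¬ IsFarBlock ε d j)
    (hk : d * k + 1 ≤ 2 ^ (j + 1)) : k ≤ cofactorBound ε i := by
  -- Block `0` contains only the prime `2` and always counts as near; there `k ≤ 1`.
  rcases Nat.eq_zero_or_pos j with rfl | hj
  · refine le_trans ?_ (one_le_cofactorBound hε i)
    have : k ≤ d * k := Nat.le_mul_of_pos_left k hd1
    rw [zero_add, pow_one] at hk
    omega
  have hd : (2 : ℝ) ^ ((j : ℝ) * (1 - ε)) < d := by
    by_contra! h
    exact hfar ⟨hj, h⟩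
  have hd0 : (0 : ℝ) < d := lt_trans (by positivity) hd
  have hdi : (d : ℝ) < (2 : ℝ) ^ ((i : ℝ) + 1) := by
    rw [Real.rpow_add two_pos, Real.rpow_one, Real.rpow_natCast, mul_comm]
    exact_mod_cast hd2
  have hji : (j : ℝ) * (1 - ε) < (i : ℝ) + 1 :=
    (Real.rpow_lt_rpow_left_iff (by norm_num : (1 : ℝ) < 2)).mp (hd.trans hdi)
  have hj0 : (0 : ℝ) ≤ j := Nat.cast_nonneg j
  have hje : (j : ℝ) * ε ≤ 2 * ε * ((i : ℝ) + 1) := by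
    have : (j : ℝ) ≤ 2 * ((i : ℝ) + 1) := by nlinarith
    calc (j : ℝ) * ε ≤ 2 * ((i : ℝ) + 1) * ε := by gcongr
      _ = _ := by ring
  refine Nat.le_floor ?_
  have h1 : (d : ℝ) * k ≤ 2 ^ (j + 1) := by
    have : d * k ≤ 2 ^ (j + 1) := by omega
    exact_mod_cast this
  have h2 : (2 : ℝ) ^ (j + 1) = 2 * ((2 : ℝ) ^ ((j : ℝ) * (1 - ε)) * (2 : ℝ) ^ ((j : ℝ) * ε)) := by
    rw [← Real.rpow_add two_pos, ← mul_add, sub_add_cancel, mul_one, Real.rpow_natCast, pow_succ,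
      mul_comm]
  have h3 : (2 : ℝ) ^ ((j : ℝ) * ε) ≤ (2 : ℝ) ^ (2 * ε * ((i : ℝ) + 1)) :=
    Real.rpow_le_rpow_of_exponent_le (by norm_num) hje
  have h4 : (0 : ℝ) < (2 : ℝ) ^ ((j : ℝ) * ε) := by positivity
  have h5 : (d : ℝ) * k ≤ d * (2 * (2 : ℝ) ^ (2 * ε * ((i : ℝ) + 1))) := by
    calc (d : ℝ) * k ≤ 2 * ((2 : ℝ) ^ ((j : ℝ) * (1 - ε)) * (2 : ℝ) ^ ((j : ℝ) * ε)) := h2 ▸ h1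
      _ ≤ 2 * (d * (2 : ℝ) ^ (2 * ε * ((i : ℝ) + 1))) := by gcongr
      _ = _ := by ring
  exact le_of_mul_le_mul_left h5 hd0

/-- Substituting `p = dk + 1` turns `1/(p-1)` into `1/(dk)`. The blocks are disjoint, so `k`
determines both the prime and its block. -/
theorem nearSum_le {ε : ℝ} (hε : 0 ≤ ε) (hε2 : ε ≤ 1 / 2) (J : ℕ) {i d : ℕ}
    (hd1 : 0 < d) (hd2 : d < 2 * 2 ^ i) :
    nearSum ε J d ≤ 1 / (d : ℝ) * ∑ k ∈ Icc 1 (cofactorBound ε i),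
      if (d * k + 1).Prime then 1 / (k : ℝ) else 0 := by
  have hd0 : (0 : ℝ) < d := by exact_mod_cast hd1
  unfold nearSum blockSum
  rw [sum_sigma', mul_sum]
  refine sum_le_sum_of_injOn_of_le (fun x => (x.2 - 1) / d) ?_ ?_ ?_ ?_
  · rintro ⟨j, p⟩ hx
    simp only [mem_sigma, mem_filter, mem_Ioc] at hx
    obtain ⟨⟨_, hfar⟩, ⟨_, hp2⟩, hp, hdp⟩ := hx
    obtain ⟨k, hk⟩ := hdp
    have hp1 := hp.two_le
    have hkd : (p - 1) / d = k := by rw [hk, Nat.mul_div_cancel_left _ hd1]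
    have hk0 : 0 < k := Nat.pos_of_ne_zero (by rintro rfl; omega)
    simp only [hkd]
    exact mem_Icc.mpr ⟨hk0, cofactor_le hε hε2 hd1 hd2 hfar (by omega)⟩
  · rintro ⟨j, p⟩ hx ⟨j', p'⟩ hx' he
    simp only [coe_sigma, Set.mem_sigma_iff, mem_coe, mem_filter, mem_Ioc] at hx hx'
    simp only at he
    have h1 := hx.2.2.1.two_le
    have h2 := hx'.2.2.1.two_le
    have h3 := (Nat.div_left_inj hx.2.2.2 hx'.2.2.2).mp he
    have hpp : p = p' := by omega
    subst hpp
    have hj : j = j' := by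
      have a1 := (Nat.pow_lt_pow_iff_right (a := 2) (by norm_num)).mp
        (hx.2.1.1.trans_le hx'.2.1.2)
      have a2 := (Nat.pow_lt_pow_iff_right (a := 2) (by norm_num)).mp
        (hx'.2.1.1.trans_le hx.2.1.2)
      omega
    rw [hj]
  · rintro ⟨j, p⟩ hx
    simp only [mem_sigma, mem_filter, mem_Ioc] at hx
    obtain ⟨_, _, hp, hdp⟩ := hx
    obtain ⟨k, hk⟩ := hdp
    have hp1 := hp.two_le
    have hkd : (p - 1) / d = k := by rw [hk, Nat.mul_div_cancel_left _ hd1]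
    have hpk : d * k + 1 = p := by omega
    simp only [hkd]
    rw [hpk, if_pos hp, ← hpk]
    push_cast
    rw [add_sub_cancel_right, one_div_mul_one_div]
  · intro k _
    split_ifs <;> positivity

/-- Group `d` by its binary length `i` and use `φ(d) ≤ d`. As `log K` is about `2εi`,
`dyadicCofactorSum_le` gives `O(ε)` for each large `i`. It matters that `C` precedes `ε`: only `B`,
which collects the small `i`, depends on `ε`. -/
theorem sum_totient_mul_nearSum_sq_le :
    ∃ C : ℝ, 0 < C ∧ ∀ ε : ℝ, 0 < ε → ε ≤ 1 / 4 → ∃ B : ℝ, ∀ J : ℕ,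
      ∑ d ∈ Icc 1 (2 ^ J), (d.totient : ℝ) * nearSum ε J d ^ 2 ≤ C * ε * J + B := by
  obtain ⟨C, hC, hdy⟩ := dyadicCofactorSum_le
  refine ⟨15 * C, by positivity, fun ε hε hε4 => ?_⟩
  set T : ℕ → ℝ := fun i => dyadicCofactorSum i (cofactorBound ε i) with hT
  have hT0 : ∀ i, 0 ≤ T i := fun i => sum_nonneg fun d _ => by positivity
  -- Beyond `1/ε` the additive constants are absorbed by `εi ≥ 1`, giving `x ≤ 6ε` below; then `x +
  -- x^2 ≤ 15ε` as `ε ≤ 1/4`.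
  obtain ⟨i₀, hi₀⟩ := exists_nat_ge (max 16 (1 / ε))
  have hTi : ∀ i, i₀ ≤ i → T i ≤ 15 * C * ε := by
    intro i hi
    have hi' : (i₀ : ℝ) ≤ i := by exact_mod_cast hi
    have h16 : (16 : ℝ) ≤ i := (le_max_left _ _).trans (hi₀.trans hi')
    have he : 1 / ε ≤ i := (le_max_right _ _).trans (hi₀.trans hi')
    have hi0 : (0 : ℝ) < i := by linarith
    have h1 := hdy i (cofactorBound ε i) (by exact_mod_cast h16) (one_le_cofactorBound hε.le i)
    have h2 := log_cofactorBound_le hε.le i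
    have h3 : 0 ≤ Real.log (cofactorBound ε i) := Real.log_natCast_nonneg _
    have h4 : 1 ≤ ε * i := by rwa [div_le_iff₀' hε] at he
    set x := (1 + Real.log (cofactorBound ε i)) / i with hx
    have hx0 : 0 ≤ x := by positivity
    have hx6 : x ≤ 6 * ε := by
      rw [hx, div_le_iff₀ hi0]
      nlinarith
    calc T i ≤ C * (x + x ^ 2) := h1
      _ ≤ C * (15 * ε) := by
          gcongr
          nlinarith
      _ = _ := by ring
  refine ⟨∑ i ∈ range i₀, T i + 15 * C * ε, fun J => ?_⟩
  calc ∑ d ∈ Icc 1 (2 ^ J), (d.totient : ℝ) * nearSum ε J d ^ 2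
      = ∑ i ∈ range (J + 1), ∑ d ∈ Icc 1 (2 ^ J) with Nat.log 2 d = i,
          (d.totient : ℝ) * nearSum ε J d ^ 2 := by
        refine (sum_fiberwise_of_maps_to (fun d hd => ?_) _).symm
        have hd' := mem_Icc.mp hd
        rw [mem_range, Nat.lt_succ_iff]
        calc Nat.log 2 d ≤ Nat.log 2 (2 ^ J) := Nat.log_mono_right hd'.2
          _ = J := Nat.log_pow (by norm_num) J
    _ ≤ ∑ i ∈ range (J + 1), T i := by
        refine sum_le_sum fun i _ => ?_
        calc _ ≤ ∑ d ∈ Icc 1 (2 ^ J) with Nat.log 2 d = i, 1 / (d : ℝ) *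
              (∑ k ∈ Icc 1 (cofactorBound ε i),
                if (d * k + 1).Prime then 1 / (k : ℝ) else 0) ^ 2 := by
              refine sum_le_sum fun d hd => ?_
              obtain ⟨hd1, hd2⟩ := mem_filter.mp hd
              have hd0 := (mem_Icc.mp hd1).1
              have hlt : d < 2 * 2 ^ i := by
                have := Nat.lt_pow_succ_log_self (b := 2) (by norm_num) d
                rw [hd2, pow_succ] at this
                omega
              have hdr : (0 : ℝ) < d := by exact_mod_cast hd0
              have h1 := nearSum_le hε.le (by linarith) J hd0 hlt
              calc (d.totient : ℝ) * nearSum ε J d ^ 2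
                  ≤ d * (1 / (d : ℝ) * ∑ k ∈ Icc 1 (cofactorBound ε i),
                    if (d * k + 1).Prime then 1 / (k : ℝ) else 0) ^ 2 := by
                    refine mul_le_mul (by exact_mod_cast Nat.totient_le d)
                      (pow_le_pow_left₀ (nearSum_nonneg _ _ _) h1 2) (sq_nonneg _) hdr.le
                _ = _ := by field_simp
          _ ≤ T i := by
              refine sum_le_sum_of_subset_of_nonneg (fun d hd => ?_) fun _ _ _ => by positivity
              obtain ⟨hd1, hd2⟩ := mem_filter.mp hd
              have hd0 := (mem_Icc.mp hd1).1
              have h1 := Nat.lt_pow_succ_log_self (b := 2) (by norm_num) d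
              have h2 := Nat.pow_log_le_self 2 (show d ≠ 0 by omega)
              rw [hd2] at h1 h2
              rw [pow_succ] at h1
              exact mem_Ico.mpr ⟨h2, by omega⟩
    _ ≤ ∑ i ∈ range (J + 1), ((if i < i₀ then T i else 0) + 15 * C * ε) := by
        refine sum_le_sum fun i _ => ?_
        split_ifs with h
        · have : 0 ≤ 15 * C * ε := by positivity
          linarith
        · have := hTi i (not_lt.mp h)
          linarith
    _ ≤ ∑ i ∈ range i₀, T i + (J + 1) * (15 * C * ε) := by
        rw [sum_add_distrib, ← sum_filter]
        refine add_le_add (sum_le_sum_of_subset_of_nonneg (fun i hi => ?_) fun i _ _ => hT0 i)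
          (le_of_eq (by simp))
        exact mem_range.mpr (mem_filter.mp hi).2
    _ = _ := by ring

end NearPart

/-! ### The summatory function of `1/φ` and its constant. -/

section TotientReciprocals

open Finset

/-- `μ(e)^2 / φ(e)`. -/
noncomputable def squarefreeInvTotient (e : ℕ) : ℝ :=
  if Squarefree e then ∏ p ∈ e.primeFactors, 1 / ((p : ℝ) - 1) else 0

theorem prime_sub_one_pos {p : ℕ} (hp : p.Prime) : 0 < (p : ℝ) - 1 := by
  have : (1 : ℝ) < p := by exact_mod_cast hp.one_lt
  linarith

theorem squarefreeInvTotient_nonneg (e : ℕ) : 0 ≤ squarefreeInvTotient e := by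
  rw [squarefreeInvTotient]
  split_ifs
  · exact prod_nonneg fun p hp => (one_div_pos.mpr
      (prime_sub_one_pos (Nat.prime_of_mem_primeFactors hp))).le
  · exact le_rfl

/-- Expand `d/φ(d)` as the product of `p/(p-1) = 1 + 1/(p-1)` over `p ∣ d`. -/
theorem inv_totient_eq {d : ℕ} (hd : d ≠ 0) :
    1 / (d.totient : ℝ) = ∑ e ∈ d.divisors, squarefreeInvTotient e / d := by
  have hd0 : (d : ℝ) ≠ 0 := by exact_mod_cast hd
  have h1 : (d.totient : ℝ) = d * ∏ p ∈ d.primeFactors, (1 - (p : ℝ)⁻¹) := by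
    have := congrArg (fun q : ℚ => (q : ℝ)) (Nat.totient_eq_mul_prod_factors d)
    push_cast at this
    exact this
  have h2 : ∑ e ∈ d.divisors, squarefreeInvTotient e =
      ∏ p ∈ d.primeFactors, (1 + 1 / ((p : ℝ) - 1)) := by
    rw [prod_primeFactors_one_add (fun p : ℕ => 1 / ((p : ℝ) - 1)) hd, sum_filter]
    rfl
  have h3 : ∏ p ∈ d.primeFactors, (1 + 1 / ((p : ℝ) - 1)) =
      (∏ p ∈ d.primeFactors, (1 - (p : ℝ)⁻¹))⁻¹ := by
    rw [← prod_inv_distrib]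
    refine prod_congr rfl fun p hp => ?_
    have hp' := Nat.prime_of_mem_primeFactors hp
    have hp1 := (prime_sub_one_pos hp').ne'
    have hp0 : (p : ℝ) ≠ 0 := by exact_mod_cast hp'.ne_zero
    have e : 1 - (p : ℝ)⁻¹ = ((p : ℝ) - 1) / p := by field_simp
    rw [e, inv_div]
    field_simp
    ring
  rw [← sum_div, h2, h3, h1, one_div, mul_inv, div_eq_mul_inv, mul_comm]

/-- For `p ≥ 3` one has `√p ≤ p - 1`; only `p = 2` needs the factor `2`. -/
theorem squarefreeInvTotient_le {e : ℕ} :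
    squarefreeInvTotient e ≤ 2 * (e : ℝ) ^ (-(1 / 2) : ℝ) := by
  rw [squarefreeInvTotient]
  split_ifs with he
  · have hp : ∀ p ∈ e.primeFactors, 1 / ((p : ℝ) - 1) ≤
        (if p = 2 then 2 else 1) * (p : ℝ) ^ (-(1 / 2) : ℝ) := by
      intro p hp
      have hp' := Nat.prime_of_mem_primeFactors hp
      have hp0 : (0 : ℝ) < p := by exact_mod_cast hp'.pos
      rw [Real.rpow_neg hp0.le, ← Real.sqrt_eq_rpow, ← div_eq_mul_inv,
        div_le_div_iff₀ (prime_sub_one_pos hp') (Real.sqrt_pos.mpr hp0), one_mul]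
      split_ifs with h2
      · subst h2
        rw [Real.sqrt_le_left (by norm_num)]
        norm_num
      · have h3 : 3 ≤ p := lt_of_le_of_ne hp'.two_le (Ne.symm h2)
        have h3' : (3 : ℝ) ≤ p := by exact_mod_cast h3
        rw [Real.sqrt_le_left (by linarith)]
        nlinarith
    calc _ ≤ ∏ p ∈ e.primeFactors, ((if p = 2 then 2 else 1) * (p : ℝ) ^ (-(1 / 2) : ℝ)) :=
          prod_le_prod (fun p hp' => (one_div_pos.mpr
            (prime_sub_one_pos (Nat.prime_of_mem_primeFactors hp'))).le) hp
      _ = (∏ p ∈ e.primeFactors, (if p = 2 then (2 : ℝ) else 1)) * (e : ℝ) ^ (-(1 / 2) : ℝ) := by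
          rw [prod_mul_distrib, prod_rpow_primeFactors he]
      _ ≤ _ := by
          rw [prod_ite_eq']
          gcongr
          split_ifs <;> norm_num
  · positivity

theorem summable_squarefreeInvTotient_div :
    Summable fun e : ℕ => squarefreeInvTotient e / e := by
  have hsum : Summable fun e : ℕ => 2 * (e : ℝ) ^ (-(3 / 2) : ℝ) :=
    (Real.summable_nat_rpow.mpr (by norm_num)).mul_left 2
  refine Summable.of_nonneg_of_le (fun e => div_nonneg (squarefreeInvTotient_nonneg e)
    (Nat.cast_nonneg e)) (fun e => ?_) hsum
  rcases Nat.eq_zero_or_pos e with rfl | he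
  · simp [squarefreeInvTotient]
  have he' : (0 : ℝ) < e := by exact_mod_cast he
  calc _ ≤ 2 * (e : ℝ) ^ (-(1 / 2) : ℝ) / e := by gcongr; exact squarefreeInvTotient_le
    _ = _ := by
        rw [show (-(1 / 2) : ℝ) = -(3 / 2) + 1 by norm_num, Real.rpow_add he', Real.rpow_one]
        field_simp

/-- Put `d = em`. The series is really finite, since `N / e = 0` for `e > N`; its infinite form is
made for dominated convergence. -/
theorem sum_Icc_inv_totient_eq (N : ℕ) :
    ∑ d ∈ Icc 1 N, 1 / (d.totient : ℝ) =
      ∑' e : ℕ, squarefreeInvTotient e / e * ∑ m ∈ Icc 1 (N / e), (1 : ℝ) / m := by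
  rw [tsum_eq_sum (s := Icc 1 N)]
  · calc _ = ∑ x ∈ (Icc 1 N).sigma fun d => d.divisors, squarefreeInvTotient x.2 / x.1 := by
          rw [sum_sigma]
          exact sum_congr rfl fun d hd => inv_totient_eq (by have := (mem_Icc.mp hd).1; omega)
      _ = ∑ x ∈ (Icc 1 N).sigma fun e => Icc 1 (N / e),
            squarefreeInvTotient x.1 / x.1 * (1 / x.2) := by
          refine sum_nbij' (fun x => ⟨x.2, x.1 / x.2⟩) (fun x => ⟨x.1 * x.2, x.1⟩) ?_ ?_ ?_ ?_ ?_
          · rintro ⟨d, e⟩ hx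
            simp only [mem_sigma, mem_Icc, Nat.mem_divisors] at hx ⊢
            obtain ⟨⟨h1, h2⟩, h3, _⟩ := hx
            have he := Nat.pos_of_dvd_of_pos h3 h1
            exact ⟨⟨he, (Nat.le_of_dvd h1 h3).trans h2⟩, Nat.div_pos (Nat.le_of_dvd h1 h3) he,
              Nat.div_le_div_right h2⟩
          · rintro ⟨e, m⟩ hx
            simp only [mem_sigma, mem_Icc, Nat.mem_divisors] at hx ⊢
            obtain ⟨⟨h1, h2⟩, h3, h4⟩ := hx
            have h5 : e * m ≤ N := (Nat.mul_le_mul_left e h4).trans (Nat.mul_div_le N e)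
            have h6 : 0 < e * m := Nat.mul_pos h1 h3
            exact ⟨⟨h6, h5⟩, dvd_mul_right _ _, h6.ne'⟩
          · rintro ⟨d, e⟩ hx
            simp only [mem_sigma, mem_Icc, Nat.mem_divisors] at hx
            simp only [Nat.mul_div_cancel' hx.2.1]
          · rintro ⟨e, m⟩ hx
            simp only [mem_sigma, mem_Icc] at hx
            simp only [Nat.mul_div_cancel_left m hx.1.1]
          · rintro ⟨d, e⟩ hx
            simp only [mem_sigma, mem_Icc, Nat.mem_divisors] at hx
            obtain ⟨⟨h1, h2⟩, h3, _⟩ := hx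
            have he : (e : ℝ) ≠ 0 := by exact_mod_cast (Nat.pos_of_dvd_of_pos h3 h1).ne'
            have hd : (d : ℝ) ≠ 0 := by exact_mod_cast (by omega : d ≠ 0)
            simp only
            rw [Nat.cast_div h3 he]
            field_simp
      _ = _ := by
          rw [sum_sigma]
          exact sum_congr rfl fun e _ => by rw [mul_sum]
  · intro e he
    rcases Nat.eq_zero_or_pos e with rfl | he0
    · simp [squarefreeInvTotient]
    · have : N / e = 0 := Nat.div_eq_of_lt (by
        by_contra! h
        exact he (mem_Icc.mpr ⟨he0, h⟩))
      simp [this]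

/-- The constant `∑ μ(e)^2 / (e φ(e))`. -/
noncomputable def totientConstant : ℝ := ∑' e : ℕ, squarefreeInvTotient e / e

/-- For fixed `e` the harmonic sum up to `N / e` is asymptotic to `log N`, and for `N ≥ 2` it is at
most `1 + log N ≤ 3 log N` uniformly in `e`, so limit and series may be exchanged. -/
theorem tendsto_sum_inv_totient_div_log :
    Tendsto (fun N : ℕ => (∑ d ∈ Icc 1 N, 1 / (d.totient : ℝ)) / Real.log N) atTop
      (nhds totientConstant) := by
  have hlogtop : Tendsto (fun N : ℕ => Real.log N) atTop atTop :=
    Real.tendsto_log_atTop.comp tendsto_natCast_atTop_atTop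
  have key : Tendsto (fun N : ℕ => ∑' e : ℕ, squarefreeInvTotient e / e *
      ((∑ m ∈ Icc 1 (N / e), (1 : ℝ) / m) / Real.log N)) atTop (nhds totientConstant) := by
    refine tendsto_tsum_of_dominated_convergence
      (bound := fun e => squarefreeInvTotient e / e * 3)
      (summable_squarefreeInvTotient_div.mul_right 3) (fun e => ?_) ?_
    · rcases Nat.eq_zero_or_pos e with rfl | he
      · simp [squarefreeInvTotient]
      have he' : (0 : ℝ) < e := by exact_mod_cast he
      have h1 : Tendsto (fun N : ℕ => (∑ m ∈ Icc 1 (N / e), (1 : ℝ) / m) / Real.log N) atTop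
          (nhds 1) := by
        have hl : Tendsto (fun N : ℕ => 1 - Real.log e / Real.log N) atTop (nhds 1) := by
          simpa using (hlogtop.const_div_atTop (Real.log e)).const_sub 1
        have hu : Tendsto (fun N : ℕ => 1 / Real.log N + 1) atTop (nhds 1) := by
          simpa using (hlogtop.const_div_atTop 1).add_const 1
        refine tendsto_of_tendsto_of_tendsto_of_le_of_le' hl hu ?_ ?_
        · filter_upwards [eventually_ge_atTop 2] with N hN
          have hN' : (0 : ℝ) < N := by exact_mod_cast (by omega : 0 < N)
          have hlog : 0 < Real.log N := Real.log_pos (by exact_mod_cast hN)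
          have h2 := log_add_one_le_harmonic (N / e)
          rw [harmonic_eq_sum_Icc] at h2
          push_cast at h2
          have h3 : Real.log N - Real.log e ≤ ∑ m ∈ Icc 1 (N / e), (1 : ℝ) / m := by
            rw [← Real.log_div hN'.ne' he'.ne']
            simp only [one_div]
            refine (Real.log_le_log (by positivity) ?_).trans h2
            rw [div_le_iff₀ he']
            have := Nat.lt_div_mul_add (a := N) he
            have : N ≤ (N / e + 1) * e := by rw [add_mul, one_mul]; omega
            exact_mod_cast this
          rw [le_div_iff₀ hlog, sub_mul, div_mul_cancel₀ _ hlog.ne', one_mul]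
          exact h3
        · filter_upwards [eventually_ge_atTop 2] with N hN
          have hlog : 0 < Real.log N := Real.log_pos (by exact_mod_cast hN)
          rw [div_le_iff₀ hlog, add_mul, one_div_mul_cancel hlog.ne', one_mul]
          calc _ ≤ ∑ m ∈ Icc 1 N, (1 : ℝ) / m :=
                sum_le_sum_of_subset_of_nonneg (Icc_subset_Icc_right (Nat.div_le_self _ _))
                  fun _ _ _ => by positivity
            _ ≤ _ := sum_Icc_inv_le N
      simpa using h1.const_mul (squarefreeInvTotient e / e)
    · filter_upwards [eventually_ge_atTop 2] with N hN e
      have hlog : Real.log 2 ≤ Real.log N := Real.log_le_log two_pos (by exact_mod_cast hN)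
      have hl2 := Real.log_two_gt_d9
      have hw : 0 ≤ squarefreeInvTotient e / e :=
        div_nonneg (squarefreeInvTotient_nonneg e) (Nat.cast_nonneg e)
      have hH : 0 ≤ ∑ m ∈ Icc 1 (N / e), (1 : ℝ) / m := sum_nonneg fun _ _ => by positivity
      rw [Real.norm_of_nonneg (mul_nonneg hw (div_nonneg hH (by linarith)))]
      refine mul_le_mul_of_nonneg_left ?_ hw
      rw [div_le_iff₀ (by linarith)]
      calc _ ≤ ∑ m ∈ Icc 1 N, (1 : ℝ) / m :=
            sum_le_sum_of_subset_of_nonneg (Icc_subset_Icc_right (Nat.div_le_self _ _))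
              fun _ _ _ => by positivity
        _ ≤ 1 + Real.log N := sum_Icc_inv_le N
        _ ≤ _ := by linarith
  refine key.congr fun N => ?_
  rw [sum_Icc_inv_totient_eq, ← tsum_div_const]
  exact tsum_congr fun e => mul_div_assoc' _ _ _

/-- `n ↦ n⁻ᵏ` as a multiplicative map. -/
noncomputable def invPowHom (k : ℕ) (hk : k ≠ 0) : ℕ →*₀ ℝ where
  toFun n := 1 / (n : ℝ) ^ k
  map_zero' := by simp [hk]
  map_one' := by simp
  map_mul' m n := by push_cast; rw [mul_pow, one_div_mul_one_div]

theorem riemannZeta_nat_re {k : ℕ} (hk : 1 < k) :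
    (riemannZeta k).re = ∑' n : ℕ, 1 / (n : ℝ) ^ k := by
  rw [zeta_nat_eq_tsum_of_gt_one hk]
  have : ∑' n : ℕ, 1 / (n : ℂ) ^ k = ((∑' n : ℕ, 1 / (n : ℝ) ^ k : ℝ) : ℂ) := by
    push_cast; rfl
  rw [this, Complex.ofReal_re]

theorem riemannZeta_nat_re_pos {k : ℕ} (hk : 1 < k) : 0 < (riemannZeta k).re := by
  rw [riemannZeta_nat_re hk]
  exact (Real.summable_one_div_nat_pow.mpr hk).tsum_pos (fun n => by positivity) 1 (by simp)

theorem hasProd_zeta_nat {k : ℕ} (hk : 1 < k) :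
    HasProd (fun p : Nat.Primes => (1 - 1 / ((p : ℕ) : ℝ) ^ k)⁻¹) (riemannZeta k).re := by
  have hs : Summable fun n : ℕ => 1 / (n : ℝ) ^ k := Real.summable_one_div_nat_pow.mpr hk
  rw [riemannZeta_nat_re hk]
  refine EulerProduct.eulerProduct_completely_multiplicative_hasProd (f := invPowHom k (by omega)) ?_
  refine hs.congr fun n => ?_
  exact (Real.norm_of_nonneg (by positivity : (0 : ℝ) ≤ 1 / (n : ℝ) ^ k)).symm

theorem hasProd_totientConstant :
    HasProd (fun p : Nat.Primes => 1 + 1 / (((p : ℕ) : ℝ) * (((p : ℕ) : ℝ) - 1)))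
      totientConstant := by
  have hmul : ∀ {m n : ℕ}, m.Coprime n → squarefreeInvTotient (m * n) / ((m * n : ℕ) : ℝ) =
      squarefreeInvTotient m / m * (squarefreeInvTotient n / n) := by
    intro m n h
    have : squarefreeInvTotient (m * n) = squarefreeInvTotient m * squarefreeInvTotient n := by
      unfold squarefreeInvTotient
      by_cases hm : Squarefree m <;> by_cases hn : Squarefree n
      · rw [if_pos hm, if_pos hn, if_pos ((Nat.squarefree_mul h).mpr ⟨hm, hn⟩),
          h.primeFactors_mul, prod_union h.disjoint_primeFactors]
      all_goals simp [hm, hn, Nat.squarefree_mul h]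
    rw [this]
    push_cast
    rw [mul_div_mul_comm]
  have h := EulerProduct.eulerProduct_hasProd
    (f := fun e : ℕ => squarefreeInvTotient e / e) (by simp [squarefreeInvTotient]) hmul
    (summable_squarefreeInvTotient_div.norm) (by simp)
  refine h.congr_fun fun p => ?_
  have hp := p.2
  have hp1 := (prime_sub_one_pos hp).ne'
  have hp0 : ((p : ℕ) : ℝ) ≠ 0 := by exact_mod_cast hp.ne_zero
  rw [tsum_eq_sum (s := range 2)]
  · rw [sum_range_succ, sum_range_one]
    simp [squarefreeInvTotient, hp.prime.squarefree, hp.primeFactors]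
    field_simp
  · intro k hk
    have hk2 : 2 ≤ k := by have := mem_range.not.mp hk; omega
    have : ¬ Squarefree ((p : ℕ) ^ k) := fun h => hp.one_lt.ne' (Nat.isUnit_iff.mp
      (h _ (by rw [← sq]; exact pow_dvd_pow _ hk2)))
    simp [squarefreeInvTotient, this]

/-- Compare Euler factors: `1 + 1/(p(p-1)) = (1 - p^(-6)) / ((1 - p^(-2))(1 - p^(-3)))`. -/
theorem totientConstant_eq : totientConstant =
    (riemannZeta 2).re * (riemannZeta 3).re / (riemannZeta 6).re := by
  have h2 := hasProd_zeta_nat (k := 2) (by norm_num)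
  have h3 := hasProd_zeta_nat (k := 3) (by norm_num)
  have h6 := hasProd_zeta_nat (k := 6) (by norm_num)
  push_cast at h2 h3 h6
  have hz := (riemannZeta_nat_re_pos (k := 6) (by norm_num)).ne'
  push_cast at hz
  rw [eq_div_iff hz]
  refine (hasProd_totientConstant.mul h6).unique ?_
  refine (h2.mul h3).congr_fun fun p => ?_
  have hp1 : (1 : ℝ) < (p : ℕ) := by exact_mod_cast p.2.one_lt
  set x : ℝ := ((p : ℕ) : ℝ)
  have e2 : x ^ 2 - 1 ≠ 0 := by nlinarith
  have e3 : x ^ 3 - 1 ≠ 0 := by nlinarith [mul_pos (sub_pos.mpr hp1) (by positivity : 0 < x ^ 2)]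
  have e6 : x ^ 6 - 1 ≠ 0 := by
    have : 1 < x ^ 6 := one_lt_pow₀ hp1 (by norm_num)
    linarith
  have e1 : x - 1 ≠ 0 := by linarith
  have e0 : x ≠ 0 := by linarith
  have hinv : ∀ k : ℕ, x ^ k - 1 ≠ 0 → (1 - 1 / x ^ k)⁻¹ = x ^ k / (x ^ k - 1) := by
    intro k hk
    have : 1 - 1 / x ^ k = (x ^ k - 1) / x ^ k := by field_simp
    rw [this, inv_div]
  rw [hinv 2 e2, hinv 3 e3, hinv 6 e6]
  field_simp
  ring

end TotientReciprocals

/-! ### Primes in progressions over one dyadic block. -/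

section BlockEstimate

open Finset MeasureTheory

theorem continuousOn_inv_log : ContinuousOn (fun t : ℝ => 1 / Real.log t) (Set.Ici 2) := by
  refine continuousOn_const.div (Real.continuousOn_log.mono fun t ht => ?_) fun t ht => ?_
  · have : (2 : ℝ) ≤ t := ht
    simp; linarith
  · have : (2 : ℝ) ≤ t := ht
    exact (Real.log_pos (by linarith)).ne'

theorem hasDerivAt_li {t : ℝ} (ht : 2 < t) : HasDerivAt li (1 / Real.log t) t := by
  refine intervalIntegral.integral_hasDerivAt_right ?_ ?_ ?_
  · exact (continuousOn_inv_log.mono (by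
      rw [Set.uIcc_of_le ht.le]; exact Set.Icc_subset_Ici_self)).intervalIntegrable
  · exact (continuousOn_inv_log.mono Set.Ioi_subset_Ici_self).stronglyMeasurableAtFilter
      isOpen_Ioi t ht
  · exact continuousOn_inv_log.continuousAt (Ici_mem_nhds ht)

theorem continuousOn_li : ContinuousOn li (Set.Ici 2) := by
  intro t ht
  have h := intervalIntegral.continuousOn_primitive_interval (μ := volume) (a := (2 : ℝ))
    (b := t + 1) (f := fun t : ℝ => 1 / Real.log t) ?_
  · have ht' : (2 : ℝ) ≤ t := ht
    have h2 := h t (by rw [Set.uIcc_of_le (by linarith)]; exact ⟨ht', by linarith⟩)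
    refine h2.mono_of_mem_nhdsWithin ?_
    rw [Set.uIcc_of_le (by linarith), ← Set.Ici_inter_Iic]
    exact inter_mem_nhdsWithin _ (Iic_mem_nhds (by linarith))
  · have ht' : (2 : ℝ) ≤ t := ht
    rw [Set.uIcc_of_le (by linarith)]
    exact (continuousOn_inv_log.mono Set.Icc_subset_Ici_self).integrableOn_Icc

theorem abs_li_le {y : ℝ} (hy : 2 ≤ y) : |li y| ≤ 2 * y := by
  have h : ∀ t ∈ Set.uIoc 2 y, ‖1 / Real.log t‖ ≤ 2 := by
    intro t ht
    rw [Set.uIoc_of_le hy] at ht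
    have h1 : Real.log 2 ≤ Real.log t := Real.log_le_log two_pos ht.1.le
    have h2 := Real.log_two_gt_d9
    rw [Real.norm_of_nonneg (one_div_nonneg.mpr (by linarith)), div_le_iff₀ (by linarith)]
    linarith
  have := intervalIntegral.norm_integral_le_of_norm_le_const h
  rw [abs_of_nonneg (by linarith)] at this
  exact this.trans (by linarith)

theorem primeCountingAP_one_eq (y : ℝ) {d : ℕ} :
    primeCountingAP y d 1 =
      ((Icc 0 ⌊y⌋₊).filter fun p => p.Prime ∧ d ∣ p - 1).card := by
  rw [primeCountingAP]
  congr 1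
  ext p
  simp only [mem_filter, Nat.mem_primesLE, mem_Icc]
  constructor
  · rintro ⟨⟨h1, h2⟩, h3⟩
    exact ⟨⟨Nat.zero_le _, h1⟩, h2, (Nat.modEq_iff_dvd' h2.one_le).mp h3.symm⟩
  · rintro ⟨⟨_, h1⟩, h2, h3⟩
    exact ⟨⟨h1, h2⟩, ((Nat.modEq_iff_dvd' h2.one_le).mpr h3).symm⟩

theorem card_Icc_prime_dvd_le (N : ℕ) {d : ℕ} (hd : 0 < d) :
    ((Icc 0 N).filter fun p => p.Prime ∧ d ∣ p - 1).card ≤ N / d := by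
  have : ((Icc 0 N).filter fun p => p.Prime ∧ d ∣ p - 1).card ≤ (Icc 1 (N / d)).card := by
    refine card_le_card_of_injOn (fun p => (p - 1) / d) (fun p hp => ?_) fun p hp q hq h => ?_
    · obtain ⟨h1, h2, h3⟩ := mem_filter.mp hp
      have hp2 := h2.two_le
      have := (mem_Icc.mp h1).2
      exact mem_Icc.mpr ⟨Nat.div_pos (Nat.le_of_dvd (by omega) h3) hd,
        Nat.div_le_div_right (by omega)⟩
    · obtain ⟨_, h2, h3⟩ := mem_filter.mp (mem_coe.mp hp)
      obtain ⟨_, h2', h3'⟩ := mem_filter.mp (mem_coe.mp hq)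
      have := (Nat.div_left_inj h3 h3').mp h
      have := h2.two_le
      have := h2'.two_le
      omega
  simpa using this

/-- The trivial bound: the count is at most `x/d` and `li y` at most `2y`. It makes `maxDiscrepancy`
a genuine supremum, and later turns a mean square of discrepancies into the first moment that
Elliott–Halberstam controls. -/
theorem abs_discrepancy_le {x y : ℝ} {d : ℕ} (hd : 0 < d) (hy : 2 ≤ y) (hyx : y ≤ x) :
    |(primeCountingAP y d 1 : ℝ) - li y / (Nat.totient d : ℝ)| ≤ 3 * x / d.totient := by
  have hφ : (0 : ℝ) < d.totient := by exact_mod_cast Nat.totient_pos.mpr hd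
  have hφd : (d.totient : ℝ) ≤ d := by exact_mod_cast Nat.totient_le d
  have h1 : (primeCountingAP y d 1 : ℝ) ≤ x / d.totient := by
    rw [primeCountingAP_one_eq]
    calc _ ≤ ((⌊y⌋₊ / d : ℕ) : ℝ) := by exact_mod_cast card_Icc_prime_dvd_le _ hd
      _ ≤ (⌊y⌋₊ : ℝ) / d := Nat.cast_div_le
      _ ≤ x / d.totient := by
          have h0 : (0 : ℝ) ≤ x := by linarith
          have h1 : (⌊y⌋₊ : ℝ) ≤ x := (Nat.floor_le (by linarith)).trans hyx
          gcongr
  have h2 : |li y / d.totient| ≤ 2 * x / d.totient := by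
    rw [abs_div, abs_of_pos hφ]
    gcongr
    exact (abs_li_le hy).trans (by linarith)
  have h3 := abs_sub (primeCountingAP y d 1 : ℝ) (li y / d.totient)
  rw [abs_of_nonneg (a := (primeCountingAP y d 1 : ℝ)) (Nat.cast_nonneg _)] at h3
  have : 3 * x / d.totient = x / d.totient + 2 * x / d.totient := by ring
  linarith

theorem abs_discrepancy_le_maxDiscrepancy {x y : ℝ} {d : ℕ} (hd : 0 < d) (hy : 2 ≤ y)
    (hyx : y ≤ x) :
    |(primeCountingAP y d 1 : ℝ) - li y / (Nat.totient d : ℝ)| ≤ maxDiscrepancy x d := by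
  refine le_ciSup (f := fun y : Set.Icc (2 : ℝ) x =>
    |(primeCountingAP y d 1 : ℝ) - li y / (Nat.totient d : ℝ)|) ?_ ⟨y, hy, hyx⟩
  refine ⟨3 * x / d.totient, ?_⟩
  rintro _ ⟨z, rfl⟩
  exact abs_discrepancy_le hd z.2.1 z.2.2

theorem maxDiscrepancy_nonneg (x : ℝ) (d : ℕ) : 0 ≤ maxDiscrepancy x d :=
  Real.iSup_nonneg fun _ => abs_nonneg _

theorem maxDiscrepancy_le {x : ℝ} {d : ℕ} (hd : 0 < d) (hx : 2 ≤ x) :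
    maxDiscrepancy x d ≤ 3 * x / d.totient := by
  have : Nonempty (Set.Icc (2 : ℝ) x) := ⟨⟨2, le_rfl, hx⟩⟩
  exact ciSup_le fun z => abs_discrepancy_le hd z.2.1 z.2.2

/-- Integration by parts: `log log t - li t / t` is an antiderivative. Only continuity is used at
the endpoints, so `a = 2` is allowed. -/
theorem integral_li_div_sq {a b : ℝ} (ha : 2 ≤ a) (hab : a ≤ b) :
    ∫ t in a..b, li t / t ^ 2 =
      (Real.log (Real.log b) - li b / b) - (Real.log (Real.log a) - li a / a) := by
  have hcont : ContinuousOn (fun t : ℝ => Real.log (Real.log t) - li t / t) (Set.Icc a b) := by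
    have hpos : ∀ t ∈ Set.Icc a b, 2 ≤ t := fun t ht => ha.trans ht.1
    have hl : ContinuousOn Real.log (Set.Icc a b) :=
      Real.continuousOn_log.mono fun t ht => by
        have := hpos t ht; simp; linarith
    refine (hl.log fun t ht => ?_).sub ((continuousOn_li.mono fun t ht => hpos t ht).div
      continuousOn_id fun t ht => ?_)
    · exact (Real.log_pos (by linarith [hpos t ht])).ne'
    · have := hpos t ht; simp; linarith
  refine intervalIntegral.integral_eq_sub_of_hasDerivAt_of_le hab hcont (fun t ht => ?_) ?_
  · have ht2 : 2 < t := ha.trans_lt ht.1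
    have hlog : Real.log t ≠ 0 := (Real.log_pos (by linarith)).ne'
    have ht0 : t ≠ 0 := by linarith
    have h1 := (Real.hasDerivAt_log ht0).log hlog
    have h2 := (hasDerivAt_li ht2).div (hasDerivAt_id t) ht0
    refine (h1.sub h2).congr_deriv ?_
    simp only [id]
    field_simp
    ring
  · refine ContinuousOn.intervalIntegrable ?_
    rw [Set.uIcc_of_le hab]
    refine (continuousOn_li.mono fun t ht => ha.trans ht.1).div (by fun_prop) fun t ht => ?_
    have : 2 ≤ t := ha.trans ht.1
    positivity

/-- Partial summation against `1/t`. The discrepancy enters at `b`, at `a` and in the integral, each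
time with at most `maxDiscrepancy b d / a`; the integral needs `b - a ≤ a`. -/
theorem abs_sum_inv_prime_sub_le {a b d : ℕ} (ha : 2 ≤ a) (hab : a ≤ b) (hba : b ≤ 2 * a)
    (hd : 0 < d) :
    |∑ p ∈ (Ioc a b).filter (fun p => p.Prime ∧ d ∣ p - 1), 1 / (p : ℝ) -
      (Real.log (Real.log b) - Real.log (Real.log a)) / d.totient| ≤
      3 * maxDiscrepancy b d / a := by
  have ha' : (2 : ℝ) ≤ a := by exact_mod_cast ha
  have hab' : (a : ℝ) ≤ b := by exact_mod_cast hab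
  have ha0 : (0 : ℝ) < a := by linarith
  have hb0 : (0 : ℝ) < b := by linarith
  have hφ : (d.totient : ℝ) ≠ 0 := by exact_mod_cast (Nat.totient_pos.mpr hd).ne'
  set c : ℕ → ℝ := fun p => if p.Prime ∧ d ∣ p - 1 then 1 else 0 with hc
  have hcsum : ∀ t : ℝ, ∑ k ∈ Icc 0 ⌊t⌋₊, c k = primeCountingAP t d 1 := by
    intro t
    rw [primeCountingAP_one_eq, hc, sum_boole]
  have hcont : ContinuousOn (fun t : ℝ => -(t ^ 2)⁻¹) (Set.Icc (a : ℝ) b) :=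
    ContinuousOn.neg (ContinuousOn.inv₀ (by fun_prop) fun t ht => by
      have : 0 < t := ha0.trans_le ht.1
      positivity)
  have hderiv : ∀ t ∈ Set.Icc (a : ℝ) b, deriv (fun t : ℝ => t⁻¹) t = -(t ^ 2)⁻¹ := by
    intro t _; simp
  have habel := sum_mul_eq_sub_sub_integral_mul' (f := fun t : ℝ => t⁻¹) c hab
    (fun t ht => differentiableAt_inv (ha0.trans_le ht.1).ne')
    ((hcont.integrableOn_Icc).congr_fun (fun t ht => (hderiv t ht).symm) measurableSet_Icc)
  have hint : IntegrableOn (fun t : ℝ => -(t ^ 2)⁻¹ * ∑ k ∈ Icc 0 ⌊t⌋₊, c k)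
      (Set.Icc (a : ℝ) b) := integrableOn_mul_sum_Icc c ha0.le hcont.integrableOn_Icc
  have hI : ∫ t in Set.Ioc (a : ℝ) b, deriv (fun t : ℝ => t⁻¹) t * ∑ k ∈ Icc 0 ⌊t⌋₊, c k =
      ∫ t in (a : ℝ)..b, -(t ^ 2)⁻¹ * (primeCountingAP t d 1 : ℝ) := by
    rw [intervalIntegral.integral_of_le hab']
    refine setIntegral_congr_fun measurableSet_Ioc fun t ht => ?_
    simp only [hderiv t (Set.Ioc_subset_Icc_self ht), hcsum]
  have e1 := hcsum (a : ℝ)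
  have e2 := hcsum (b : ℝ)
  rw [Nat.floor_natCast] at e1 e2
  rw [hI, e1, e2] at habel
  have hlhs : ∑ k ∈ Ioc a b, (k : ℝ)⁻¹ * c k =
      ∑ p ∈ (Ioc a b).filter (fun p => p.Prime ∧ d ∣ p - 1), 1 / (p : ℝ) := by
    rw [sum_filter]
    refine sum_congr rfl fun k _ => ?_
    simp only [hc]
    split_ifs <;> simp
  rw [hlhs] at habel
  have hli := integral_li_div_sq ha' hab'
  have i1 : IntervalIntegrable (fun t : ℝ => -(t ^ 2)⁻¹ * (primeCountingAP t d 1 : ℝ))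
      volume a b := by
    rw [intervalIntegrable_iff_integrableOn_Icc_of_le hab']
    exact hint.congr_fun (fun t _ => by simp only [hcsum]) measurableSet_Icc
  have i2 : IntervalIntegrable (fun t : ℝ => li t / t ^ 2 / d.totient) volume a b := by
    refine ContinuousOn.intervalIntegrable ?_
    rw [Set.uIcc_of_le hab']
    refine ((continuousOn_li.mono fun t ht => ha'.trans ht.1).div (by fun_prop)
      fun t ht => ?_).div_const _
    have : 0 < t := ha0.trans_le ht.1
    positivity
  have hm : ∀ t ∈ Set.Icc (a : ℝ) b,
      |(primeCountingAP t d 1 : ℝ) - li t / d.totient| ≤ maxDiscrepancy b d :=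
    fun t ht => abs_discrepancy_le_maxDiscrepancy hd (ha'.trans ht.1) ht.2
  have hm0 := maxDiscrepancy_nonneg (b : ℝ) d
  set m := maxDiscrepancy (b : ℝ) d with hmdef
  have hfin : ∑ p ∈ (Ioc a b).filter (fun p => p.Prime ∧ d ∣ p - 1), 1 / (p : ℝ) -
      (Real.log (Real.log b) - Real.log (Real.log a)) / d.totient =
      ((primeCountingAP b d 1 : ℝ) - li b / d.totient) / b -
      ((primeCountingAP a d 1 : ℝ) - li a / d.totient) / a -
      ∫ t in (a : ℝ)..b, (-(t ^ 2)⁻¹ * (primeCountingAP t d 1 : ℝ) + li t / t ^ 2 / d.totient) := by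
    rw [intervalIntegral.integral_add i1 i2, intervalIntegral.integral_div, hli, habel]
    field_simp
    ring
  have hbound : ‖∫ t in (a : ℝ)..b,
      (-(t ^ 2)⁻¹ * (primeCountingAP t d 1 : ℝ) + li t / t ^ 2 / d.totient)‖ ≤
      m / (a : ℝ) ^ 2 * |(b : ℝ) - a| := by
    refine intervalIntegral.norm_integral_le_of_norm_le_const fun t ht => ?_
    rw [Set.uIoc_of_le hab'] at ht
    have ht0 : 0 < t := ha0.trans ht.1
    have e : -(t ^ 2)⁻¹ * (primeCountingAP t d 1 : ℝ) + li t / t ^ 2 / d.totient =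
        -(((primeCountingAP t d 1 : ℝ) - li t / d.totient) / t ^ 2) := by
      field_simp
      ring
    rw [e, norm_neg, Real.norm_eq_abs, abs_div, abs_of_pos (by positivity : 0 < t ^ 2)]
    have := hm t (Set.Ioc_subset_Icc_self ht)
    have := ht.1.le
    gcongr
  have h1 := hm b ⟨hab', le_rfl⟩
  have h2 := hm a ⟨le_rfl, hab'⟩
  have hb1 : |((primeCountingAP b d 1 : ℝ) - li b / d.totient) / b| ≤ m / a := by
    rw [abs_div, abs_of_pos hb0]
    gcongr
  have ha1 : |((primeCountingAP a d 1 : ℝ) - li a / d.totient) / a| ≤ m / a := by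
    rw [abs_div, abs_of_pos ha0]
    gcongr
  have hI1 : m / (a : ℝ) ^ 2 * |(b : ℝ) - a| ≤ m / a := by
    have hba' : (b : ℝ) ≤ 2 * a := by exact_mod_cast hba
    rw [abs_of_nonneg (by linarith)]
    calc _ ≤ m / (a : ℝ) ^ 2 * a := by gcongr; linarith
      _ = _ := by field_simp
  rw [Real.norm_eq_abs] at hbound
  rw [hfin]
  refine (abs_sub _ _).trans ?_
  have := abs_sub (((primeCountingAP b d 1 : ℝ) - li b / d.totient) / b)
    (((primeCountingAP a d 1 : ℝ) - li a / d.totient) / a)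
  have e : 3 * m / (a : ℝ) = m / a + m / a + m / a := by ring
  linarith

/-- On a dyadic block the difference of `log log` is `log((j+1)/j)`. Replacing `1/p` by `1/(p-1)`
costs at most `4^(-j)` for each of at most `2^(j+1)/d` primes. -/
theorem abs_blockSum_sub_le {j d : ℕ} (hj : 1 ≤ j) (hd : 0 < d) :
    |blockSum j d - Real.log (((j : ℝ) + 1) / j) / d.totient| ≤
      3 * maxDiscrepancy (2 ^ (j + 1)) d / 2 ^ j + 2 / (2 ^ j * d) := by
  have hj0 : (0 : ℝ) < j := by exact_mod_cast hj
  have hd0 : (0 : ℝ) < d := by exact_mod_cast hd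
  have h2j : 2 ≤ 2 ^ j := by
    calc 2 = 2 ^ 1 := rfl
      _ ≤ 2 ^ j := Nat.pow_le_pow_right (by norm_num) hj
  have h := abs_sum_inv_prime_sub_le (a := 2 ^ j) (b := 2 ^ (j + 1)) h2j
    (Nat.pow_le_pow_right (by norm_num) (by omega)) (by rw [pow_succ]; omega) hd
  push_cast at h
  have hl2 : Real.log 2 ≠ 0 := (Real.log_pos (by norm_num)).ne'
  have hlog : Real.log (Real.log (2 ^ (j + 1))) - Real.log (Real.log (2 ^ j)) =
      Real.log (((j : ℝ) + 1) / j) := by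
    rw [Real.log_pow, Real.log_pow, ← Real.log_div (by positivity) (by positivity)]
    push_cast
    rw [mul_div_mul_right _ _ hl2]
  rw [hlog] at h
  set P := (Ioc (2 ^ j) (2 ^ (j + 1))).filter (fun p => p.Prime ∧ d ∣ p - 1) with hP
  have hpj : (0 : ℝ) < 2 ^ j := by positivity
  have hterm : ∀ p ∈ P, (0 : ℝ) ≤ 1 / ((p : ℝ) - 1) - 1 / p ∧
      1 / ((p : ℝ) - 1) - 1 / p ≤ 1 / (2 ^ j) ^ 2 := by
    intro p hp
    have hp1 := (mem_Ioc.mp (mem_filter.mp hp).1).1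
    have hp2 : (2 : ℝ) ^ j + 1 ≤ p := by exact_mod_cast hp1
    have hp3 : (0 : ℝ) < (p : ℝ) - 1 := by linarith
    have hp4 : (0 : ℝ) < p := by linarith
    have e : 1 / ((p : ℝ) - 1) - 1 / p = 1 / (((p : ℝ) - 1) * p) := by field_simp; ring
    rw [e]
    refine ⟨by positivity, one_div_le_one_div_of_le (by positivity) ?_⟩
    nlinarith
  have hcard : (P.card : ℝ) ≤ 2 * 2 ^ j / d := by
    have : P.card ≤ 2 ^ (j + 1) / d := by
      refine le_trans (card_le_card fun p hp => ?_) (card_Icc_prime_dvd_le (2 ^ (j + 1)) hd)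
      obtain ⟨h1, h2⟩ := mem_filter.mp hp
      exact mem_filter.mpr ⟨mem_Icc.mpr ⟨Nat.zero_le _, (mem_Ioc.mp h1).2⟩, h2⟩
    calc (P.card : ℝ) ≤ ((2 ^ (j + 1) / d : ℕ) : ℝ) := by exact_mod_cast this
      _ ≤ ((2 ^ (j + 1) : ℕ) : ℝ) / d := Nat.cast_div_le
      _ = _ := by push_cast; rw [pow_succ]; ring
  have hdiff : |blockSum j d - ∑ p ∈ P, 1 / (p : ℝ)| ≤ 2 / (2 ^ j * d) := by
    rw [blockSum, ← sum_sub_distrib, abs_of_nonneg (sum_nonneg fun p hp => (hterm p hp).1)]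
    calc _ ≤ ∑ p ∈ P, (1 : ℝ) / (2 ^ j) ^ 2 := sum_le_sum fun p hp => (hterm p hp).2
      _ = P.card * (1 / (2 ^ j) ^ 2) := by rw [sum_const, nsmul_eq_mul]
      _ ≤ 2 * 2 ^ j / d * (1 / (2 ^ j) ^ 2) := by gcongr
      _ = _ := by field_simp
  have e : blockSum j d - Real.log (((j : ℝ) + 1) / j) / d.totient =
      (blockSum j d - ∑ p ∈ P, 1 / (p : ℝ)) +
      (∑ p ∈ P, 1 / (p : ℝ) - Real.log (((j : ℝ) + 1) / j) / d.totient) := by ring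
  rw [e]
  refine (abs_add_le _ _).trans ?_
  linarith

end BlockEstimate

/-! ### The contribution of far blocks under Elliott–Halberstam. -/

section FarPart

open Finset

open Classical in
/-- The expected value of `farSum`. -/
noncomputable def modelSum (ε : ℝ) (J d : ℕ) : ℝ :=
  ∑ j ∈ range J with IsFarBlock ε d j, Real.log (((j : ℝ) + 1) / j) / d.totient

/-- The weighted mean square of the error in the block `j`. -/
noncomputable def blockError (ε : ℝ) (j : ℕ) : ℝ :=
  ∑ d ∈ Icc 1 ⌊(2 : ℝ) ^ ((j : ℝ) * (1 - ε))⌋₊,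
    (d.totient : ℝ) * (blockSum j d - Real.log (((j : ℝ) + 1) / j) / d.totient) ^ 2

theorem blockError_nonneg (ε : ℝ) (j : ℕ) : 0 ≤ blockError ε j :=
  sum_nonneg fun _ _ => by positivity

theorem two_rpow_mul_one_sub_le {ε : ℝ} (hε : 0 ≤ ε) (j : ℕ) :
    (2 : ℝ) ^ ((j : ℝ) * (1 - ε)) ≤ 2 ^ j := by
  rw [← Real.rpow_natCast]
  refine Real.rpow_le_rpow_of_exponent_le (by norm_num) ?_
  have : (0 : ℝ) ≤ j := Nat.cast_nonneg j
  nlinarith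

/-- In `φ(d) m^2`, with `m` the discrepancy, one factor `φ(d) m` is replaced by its trivial bound `3
· 2^(j+1)`, leaving a sum linear in `m`. -/
theorem blockError_le {ε : ℝ} (hε : 0 ≤ ε) {j : ℕ} (hj : 1 ≤ j) :
    blockError ε j ≤ 108 / 2 ^ j *
      ∑ d ∈ Icc 1 ⌊(2 : ℝ) ^ ((j : ℝ) * (1 - ε))⌋₊, maxDiscrepancy (2 ^ (j + 1)) d +
      8 / 2 ^ j := by
  have hp : (0 : ℝ) < 2 ^ j := by positivity
  set D := ⌊(2 : ℝ) ^ ((j : ℝ) * (1 - ε))⌋₊ with hD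
  have hDle : (D : ℝ) ≤ 2 ^ j :=
    (Nat.floor_le (by positivity)).trans (two_rpow_mul_one_sub_le hε j)
  have hx2 : (2 : ℝ) ≤ 2 ^ (j + 1) := by
    calc (2 : ℝ) = 2 ^ 1 := by norm_num
      _ ≤ 2 ^ (j + 1) := pow_le_pow_right₀ (by norm_num) (by omega)
  calc blockError ε j
      ≤ ∑ d ∈ Icc 1 D, (108 / 2 ^ j * maxDiscrepancy (2 ^ (j + 1)) d + 8 / (2 ^ j) ^ 2) := by
        refine sum_le_sum fun d hd => ?_
        have hd1 : 0 < d := (mem_Icc.mp hd).1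
        have hd0 : (1 : ℝ) ≤ d := by exact_mod_cast hd1
        have hφ : (0 : ℝ) < d.totient := by exact_mod_cast Nat.totient_pos.mpr hd1
        have hφd : (d.totient : ℝ) ≤ d := by exact_mod_cast Nat.totient_le d
        have h := abs_blockSum_sub_le hj hd1
        have hm0 := maxDiscrepancy_nonneg (2 ^ (j + 1)) d
        have hm1 := maxDiscrepancy_le hd1 hx2
        rw [le_div_iff₀ hφ] at hm1
        set m := maxDiscrepancy (2 ^ (j + 1)) d
        set E := blockSum j d - Real.log (((j : ℝ) + 1) / j) / d.totient
        have h1 : E ^ 2 ≤ (3 * m / 2 ^ j + 2 / (2 ^ j * d)) ^ 2 := by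
          rw [← sq_abs E]
          exact pow_le_pow_left₀ (abs_nonneg _) h 2
        have h2 : (3 * m / 2 ^ j + 2 / (2 ^ j * d)) ^ 2 ≤
            2 * (3 * m / 2 ^ j) ^ 2 + 2 * (2 / (2 ^ j * (d : ℝ))) ^ 2 := by
          nlinarith [sq_nonneg (3 * m / 2 ^ j - 2 / (2 ^ j * (d : ℝ)))]
        calc (d.totient : ℝ) * E ^ 2
            ≤ d.totient * (2 * (3 * m / 2 ^ j) ^ 2 + 2 * (2 / (2 ^ j * (d : ℝ))) ^ 2) := by
              gcongr
              exact h1.trans h2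
          _ = 18 / (2 ^ j) ^ 2 * (m * d.totient) * m +
                8 / (2 ^ j) ^ 2 * (d.totient / (d : ℝ) ^ 2) := by
              field_simp
              ring
          _ ≤ 18 / (2 ^ j) ^ 2 * (3 * 2 ^ (j + 1)) * m + 8 / (2 ^ j) ^ 2 * 1 := by
              gcongr
              rw [div_le_one (by positivity)]
              nlinarith
          _ = _ := by
              rw [pow_succ]
              field_simp
              ring
    _ = 108 / 2 ^ j * ∑ d ∈ Icc 1 D, maxDiscrepancy (2 ^ (j + 1)) d +
          D * (8 / (2 ^ j) ^ 2) := by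
        rw [sum_add_distrib, ← mul_sum]
        simp
    _ ≤ 108 / 2 ^ j * ∑ d ∈ Icc 1 D, maxDiscrepancy (2 ^ (j + 1)) d +
          2 ^ j * (8 / (2 ^ j) ^ 2) := by gcongr
    _ = _ := by field_simp

theorem summable_sq_mul_blockError (hEH : ElliottHalberstam) {ε : ℝ} (hε : 0 < ε) (hε1 : ε < 1) :
    Summable fun j : ℕ => ((j : ℝ) + 1) ^ 2 * blockError ε j := by
  -- A saving of `log^4` makes `blockError` of order `j^(-4)`, so that the weighted terms are of
  -- order `j^(-2)`.
  obtain ⟨C, hC⟩ := (hEH 4 ε (by norm_num) hε).bound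
  have hpow : Tendsto (fun j : ℕ => (2 : ℝ) ^ (j + 1)) atTop atTop :=
    (tendsto_pow_atTop_atTop_of_one_lt (by norm_num : (1 : ℝ) < 2)).comp (tendsto_add_atTop_nat 1)
  have hs1 : Summable fun j : ℕ => 3456 * |C| * (1 / ((j : ℝ) + 1) ^ 2) := by
    refine Summable.mul_left _ ?_
    have := (summable_nat_add_iff 1).mpr (Real.summable_one_div_nat_pow.mpr (by norm_num : 1 < 2))
    exact this.congr fun j => by push_cast; rfl
  have hs2 : Summable fun j : ℕ => 16 * (((j : ℝ) + 1) ^ 2 * (1 / 2) ^ (j + 1)) := by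
    refine Summable.mul_left _ ?_
    have := (summable_nat_add_iff 1).mpr
      (summable_pow_mul_geometric_of_norm_lt_one 2 (r := (1 / 2 : ℝ)) (by norm_num))
    exact this.congr fun j => by push_cast; rfl
  refine Summable.of_norm_bounded_eventually_nat (hs1.add hs2) ?_
  filter_upwards [hpow.eventually hC, eventually_ge_atTop 1] with j hj hj1
  have hnn := blockError_nonneg ε j
  rw [Real.norm_of_nonneg (by positivity)]
  have hp : (0 : ℝ) < 2 ^ j := by positivity
  have hj0 : (0 : ℝ) < (j : ℝ) + 1 := by positivity
  have hlog : ((j : ℝ) + 1) / 2 ≤ Real.log (2 ^ (j + 1)) := by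
    rw [Real.log_pow]
    have := Real.log_two_gt_d9
    push_cast
    nlinarith
  have hsum : ∑ d ∈ Icc 1 ⌊(2 : ℝ) ^ ((j : ℝ) * (1 - ε))⌋₊, maxDiscrepancy (2 ^ (j + 1)) d ≤
      |C| * (2 ^ (j + 1) / (((j : ℝ) + 1) / 2) ^ 4) := by
    calc _ ≤ ∑ d ∈ Icc 1 ⌊((2 : ℝ) ^ (j + 1)) ^ (1 - ε)⌋₊, maxDiscrepancy (2 ^ (j + 1)) d := by
          refine sum_le_sum_of_subset_of_nonneg (Icc_subset_Icc_right (Nat.floor_le_floor ?_))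
            fun _ _ _ => maxDiscrepancy_nonneg _ _
          rw [← Real.rpow_natCast 2 (j + 1), ← Real.rpow_mul (by norm_num)]
          refine Real.rpow_le_rpow_of_exponent_le (by norm_num) ?_
          push_cast
          nlinarith
      _ ≤ C * ‖(2 : ℝ) ^ (j + 1) / Real.log (2 ^ (j + 1)) ^ (4 : ℝ)‖ :=
          (le_abs_self _).trans hj
      _ ≤ |C| * (2 ^ (j + 1) / (((j : ℝ) + 1) / 2) ^ 4) := by
          have h4 : Real.log ((2 : ℝ) ^ (j + 1)) ^ (4 : ℝ) = Real.log (2 ^ (j + 1)) ^ 4 := by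
            exact_mod_cast Real.rpow_natCast _ 4
          have hl0 : 0 < Real.log ((2 : ℝ) ^ (j + 1)) := by linarith [half_pos hj0]
          rw [h4, Real.norm_of_nonneg (by positivity)]
          refine mul_le_mul (le_abs_self C) ?_ (by positivity) (abs_nonneg C)
          gcongr
  calc ((j : ℝ) + 1) ^ 2 * blockError ε j
      ≤ ((j : ℝ) + 1) ^ 2 * (108 / 2 ^ j * (|C| * (2 ^ (j + 1) / (((j : ℝ) + 1) / 2) ^ 4)) +
        8 / 2 ^ j) := by
        gcongr
        refine (blockError_le hε.le hj1).trans ?_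
        gcongr
    _ = _ := by
        rw [one_div_pow, pow_succ (2 : ℝ)]
        field_simp
        ring

/-- Cauchy–Schwarz across the blocks with weights `1/(j+1)` and `j+1`: the first factor is `∑
1/(j+1)^2 ≤ 2`, the second is the convergent series above, whence a bound independent of `J`. -/
theorem sum_totient_mul_farSum_sub_sq_le (hEH : ElliottHalberstam) {ε : ℝ} (hε : 0 < ε)
    (hε1 : ε < 1) : ∃ B : ℝ, ∀ J : ℕ,
      ∑ d ∈ Icc 1 (2 ^ J), (d.totient : ℝ) * (farSum ε J d - modelSum ε J d) ^ 2 ≤ B := by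
  classical
  have hsum := summable_sq_mul_blockError hEH hε hε1
  refine ⟨2 * ∑' j : ℕ, ((j : ℝ) + 1) ^ 2 * blockError ε j, fun J => ?_⟩
  set E : ℕ → ℕ → ℝ := fun j d => if IsFarBlock ε d j then
    blockSum j d - Real.log (((j : ℝ) + 1) / j) / d.totient else 0 with hE
  have hdiff : ∀ d, farSum ε J d - modelSum ε J d = ∑ j ∈ range J, E j d := by
    intro d
    rw [farSum, modelSum, ← sum_sub_distrib, sum_filter]
  have hinv : ∑ j ∈ range J, (1 / ((j : ℝ) + 1)) ^ 2 ≤ 2 := by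
    refine le_trans (le_of_eq ?_) (sum_Icc_inv_sq_le_two J)
    refine sum_nbij' (fun j => j + 1) (fun s => s - 1) ?_ ?_ ?_ ?_ ?_ <;>
      simp only [mem_range, mem_Icc]
    any_goals omega
    · intro j _
      push_cast
      rw [one_div_pow]
  have hcs : ∀ d, (∑ j ∈ range J, E j d) ^ 2 ≤
      2 * ∑ j ∈ range J, ((j : ℝ) + 1) ^ 2 * E j d ^ 2 := by
    intro d
    have h := sum_mul_sq_le_sq_mul_sq (range J) (fun j : ℕ => 1 / ((j : ℝ) + 1))
      (fun j : ℕ => ((j : ℝ) + 1) * E j d)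
    have e : ∑ j ∈ range J, 1 / ((j : ℝ) + 1) * (((j : ℝ) + 1) * E j d) =
        ∑ j ∈ range J, E j d := by
      refine sum_congr rfl fun j _ => ?_
      have : (j : ℝ) + 1 ≠ 0 := by positivity
      field_simp
    rw [e] at h
    refine h.trans ?_
    simp only [mul_pow]
    exact mul_le_mul_of_nonneg_right hinv (sum_nonneg fun _ _ => by positivity)
  have hblock : ∀ j ∈ range J, ∑ d ∈ Icc 1 (2 ^ J), (d.totient : ℝ) * E j d ^ 2 ≤
      blockError ε j := by
    intro j _
    calc _ ≤ ∑ d ∈ (Icc 1 (2 ^ J)).filter (fun d => IsFarBlock ε d j), (d.totient : ℝ) *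
          (blockSum j d - Real.log (((j : ℝ) + 1) / j) / d.totient) ^ 2 := by
          rw [sum_filter]
          refine sum_le_sum fun d _ => ?_
          simp only [hE]
          split_ifs <;> simp
      _ ≤ _ := by
          refine sum_le_sum_of_subset_of_nonneg (fun d hd => ?_) fun _ _ _ => by positivity
          obtain ⟨h1, h2⟩ := mem_filter.mp hd
          exact mem_Icc.mpr ⟨(mem_Icc.mp h1).1, Nat.le_floor h2.2⟩
  calc ∑ d ∈ Icc 1 (2 ^ J), (d.totient : ℝ) * (farSum ε J d - modelSum ε J d) ^ 2
      ≤ ∑ d ∈ Icc 1 (2 ^ J), (d.totient : ℝ) *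
          (2 * ∑ j ∈ range J, ((j : ℝ) + 1) ^ 2 * E j d ^ 2) := by
        refine sum_le_sum fun d _ => ?_
        rw [hdiff]
        exact mul_le_mul_of_nonneg_left (hcs d) (Nat.cast_nonneg _)
    _ = 2 * ∑ j ∈ range J, ((j : ℝ) + 1) ^ 2 *
          ∑ d ∈ Icc 1 (2 ^ J), (d.totient : ℝ) * E j d ^ 2 := by
        simp only [mul_sum]
        rw [sum_comm]
        refine sum_congr rfl fun j _ => sum_congr rfl fun d _ => ?_
        ring
    _ ≤ 2 * ∑ j ∈ range J, ((j : ℝ) + 1) ^ 2 * blockError ε j := by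
        gcongr with j hj
        exact hblock j hj
    _ ≤ _ := by
        gcongr
        exact hsum.sum_le_tsum _ fun j _ => by
          have := blockError_nonneg ε j
          positivity

end FarPart

/-! ### The mean square of the model. -/

section MainTerm

open Finset

theorem sum_Ico_log_succ_div {m J : ℕ} (hm : 1 ≤ m) (hmJ : m ≤ J) :
    ∑ i ∈ Ico m J, Real.log (((i : ℝ) + 1) / i) = Real.log ((J : ℝ) / m) := by
  induction J, hmJ using Nat.le_induction with
  | base =>
    have : (m : ℝ) ≠ 0 := by exact_mod_cast (by omega : m ≠ 0)
    simp [this]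
  | succ J hJ ih =>
    have h1 : (m : ℝ) ≠ 0 := by exact_mod_cast (by omega : m ≠ 0)
    have h2 : (J : ℝ) ≠ 0 := by exact_mod_cast (by omega : J ≠ 0)
    have h3 : (J : ℝ) + 1 ≠ 0 := by positivity
    rw [sum_Ico_succ_top hJ, ih, ← Real.log_mul (by positivity) (by positivity)]
    congr 1
    push_cast
    field_simp

theorem log_succ_div_nonneg (i : ℕ) : 0 ≤ Real.log (((i : ℝ) + 1) / i) := by
  rcases Nat.eq_zero_or_pos i with rfl | hi
  · simp
  · have : (0 : ℝ) < i := by exact_mod_cast hi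
    refine Real.log_nonneg ?_
    rw [le_div_iff₀ this]
    linarith

/-- Write `min i j` as the number of `m ≥ 1` with `m ≤ i` and `m ≤ j`. After exchanging sums each
`m` yields the square of a tail sum, which telescopes to `log(J/m)`. -/
theorem sum_mul_mul_min_eq (J : ℕ) :
    ∑ i ∈ range J, ∑ j ∈ range J, Real.log (((i : ℝ) + 1) / i) * Real.log (((j : ℝ) + 1) / j) *
      ((min i j : ℕ) : ℝ) = ∑ m ∈ Ico 1 J, Real.log ((J : ℝ) / m) ^ 2 := by
  set a : ℕ → ℝ := fun i => Real.log (((i : ℝ) + 1) / i) with ha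
  have hmin : ∀ i ∈ range J, ∀ j ∈ range J, ((min i j : ℕ) : ℝ) =
      ∑ m ∈ Ico 1 J, (if m ≤ i then (1 : ℝ) else 0) * (if m ≤ j then 1 else 0) := by
    intro i hi j hj
    have hi' := mem_range.mp hi
    have hj' := mem_range.mp hj
    have : (Ico 1 J).filter (fun m => m ≤ i ∧ m ≤ j) = Icc 1 (min i j) := by
      ext m
      simp only [mem_filter, mem_Ico, mem_Icc, le_min_iff]
      omega
    calc ((min i j : ℕ) : ℝ) = (((Ico 1 J).filter (fun m => m ≤ i ∧ m ≤ j)).card : ℝ) := by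
          rw [this]; simp
      _ = _ := by
          rw [← sum_boole]
          refine sum_congr rfl fun m _ => ?_
          by_cases h1 : m ≤ i <;> by_cases h2 : m ≤ j <;> simp [h1, h2]
  calc _ = ∑ i ∈ range J, ∑ j ∈ range J, ∑ m ∈ Ico 1 J,
        (a i * if m ≤ i then (1 : ℝ) else 0) * (a j * if m ≤ j then (1 : ℝ) else 0) := by
        refine sum_congr rfl fun i hi => sum_congr rfl fun j hj => ?_
        rw [hmin i hi j hj, mul_sum]
        exact sum_congr rfl fun m _ => by ring
    _ = ∑ m ∈ Ico 1 J, (∑ i ∈ range J, a i * if m ≤ i then (1 : ℝ) else 0) ^ 2 := by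
        calc _ = ∑ i ∈ range J, ∑ m ∈ Ico 1 J, ∑ j ∈ range J,
              (a i * if m ≤ i then (1 : ℝ) else 0) * (a j * if m ≤ j then (1 : ℝ) else 0) :=
              sum_congr rfl fun i _ => sum_comm
          _ = _ := by
              rw [sum_comm]
              exact sum_congr rfl fun m _ => by rw [sq, sum_mul_sum]
    _ = _ := by
        refine sum_congr rfl fun m hm => ?_
        have hm' := mem_Ico.mp hm
        rw [← sum_Ico_log_succ_div hm'.1 hm'.2.le]
        congr 1
        simp only [mul_ite, mul_one, mul_zero]
        rw [← sum_filter]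
        congr 1
        ext i
        simp only [mem_filter, mem_range, mem_Ico]
        omega

theorem integral_log_div_sq {J : ℝ} (hJ : 1 ≤ J) :
    ∫ t in (1 : ℝ)..J, Real.log (J / t) ^ 2 =
      2 * J - (Real.log J ^ 2 + 2 * Real.log J + 2) := by
  have hJ0 : 0 < J := by linarith
  have hderiv : ∀ t ∈ Set.uIcc 1 J, HasDerivAt (fun t : ℝ => t * (Real.log (J / t) ^ 2 +
      2 * Real.log (J / t) + 2)) (Real.log (J / t) ^ 2) t := by
    intro t ht
    rw [Set.uIcc_of_le hJ] at ht
    have ht0 : t ≠ 0 := by linarith [ht.1]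
    have h1 : HasDerivAt (fun t : ℝ => Real.log (J / t)) (-1 / t) t := by
      have := ((hasDerivAt_const t J).div (hasDerivAt_id t) ht0).log
        (div_ne_zero hJ0.ne' ht0)
      refine this.congr_deriv ?_
      simp only [id, Pi.div_apply]
      field_simp
      ring
    have h2 := (hasDerivAt_id t).mul (((h1.pow 2).add (h1.const_mul 2)).add_const 2)
    refine h2.congr_deriv ?_
    simp only [id, Pi.add_apply, Pi.pow_apply]
    field_simp
    ring
  rw [intervalIntegral.integral_eq_sub_of_hasDerivAt hderiv]
  · rw [div_self hJ0.ne', div_one, Real.log_one]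
    ring
  · refine ContinuousOn.intervalIntegrable ?_
    rw [Set.uIcc_of_le hJ]
    refine ContinuousOn.pow (ContinuousOn.log (continuousOn_const.div continuousOn_id
      fun t ht => ?_) fun t ht => ?_) 2
    · exact (lt_of_lt_of_le one_pos ht.1).ne'
    · exact (div_pos hJ0 (lt_of_lt_of_le one_pos ht.1)).ne'

theorem tendsto_log_sq_div_natCast :
    Tendsto (fun J : ℕ => Real.log J ^ 2 / J) atTop (nhds 0) := by
  have := (Real.isLittleO_pow_log_id_atTop (n := 2)).tendsto_div_nhds_zero
  exact this.comp tendsto_natCast_atTop_atTop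

/-- A Riemann sum for the integral of `log^2` over `(0, 1)`. The summand decreases in `m`, so
comparison with `integral_log_div_sq` leaves an error `O(1 + log^2 J)`. -/
theorem tendsto_sum_log_div_sq :
    Tendsto (fun J : ℕ => (∑ m ∈ Ico 1 J, Real.log ((J : ℝ) / m) ^ 2) / J) atTop (nhds 2) := by
  have hinv : Tendsto (fun J : ℕ => (1 : ℝ) / J) atTop (nhds 0) :=
    tendsto_one_div_atTop_nhds_zero_nat
  have hl2 := tendsto_log_sq_div_natCast
  have hlower : Tendsto (fun J : ℕ => 2 - (2 * (Real.log J ^ 2 / J) + 3 * ((1 : ℝ) / J)))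
      atTop (nhds 2) := by
    simpa using ((hl2.const_mul 2).add (hinv.const_mul 3)).const_sub 2
  have hupper : Tendsto (fun J : ℕ => 2 + Real.log J ^ 2 / J) atTop (nhds 2) := by
    simpa using hl2.const_add 2
  have hanti : ∀ J : ℕ, 1 ≤ J → AntitoneOn (fun t : ℝ => Real.log ((J : ℝ) / t) ^ 2)
      (Set.Icc ((1 : ℕ) : ℝ) J) := by
    intro J hJ s hs t ht hst
    have hs1 : (1 : ℝ) ≤ s := by simpa using hs.1
    have ht1 : (1 : ℝ) ≤ t := by simpa using ht.1
    have hJ0 : (0 : ℝ) < J := by exact_mod_cast hJ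
    have h1 : 0 ≤ Real.log ((J : ℝ) / t) := Real.log_nonneg (by
      rw [le_div_iff₀ (by linarith)]; linarith [ht.2])
    refine pow_le_pow_left₀ h1 (Real.log_le_log (by positivity) ?_) 2
    gcongr
  refine tendsto_of_tendsto_of_tendsto_of_le_of_le' hlower hupper ?_ ?_
  · filter_upwards [eventually_ge_atTop 1] with J hJ
    have hJ0 : (0 : ℝ) < J := by exact_mod_cast hJ
    have hJ1 : (1 : ℝ) ≤ J := by exact_mod_cast hJ
    have h := (hanti J hJ).integral_le_sum_Ico hJ
    rw [Nat.cast_one, integral_log_div_sq hJ1] at h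
    rw [le_div_iff₀ hJ0]
    have e : (2 - (2 * (Real.log J ^ 2 / J) + 3 * ((1 : ℝ) / J))) * J =
        2 * J - (2 * Real.log J ^ 2 + 3) := by field_simp
    rw [e]
    nlinarith [sq_nonneg (Real.log J - 1)]
  · filter_upwards [eventually_ge_atTop 1] with J hJ
    have hJ0 : (0 : ℝ) < J := by exact_mod_cast hJ
    have hJ1 : (1 : ℝ) ≤ J := by exact_mod_cast hJ
    have h := (hanti J hJ).sum_le_integral_Ico hJ
    rw [Nat.cast_one, integral_log_div_sq hJ1] at h
    have hlog := Real.log_nonneg hJ1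
    rw [div_le_iff₀ hJ0]
    have e : (2 + Real.log J ^ 2 / J) * (J : ℝ) = 2 * J + Real.log J ^ 2 := by field_simp
    rw [e]
    -- The integral bounds the sum shifted by one; undoing the shift adds the term `m = 1`, which is
    -- `log^2 J`.
    have hshift : ∑ m ∈ Ico 1 J, Real.log ((J : ℝ) / m) ^ 2 ≤
        ∑ m ∈ Ico 1 J, Real.log ((J : ℝ) / ((m + 1 : ℕ) : ℝ)) ^ 2 + Real.log J ^ 2 := by
      rw [sum_Ico_add' (fun m : ℕ => Real.log ((J : ℝ) / (m : ℝ)) ^ 2) 1 J 1]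
      have h1 := sum_eq_sum_Ico_succ_bot (show 1 < J + 1 by omega)
        (fun m : ℕ => Real.log ((J : ℝ) / (m : ℝ)) ^ 2)
      have h2 := sum_Ico_succ_top hJ (fun m : ℕ => Real.log ((J : ℝ) / (m : ℝ)) ^ 2)
      rw [Nat.cast_one, div_one] at h1
      have h3 := sq_nonneg (Real.log ((J : ℝ) / (J : ℝ)))
      linarith
    have hsq := sq_nonneg (Real.log (J : ℝ))
    linarith

/-- The summatory function of `1/φ` at `2^(m(1-ε))`. -/
noncomputable def totientPartialSum (ε : ℝ) (m : ℕ) : ℝ :=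
  ∑ d ∈ Icc 1 ⌊(2 : ℝ) ^ ((m : ℝ) * (1 - ε))⌋₊, 1 / (d.totient : ℝ)

theorem tendsto_totientPartialSum_div {ε : ℝ} (hε1 : ε < 1) :
    Tendsto (fun m : ℕ => totientPartialSum ε m / m) atTop
      (nhds (totientConstant * ((1 - ε) * Real.log 2))) := by
  have hc : 0 < (1 - ε) * Real.log 2 := mul_pos (by linarith) (Real.log_pos (by norm_num))
  have hexp : Tendsto (fun m : ℕ => (m : ℝ) * (1 - ε)) atTop atTop :=
    tendsto_natCast_atTop_atTop.atTop_mul_const (by linarith)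
  have hN : Tendsto (fun m : ℕ => ⌊(2 : ℝ) ^ ((m : ℝ) * (1 - ε))⌋₊) atTop atTop := by
    refine tendsto_nat_floor_atTop.comp ?_
    have : (fun m : ℕ => (2 : ℝ) ^ ((m : ℝ) * (1 - ε))) =
        fun m : ℕ => Real.exp (Real.log 2 * ((m : ℝ) * (1 - ε))) := by
      ext m
      rw [Real.rpow_def_of_pos two_pos]
    rw [this]
    exact Real.tendsto_exp_atTop.comp (hexp.const_mul_atTop (Real.log_pos (by norm_num)))
  have hlog : Tendsto (fun m : ℕ => Real.log ⌊(2 : ℝ) ^ ((m : ℝ) * (1 - ε))⌋₊ / m) atTop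
      (nhds ((1 - ε) * Real.log 2)) := by
    have hl : Tendsto (fun m : ℕ => (1 - ε) * Real.log 2 - Real.log 2 * ((1 : ℝ) / m)) atTop
        (nhds ((1 - ε) * Real.log 2)) := by
      simpa using (tendsto_one_div_atTop_nhds_zero_nat (𝕜 := ℝ) |>.const_mul
        (Real.log 2)).const_sub ((1 - ε) * Real.log 2)
    refine tendsto_of_tendsto_of_tendsto_of_le_of_le' hl tendsto_const_nhds ?_ ?_
    · filter_upwards [eventually_ge_atTop 1] with m hm
      have hm0 : (0 : ℝ) < m := by exact_mod_cast hm
      have hy : (1 : ℝ) ≤ (2 : ℝ) ^ ((m : ℝ) * (1 - ε)) :=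
        Real.one_le_rpow (by norm_num) (mul_nonneg hm0.le (by linarith))
      have h1 : (2 : ℝ) ^ ((m : ℝ) * (1 - ε)) / 2 ≤ ⌊(2 : ℝ) ^ ((m : ℝ) * (1 - ε))⌋₊ := by
        have a1 := Nat.lt_floor_add_one ((2 : ℝ) ^ ((m : ℝ) * (1 - ε)))
        have a2 : (1 : ℝ) ≤ ⌊(2 : ℝ) ^ ((m : ℝ) * (1 - ε))⌋₊ := by
          exact_mod_cast (Nat.one_le_floor_iff _).mpr hy
        linarith
      have h2 := Real.log_le_log (by positivity) h1
      rw [Real.log_div (by positivity) (by norm_num), Real.log_rpow two_pos] at h2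
      rw [le_div_iff₀ hm0]
      have e : ((1 - ε) * Real.log 2 - Real.log 2 * ((1 : ℝ) / m)) * m =
          (m : ℝ) * (1 - ε) * Real.log 2 - Real.log 2 := by field_simp
      rw [e]
      exact h2
    · filter_upwards [eventually_ge_atTop 1] with m hm
      have hm0 : (0 : ℝ) < m := by exact_mod_cast hm
      have hy : (1 : ℝ) ≤ (2 : ℝ) ^ ((m : ℝ) * (1 - ε)) :=
        Real.one_le_rpow (by norm_num) (mul_nonneg hm0.le (by linarith))
      have h0 : (0 : ℝ) < ⌊(2 : ℝ) ^ ((m : ℝ) * (1 - ε))⌋₊ := by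
        exact_mod_cast (Nat.one_le_floor_iff _).mpr hy
      have h1 := Real.log_le_log h0 (Nat.floor_le (by positivity))
      rw [Real.log_rpow two_pos] at h1
      rw [div_le_iff₀ hm0]
      linarith
  refine ((tendsto_sum_inv_totient_div_log.comp hN).mul hlog).congr' ?_
  filter_upwards [hN.eventually_ge_atTop 2] with m hm
  have : 0 < Real.log ⌊(2 : ℝ) ^ ((m : ℝ) * (1 - ε))⌋₊ :=
    Real.log_pos (by exact_mod_cast hm)
  simp only [Function.comp, totientPartialSum]
  field_simp

/-- The block bounds on `d` increase with `j`, so both blocks `i` and `j` are far from `d` exactly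
when `d` meets the bound of `min i j`. One factor `1/φ(d)` survives the weight. -/
theorem sum_totient_mul_modelSum_sq_eq {ε : ℝ} (hε : 0 ≤ ε) (hε1 : ε ≤ 1) (J : ℕ) :
    ∑ d ∈ Icc 1 (2 ^ J), (d.totient : ℝ) * modelSum ε J d ^ 2 =
      ∑ i ∈ range J, ∑ j ∈ range J, Real.log (((i : ℝ) + 1) / i) *
        Real.log (((j : ℝ) + 1) / j) * totientPartialSum ε (min i j) := by
  classical
  set a : ℕ → ℝ := fun i => Real.log (((i : ℝ) + 1) / i) with ha
  set D : ℕ → ℕ := fun m => ⌊(2 : ℝ) ^ ((m : ℝ) * (1 - ε))⌋₊ with hD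
  have hmem : ∀ d m : ℕ, d ≤ D m ↔ (d : ℝ) ≤ (2 : ℝ) ^ ((m : ℝ) * (1 - ε)) := fun d m =>
    Nat.le_floor_iff (by positivity)
  have hmono : Monotone D := fun m n hmn => Nat.floor_le_floor
    (Real.rpow_le_rpow_of_exponent_le (by norm_num)
      (mul_le_mul_of_nonneg_right (by exact_mod_cast hmn) (by linarith)))
  have hDle : ∀ m < J, D m ≤ 2 ^ J := by
    intro m hm
    have h1 : (D m : ℝ) ≤ 2 ^ m :=
      (Nat.floor_le (by positivity)).trans (two_rpow_mul_one_sub_le hε m)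
    have h2 : D m ≤ 2 ^ m := by exact_mod_cast h1
    exact h2.trans (Nat.pow_le_pow_right (by norm_num) hm.le)
  have hmodel : ∀ d, modelSum ε J d =
      (∑ j ∈ range J, if d ≤ D j then a j else 0) / d.totient := by
    intro d
    rw [modelSum, sum_filter, sum_div]
    refine sum_congr rfl fun j _ => ?_
    -- Block `0` is never far; its coefficient `log(1/0)` is `0` by convention, so it may be
    -- included.
    rcases Nat.eq_zero_or_pos j with rfl | hj
    · simp [ha]
    · by_cases h : d ≤ D j
      · rw [if_pos h, if_pos ⟨hj, (hmem d j).mp h⟩]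
      · rw [if_neg h, if_neg (fun h' => h ((hmem d j).mpr h'.2)), zero_div]
  calc _ = ∑ d ∈ Icc 1 (2 ^ J), ∑ i ∈ range J, ∑ j ∈ range J,
        (if d ≤ D (min i j) then a i * a j * (1 / (d.totient : ℝ)) else 0) := by
        refine sum_congr rfl fun d hd => ?_
        have hφ : (d.totient : ℝ) ≠ 0 := by
          exact_mod_cast (Nat.totient_pos.mpr (mem_Icc.mp hd).1).ne'
        rw [hmodel, div_pow, sq (∑ j ∈ range J, _), sum_mul_sum]
        rw [show ∀ S : ℝ, (d.totient : ℝ) * (S / (d.totient : ℝ) ^ 2) = S * (1 / d.totient) from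
          fun S => by field_simp, sum_mul]
        refine sum_congr rfl fun i _ => ?_
        rw [sum_mul]
        refine sum_congr rfl fun j _ => ?_
        have hmin : d ≤ D (min i j) ↔ d ≤ D i ∧ d ≤ D j := by
          rw [hmono.map_min, le_min_iff]
        by_cases h1 : d ≤ D i <;> by_cases h2 : d ≤ D j <;> simp [hmin, h1, h2]
    _ = ∑ i ∈ range J, ∑ j ∈ range J, ∑ d ∈ Icc 1 (2 ^ J),
        (if d ≤ D (min i j) then a i * a j * (1 / (d.totient : ℝ)) else 0) := by
        rw [sum_comm]
        exact sum_congr rfl fun i _ => sum_comm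
    _ = _ := by
        refine sum_congr rfl fun i hi => sum_congr rfl fun j _ => ?_
        rw [← sum_filter, totientPartialSum, mul_sum]
        refine sum_congr ?_ fun _ _ => rfl
        ext d
        have := hDle (min i j) ((min_le_left i j).trans_lt (mem_range.mp hi))
        simp only [mem_filter, mem_Icc]
        change _ ↔ 1 ≤ d ∧ d ≤ D (min i j)
        omega

/-- Turns the asymptotic into a bound for every `m`, small values included, so that it can be
inserted in a double sum over `min i j`. -/
theorem exists_abs_sub_le_of_tendsto_div {G : ℕ → ℝ} {c δ : ℝ} (hδ : 0 < δ)
    (h : Tendsto (fun m : ℕ => G m / m) atTop (nhds c)) :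
    ∃ K : ℝ, 0 ≤ K ∧ ∀ m : ℕ, |G m - c * m| ≤ δ * m + K := by
  obtain ⟨M, hM⟩ := eventually_atTop.mp (Metric.tendsto_nhds.mp h δ hδ)
  refine ⟨∑ m ∈ range (M + 1), |G m - c * m|, sum_nonneg fun _ _ => abs_nonneg _, fun m => ?_⟩
  by_cases hm : m ≤ M
  · have h1 := single_le_sum (f := fun m : ℕ => |G m - c * m|) (fun _ _ => abs_nonneg _)
      (mem_range.mpr (Nat.lt_succ_of_le hm))
    have h2 : 0 ≤ δ * m := by positivity
    linarith
  · have hm0 : (0 : ℝ) < m := by exact_mod_cast (by omega : 0 < m)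
    have h1 := hM m (by omega)
    rw [Real.dist_eq] at h1
    have h2 : |G m - c * m| = |G m / m - c| * m := by
      rw [← abs_of_pos hm0, ← abs_mul, abs_of_pos hm0, sub_mul, div_mul_cancel₀ _ hm0.ne']
    have h3 : 0 ≤ ∑ m ∈ range (M + 1), |G m - c * m| := sum_nonneg fun _ _ => abs_nonneg _
    rw [h2]
    nlinarith

/-- Replacing `totientPartialSum ε m` by `cm` costs `δ W(J) + K (∑ a_i)^2` with `∑ a_i = log J`.
Since `W(J) ~ 2J`, this is at most a small multiple of `J` plus `o(J)`. -/
theorem tendsto_sum_totient_mul_modelSum_sq {ε : ℝ} (hε : 0 ≤ ε) (hε1 : ε < 1) :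
    Tendsto (fun J : ℕ => (∑ d ∈ Icc 1 (2 ^ J), (d.totient : ℝ) * modelSum ε J d ^ 2) / J) atTop
      (nhds (2 * (totientConstant * ((1 - ε) * Real.log 2)))) := by
  set c := totientConstant * ((1 - ε) * Real.log 2) with hc
  set a : ℕ → ℝ := fun i => Real.log (((i : ℝ) + 1) / i) with ha
  have ha0 : ∀ i, 0 ≤ a i := log_succ_div_nonneg
  set W : ℕ → ℝ := fun J => ∑ m ∈ Ico 1 J, Real.log ((J : ℝ) / m) ^ 2 with hW
  have hWlim : Tendsto (fun J : ℕ => W J / J) atTop (nhds 2) := tendsto_sum_log_div_sq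
  have hsuma : ∀ J : ℕ, 1 ≤ J → ∑ i ∈ range J, a i = Real.log J := by
    intro J hJ
    have h := sum_Ico_log_succ_div le_rfl hJ
    rw [range_eq_Ico, sum_eq_sum_Ico_succ_bot (by omega), zero_add, h]
    simp [ha]
  have hdiff : Tendsto (fun J : ℕ => (∑ d ∈ Icc 1 (2 ^ J), (d.totient : ℝ) * modelSum ε J d ^ 2) / J
      - c * (W J / J)) atTop (nhds 0) := by
    rw [Metric.tendsto_nhds]
    intro η hη
    obtain ⟨K, hK, hG⟩ := exists_abs_sub_le_of_tendsto_div (δ := η / 6) (by positivity)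
      (tendsto_totientPartialSum_div hε1)
    have hlim2 : Tendsto (fun J : ℕ => K * (Real.log J ^ 2 / J)) atTop (nhds 0) := by
      simpa using tendsto_log_sq_div_natCast.const_mul K
    filter_upwards [hWlim.eventually_lt_const (by norm_num : (2 : ℝ) < 3 / 1),
      hlim2.eventually_lt_const (half_pos hη), eventually_ge_atTop 1] with J h1 h2 hJ
    have hJ0 : (0 : ℝ) < J := by exact_mod_cast hJ
    rw [Real.dist_eq, sub_zero, sum_totient_mul_modelSum_sq_eq hε hε1.le, ← mul_div_assoc,
      ← sub_div, abs_div, abs_of_pos hJ0]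
    have hWeq := sum_mul_mul_min_eq J
    have hbound : |∑ i ∈ range J, ∑ j ∈ range J, a i * a j * totientPartialSum ε (min i j) -
        c * W J| ≤ η / 6 * W J + K * Real.log J ^ 2 := by
      calc _ = |∑ i ∈ range J, ∑ j ∈ range J, a i * a j *
            (totientPartialSum ε (min i j) - c * (min i j : ℕ))| := by
            rw [hW]
            simp only
            rw [← hWeq, mul_sum, ← sum_sub_distrib]
            congr 1
            refine sum_congr rfl fun i _ => ?_
            rw [mul_sum, ← sum_sub_distrib]
            exact sum_congr rfl fun j _ => by ring
        _ ≤ ∑ i ∈ range J, ∑ j ∈ range J, a i * a j * (η / 6 * (min i j : ℕ) + K) := by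
            refine (abs_sum_le_sum_abs _ _).trans (sum_le_sum fun i _ => ?_)
            refine (abs_sum_le_sum_abs _ _).trans (sum_le_sum fun j _ => ?_)
            rw [abs_mul, abs_of_nonneg (mul_nonneg (ha0 i) (ha0 j))]
            exact mul_le_mul_of_nonneg_left (hG _) (mul_nonneg (ha0 i) (ha0 j))
        _ = η / 6 * W J + K * Real.log J ^ 2 := by
            rw [hW]
            simp only
            rw [← hWeq, ← hsuma J hJ, sq, sum_mul_sum, mul_sum, mul_sum, ← sum_add_distrib]
            refine sum_congr rfl fun i _ => ?_
            rw [mul_sum, mul_sum, ← sum_add_distrib]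
            exact sum_congr rfl fun j _ => by ring
    calc _ ≤ (η / 6 * W J + K * Real.log J ^ 2) / J := by gcongr
      _ = η / 6 * (W J / J) + K * (Real.log J ^ 2 / J) := by ring
      _ < η := by nlinarith
  have := hdiff.add (hWlim.const_mul c)
  simp only [sub_add_cancel, zero_add] at this
  rwa [mul_comm c 2] at this

end MainTerm

/-! ### From the least common multiple to the mean square, and the limit. -/

section MainAsymptotic

open Finset

/-- From `1/[a, b] = (a, b)/(ab)` and `(a, b) = ∑ φ(d)` over common divisors. The range of `d` does
not depend on `a, b`, so the two variables separate. -/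
theorem inv_lcm_eq_sum_totient {a b N : ℕ} (ha : 0 < a) (hb : 0 < b) (haN : a ≤ N) :
    1 / (Nat.lcm a b : ℝ) = ∑ d ∈ Icc 1 N, (d.totient : ℝ) *
      ((if d ∣ a then 1 / (a : ℝ) else 0) * (if d ∣ b then 1 / (b : ℝ) else 0)) := by
  have ha' : (a : ℝ) ≠ 0 := by exact_mod_cast ha.ne'
  have hb' : (b : ℝ) ≠ 0 := by exact_mod_cast hb.ne'
  have hg : 0 < Nat.gcd a b := Nat.gcd_pos_of_pos_left _ ha
  have hl : (Nat.lcm a b : ℝ) ≠ 0 := by exact_mod_cast (Nat.lcm_pos ha hb).ne'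
  have h1 : (Nat.gcd a b : ℝ) * Nat.lcm a b = a * b := by exact_mod_cast Nat.gcd_mul_lcm a b
  have h2 : (Nat.gcd a b : ℝ) = ∑ d ∈ (Nat.gcd a b).divisors, (d.totient : ℝ) := by
    exact_mod_cast (Nat.sum_totient (Nat.gcd a b)).symm
  have h3 : (Nat.gcd a b).divisors = (Icc 1 N).filter fun d => d ∣ a ∧ d ∣ b := by
    ext d
    simp only [Nat.mem_divisors, mem_filter, mem_Icc, Nat.dvd_gcd_iff]
    constructor
    · rintro ⟨h, -⟩
      exact ⟨⟨Nat.pos_of_dvd_of_pos h.1 ha, (Nat.le_of_dvd ha h.1).trans haN⟩, h⟩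
    · rintro ⟨-, h⟩
      exact ⟨h, hg.ne'⟩
  have h4 : 1 / (Nat.lcm a b : ℝ) = (Nat.gcd a b : ℝ) * (1 / a * (1 / b)) := by
    field_simp
    linarith
  rw [h4, h2, h3, sum_filter, sum_mul]
  refine sum_congr rfl fun d _ => ?_
  by_cases hda : d ∣ a <;> by_cases hdb : d ∣ b <;> simp [hda, hdb]

theorem primesLE_two_pow_eq_biUnion (J : ℕ) :
    Nat.primesLE (2 ^ J) =
      (range J).biUnion fun j => (Ioc (2 ^ j) (2 ^ (j + 1))).filter Nat.Prime := by
  ext p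
  simp only [Nat.mem_primesLE, mem_biUnion, mem_range, mem_filter, mem_Ioc]
  constructor
  · rintro ⟨hpJ, hp⟩
    have hp2 := hp.two_le
    have h1 : p - 1 ≠ 0 := by omega
    have h2 := Nat.pow_log_le_self 2 h1
    have h3 := Nat.lt_pow_succ_log_self (b := 2) (by norm_num) (p - 1)
    -- The logarithm of `p - 1`, not of `p`, because the blocks are open on the left and closed on
    -- the right.
    refine ⟨Nat.log 2 (p - 1), ?_, ⟨by omega, by rw [Nat.succ_eq_add_one] at h3; omega⟩, hp⟩
    exact (Nat.pow_lt_pow_iff_right (by norm_num : 1 < 2)).mp (by omega)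
  · rintro ⟨j, hj, ⟨-, h⟩, hp⟩
    exact ⟨h.trans (Nat.pow_le_pow_right (by norm_num) hj), hp⟩

theorem sum_primesLE_two_pow (J : ℕ) (f : ℕ → ℝ) :
    ∑ p ∈ Nat.primesLE (2 ^ J), f p =
      ∑ j ∈ range J, ∑ p ∈ (Ioc (2 ^ j) (2 ^ (j + 1))).filter Nat.Prime, f p := by
  rw [primesLE_two_pow_eq_biUnion, sum_biUnion]
  intro i _ j _ hij
  refine disjoint_left.mpr fun p hpi hpj => hij ?_
  simp only [mem_filter, mem_Ioc] at hpi hpj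
  have h1 : i < j + 1 := (Nat.pow_lt_pow_iff_right (by norm_num : 1 < 2)).mp
    (hpi.1.1.trans_le hpj.1.2)
  have h2 : j < i + 1 := (Nat.pow_lt_pow_iff_right (by norm_num : 1 < 2)).mp
    (hpj.1.1.trans_le hpi.1.2)
  omega

theorem nearSum_add_farSum (ε : ℝ) (J d : ℕ) :
    nearSum ε J d + farSum ε J d =
      ∑ p ∈ Nat.primesLE (2 ^ J), if d ∣ p - 1 then 1 / (((p - 1 : ℕ)) : ℝ) else 0 := by
  classical
  have h : nearSum ε J d + farSum ε J d = ∑ j ∈ range J, blockSum j d := by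
    rw [add_comm, ← sum_filter_add_sum_filter_not (range J) (fun j => IsFarBlock ε d j)]
    unfold nearSum farSum
    congr!
  rw [h, sum_primesLE_two_pow]
  refine sum_congr rfl fun j _ => ?_
  unfold blockSum
  rw [← filter_filter, sum_filter (fun p => d ∣ p - 1)]
  refine sum_congr rfl fun p hp => ?_
  rw [Nat.cast_pred (mem_filter.mp hp).2.pos]

theorem lcmSum_two_pow (ε : ℝ) (J : ℕ) :
    lcmSum (2 ^ J) = ∑ d ∈ Icc 1 (2 ^ J),
      (d.totient : ℝ) * (nearSum ε J d + farSum ε J d) ^ 2 := by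
  have hfl : ⌊(2 : ℝ) ^ J⌋₊ = 2 ^ J := by
    rw [← Nat.floor_natCast (R := ℝ) (2 ^ J)]
    norm_cast
  unfold lcmSum
  rw [hfl]
  simp_rw [nearSum_add_farSum, sq, sum_mul_sum, mul_sum]
  rw [sum_comm]
  conv_rhs => rw [sum_comm]
  rw [sum_comm]
  refine sum_congr rfl fun p hp => ?_
  rw [sum_comm]
  refine sum_congr rfl fun q hq => ?_
  rw [Nat.mem_primesLE] at hp hq
  exact inv_lcm_eq_sum_totient (Nat.sub_pos_of_lt hp.2.one_lt) (Nat.sub_pos_of_lt hq.2.one_lt)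
    ((Nat.sub_le _ _).trans hp.1)

/-- Termwise, the right side exceeds the left by `w (ηf - g)^2 / η`. -/
theorem sum_mul_add_sq_le {ι : Type*} (s : Finset ι) {w : ι → ℝ} (hw : ∀ i, 0 ≤ w i)
    (f g : ι → ℝ) {η : ℝ} (hη : 0 < η) :
    ∑ i ∈ s, w i * (f i + g i) ^ 2 ≤
      (1 + η) * ∑ i ∈ s, w i * f i ^ 2 + (1 + 1 / η) * ∑ i ∈ s, w i * g i ^ 2 := by
  rw [mul_sum, mul_sum, ← sum_add_distrib]
  refine sum_le_sum fun i _ => ?_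
  have h : (1 + η) * f i ^ 2 + (1 + 1 / η) * g i ^ 2 - (f i + g i) ^ 2 =
      (η * f i - g i) ^ 2 / η := by
    field_simp
    ring
  have h0 : 0 ≤ (η * f i - g i) ^ 2 / η := by positivity
  nlinarith [mul_nonneg (hw i) (h ▸ h0)]

/-- Under the Elliott–Halberstam conjecture `lcmSum` is close to the weighted mean square of
`modelSum`, with a free parameter `η` from `(a + b)² ≤ (1 + η) a² + (1 + 1/η) b²`. -/
theorem exists_lcmSum_modelSum_le (hEH : ElliottHalberstam) :
    ∃ C : ℝ, 0 < C ∧ ∀ ε : ℝ, 0 < ε → ε ≤ 1 / 4 → ∃ B : ℝ, ∀ J : ℕ, ∀ η : ℝ, 0 < η →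
      lcmSum (2 ^ J) ≤ (1 + η) * (∑ d ∈ Icc 1 (2 ^ J), (d.totient : ℝ) * modelSum ε J d ^ 2) +
        (1 + 1 / η) * (C * ε * J + B) ∧
      (∑ d ∈ Icc 1 (2 ^ J), (d.totient : ℝ) * modelSum ε J d ^ 2) ≤
        (1 + η) * lcmSum (2 ^ J) + (1 + 1 / η) * (C * ε * J + B) := by
  obtain ⟨C, hC, hnear⟩ := sum_totient_mul_nearSum_sq_le
  refine ⟨2 * C, by positivity, fun ε hε hε4 => ?_⟩
  obtain ⟨B₁, hB₁⟩ := hnear ε hε hε4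
  obtain ⟨B₂, hB₂⟩ := sum_totient_mul_farSum_sub_sq_le hEH hε (by linarith)
  refine ⟨2 * B₁ + 2 * B₂, fun J η hη => ?_⟩
  have hw : ∀ d : ℕ, (0 : ℝ) ≤ d.totient := fun d => Nat.cast_nonneg _
  -- The total error: the full sum is `modelSum + E`. The weighted square inequality, applied to
  -- this and to `modelSum = full sum - E`, yields the two claims.
  set E : ℕ → ℝ := fun d => nearSum ε J d + (farSum ε J d - modelSum ε J d) with hE
  have herr : ∑ d ∈ Icc 1 (2 ^ J), (d.totient : ℝ) * E d ^ 2 ≤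
      2 * C * ε * J + (2 * B₁ + 2 * B₂) := by
    have := sum_mul_add_sq_le (Icc 1 (2 ^ J)) hw (nearSum ε J)
      (fun d => farSum ε J d - modelSum ε J d) one_pos
    have h1 := hB₁ J
    have h2 := hB₂ J
    norm_num at this
    linarith
  have hη1 : 0 ≤ 1 + 1 / η := by positivity
  have hmul := mul_le_mul_of_nonneg_left herr hη1
  rw [lcmSum_two_pow ε J]
  constructor
  · have := sum_mul_add_sq_le (Icc 1 (2 ^ J)) hw (modelSum ε J) E hη
    have e : ∀ d, modelSum ε J d + E d = nearSum ε J d + farSum ε J d := fun d => by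
      simp only [hE]; ring
    simp_rw [e] at this
    linarith
  · have := sum_mul_add_sq_le (Icc 1 (2 ^ J)) hw
      (fun d => nearSum ε J d + farSum ε J d) (fun d => - E d) hη
    have e : ∀ d, nearSum ε J d + farSum ε J d + - E d = modelSum ε J d := fun d => by
      simp only [hE]; ring
    simp_rw [e, neg_sq] at this
    linarith

/-- Squeezing with iterated limits: `J → ∞` for fixed `η`, then `η → 0`. No uniformity in `η` is
needed, so constants may depend on it freely. -/
theorem tendsto_of_approx_squeeze {s : ℕ → ℝ} {l u : ℝ → ℕ → ℝ} {l' u' : ℝ → ℝ} {a : ℝ}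
    (hl : Tendsto l' (nhdsWithin 0 (Set.Ioi 0)) (nhds a))
    (hu : Tendsto u' (nhdsWithin 0 (Set.Ioi 0)) (nhds a))
    (hlt : ∀ᶠ η in nhdsWithin 0 (Set.Ioi 0), Tendsto (l η) atTop (nhds (l' η)))
    (hut : ∀ᶠ η in nhdsWithin 0 (Set.Ioi 0), Tendsto (u η) atTop (nhds (u' η)))
    (hls : ∀ᶠ η in nhdsWithin 0 (Set.Ioi 0), ∀ᶠ J in atTop, l η J ≤ s J)
    (hsu : ∀ᶠ η in nhdsWithin 0 (Set.Ioi 0), ∀ᶠ J in atTop, s J ≤ u η J) :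
    Tendsto s atTop (nhds a) := by
  refine tendsto_order.mpr ⟨fun b hb => ?_, fun b hb => ?_⟩
  · obtain ⟨η, h1, h2, h3⟩ := ((hl.eventually_const_lt hb).and (hlt.and hls)).exists
    filter_upwards [h2.eventually_const_lt h1, h3] with J h4 h5 using h4.trans_le h5
  · obtain ⟨η, h1, h2, h3⟩ := ((hu.eventually_lt_const hb).and (hut.and hsu)).exists
    filter_upwards [h2.eventually_lt_const h1, h3] with J h4 h5 using h5.trans_lt h4

/-- The choice `ε = η^2` balances the two parameters: `(1 + 1/η) C η^2 = C(η^2 + η)` still tends to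
`0`, while the constant depending on `η` disappears on division by `J`. -/
theorem tendsto_lcmSum_two_pow_div (hEH : ElliottHalberstam) :
    Tendsto (fun J : ℕ => lcmSum (2 ^ J) / J) atTop
      (nhds (2 * (totientConstant * Real.log 2))) := by
  obtain ⟨C, hC, h⟩ := exists_lcmSum_modelSum_le hEH
  have h' : ∀ η : ℝ, ∃ B : ℝ, 0 < η → η ≤ 1 / 2 → ∀ J : ℕ, ∀ θ : ℝ, 0 < θ →
      lcmSum (2 ^ J) ≤
        (1 + θ) * (∑ d ∈ Icc 1 (2 ^ J), (d.totient : ℝ) * modelSum (η ^ 2) J d ^ 2) +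
        (1 + 1 / θ) * (C * η ^ 2 * J + B) ∧
      (∑ d ∈ Icc 1 (2 ^ J), (d.totient : ℝ) * modelSum (η ^ 2) J d ^ 2) ≤
        (1 + θ) * lcmSum (2 ^ J) + (1 + 1 / θ) * (C * η ^ 2 * J + B) := by
    intro η
    by_cases hη : 0 < η ∧ η ≤ 1 / 2
    · obtain ⟨B, hB⟩ := h (η ^ 2) (pow_pos hη.1 2) (by nlinarith [hη.1, hη.2])
      exact ⟨B, fun _ _ => hB⟩
    · exact ⟨0, fun h1 h2 => absurd ⟨h1, h2⟩ hη⟩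
  choose B hB using h'
  set M : ℝ → ℕ → ℝ := fun η J =>
    (∑ d ∈ Icc 1 (2 ^ J), (d.totient : ℝ) * modelSum (η ^ 2) J d ^ 2) / J with hM
  set R : ℝ → ℕ → ℝ := fun η J => (1 + 1 / η) * (C * η ^ 2 + B η * (1 / J)) with hR
  have hsmall : ∀ᶠ η : ℝ in nhdsWithin 0 (Set.Ioi 0), 0 < η ∧ η ≤ 1 / 2 := by
    filter_upwards [Ioo_mem_nhdsGT (show (0 : ℝ) < 1 / 2 by norm_num)] with η hη
    exact ⟨hη.1, hη.2.le⟩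
  have hMt : ∀ η : ℝ, 0 < η → η ≤ 1 / 2 → Tendsto (M η) atTop
      (nhds (2 * (totientConstant * ((1 - η ^ 2) * Real.log 2)))) := fun η h1 h2 =>
    tendsto_sum_totient_mul_modelSum_sq (by positivity) (by nlinarith)
  have hRt : ∀ η : ℝ, 0 < η → Tendsto (R η) atTop (nhds (C * (η ^ 2 + η))) := by
    intro η hη
    have := ((tendsto_one_div_atTop_nhds_zero_nat (𝕜 := ℝ)).const_mul (B η)).const_add (C * η ^ 2)
    have := this.const_mul (1 + 1 / η)
    convert this using 2
    field_simp
    ring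
  refine tendsto_of_approx_squeeze
    (l := fun η J => (M η J - R η J) / (1 + η)) (u := fun η J => (1 + η) * M η J + R η J)
    (l' := fun η => (2 * (totientConstant * ((1 - η ^ 2) * Real.log 2)) - C * (η ^ 2 + η)) /
      (1 + η))
    (u' := fun η => (1 + η) * (2 * (totientConstant * ((1 - η ^ 2) * Real.log 2))) +
      C * (η ^ 2 + η)) ?_ ?_ ?_ ?_ ?_ ?_
  · have : ContinuousAt (fun η : ℝ => (2 * (totientConstant * ((1 - η ^ 2) * Real.log 2)) -
        C * (η ^ 2 + η)) / (1 + η)) 0 :=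
      ContinuousAt.div (by fun_prop) (by fun_prop) (by norm_num)
    simpa [ContinuousAt] using this.tendsto.mono_left nhdsWithin_le_nhds
  · have : ContinuousAt (fun η : ℝ => (1 + η) * (2 * (totientConstant * ((1 - η ^ 2) *
        Real.log 2))) + C * (η ^ 2 + η)) 0 := by fun_prop
    simpa [ContinuousAt] using this.tendsto.mono_left nhdsWithin_le_nhds
  · filter_upwards [hsmall] with η hη
    exact ((hMt η hη.1 hη.2).sub (hRt η hη.1)).div_const _
  · filter_upwards [hsmall] with η hη
    exact ((hMt η hη.1 hη.2).const_mul _).add (hRt η hη.1)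
  · filter_upwards [hsmall] with η hη
    filter_upwards [eventually_ge_atTop 1] with J hJ
    have hJ0 : (0 : ℝ) < J := by exact_mod_cast hJ
    have h1 := (hB η hη.1 hη.2 J η hη.1).2
    have h2 : 0 < 1 + η := by linarith [hη.1]
    rw [div_le_div_iff₀ h2 hJ0]
    simp only [hM, hR, sub_mul]
    have e : (1 + 1 / η) * (C * η ^ 2 + B η * (1 / (J : ℝ))) * J =
        (1 + 1 / η) * (C * η ^ 2 * J + B η) := by field_simp
    rw [e, div_mul_cancel₀ _ hJ0.ne']
    linarith
  · filter_upwards [hsmall] with η hη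
    filter_upwards [eventually_ge_atTop 1] with J hJ
    have hJ0 : (0 : ℝ) < J := by exact_mod_cast hJ
    have h1 := (hB η hη.1 hη.2 J η hη.1).1
    rw [div_le_iff₀ hJ0]
    simp only [hM, hR, add_mul _ _ (J : ℝ)]
    have e : (1 + 1 / η) * (C * η ^ 2 + B η * (1 / (J : ℝ))) * J =
        (1 + 1 / η) * (C * η ^ 2 * J + B η) := by field_simp
    rw [e, mul_assoc, div_mul_cancel₀ _ hJ0.ne']
    exact h1

theorem lcmSum_mono {x y : ℝ} (hxy : x ≤ y) : lcmSum x ≤ lcmSum y := by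
  have hsub : Nat.primesLE ⌊x⌋₊ ⊆ Nat.primesLE ⌊y⌋₊ := by
    intro p hp
    rw [Nat.mem_primesLE] at hp ⊢
    exact ⟨hp.1.trans (Nat.floor_mono hxy), hp.2⟩
  unfold lcmSum
  calc _ ≤ ∑ p ∈ Nat.primesLE ⌊x⌋₊, ∑ q ∈ Nat.primesLE ⌊y⌋₊,
        1 / (Nat.lcm (p - 1) (q - 1) : ℝ) :=
        sum_le_sum fun p _ => sum_le_sum_of_subset_of_nonneg hsub fun _ _ _ => by positivity
    _ ≤ _ := sum_le_sum_of_subset_of_nonneg hsub fun _ _ _ => sum_nonneg fun _ _ => by positivity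

theorem lcmSum_nonneg (x : ℝ) : 0 ≤ lcmSum x :=
  sum_nonneg fun _ _ => sum_nonneg fun _ _ => by positivity

/-- A nonnegative monotone function with linear growth along powers of `2` is asymptotically a
multiple of the logarithm. -/
theorem tendsto_div_log_of_tendsto_two_pow {f : ℝ → ℝ} (hf : Monotone f) (hf0 : ∀ x, 0 ≤ f x)
    {c : ℝ} (h : Tendsto (fun J : ℕ => f (2 ^ J) / J) atTop (nhds (c * Real.log 2))) :
    Tendsto (fun x : ℝ => f x / Real.log x) atTop (nhds c) := by
  have hl2 : 0 < Real.log 2 := Real.log_pos (by norm_num)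
  have hone := tendsto_natCast_div_add_atTop (𝕜 := ℝ) 1
  have hinv : Tendsto (fun J : ℕ => ((J : ℝ) + 1) / J) atTop (nhds 1) := by
    have := hone.inv₀ one_ne_zero
    simpa using this
  have hlow : Tendsto (fun J : ℕ => f (2 ^ J) / J * (J / ((J : ℝ) + 1)) / Real.log 2) atTop
      (nhds c) := by
    have := (h.mul hone).div_const (Real.log 2)
    rwa [mul_one, mul_div_cancel_right₀ _ hl2.ne'] at this
  have hup : Tendsto (fun J : ℕ => f (2 ^ (J + 1)) / ((J + 1 : ℕ) : ℝ) * (((J : ℝ) + 1) / J) /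
      Real.log 2) atTop (nhds c) := by
    have := (((tendsto_add_atTop_iff_nat 1).mpr h).mul hinv).div_const (Real.log 2)
    rwa [mul_one, mul_div_cancel_right₀ _ hl2.ne'] at this
  have hJt : Tendsto (fun x : ℝ => Nat.log 2 ⌊x⌋₊) atTop atTop := by
    refine tendsto_atTop.mpr fun K => ?_
    filter_upwards [eventually_ge_atTop ((2 : ℝ) ^ K)] with x hx
    have h1 : 2 ^ K ≤ ⌊x⌋₊ := Nat.le_floor (by exact_mod_cast hx)
    exact (Nat.le_log_iff_pow_le (by norm_num) 
      (by have := Nat.two_pow_pos K; omega)).mpr h1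
  refine tendsto_of_tendsto_of_tendsto_of_le_of_le' (hlow.comp hJt) (hup.comp hJt) ?_ ?_ <;>
  · filter_upwards [eventually_ge_atTop (2 : ℝ)] with x hx
    -- With `2^J ≤ x ≤ 2^(J+1)`, the quotient lies between `f(2^J)/((J+1) log 2)` and `f(2^(J+1))/(J
    -- log 2)`.
    set J := Nat.log 2 ⌊x⌋₊ with hJ
    have hx0 : 0 < x := by linarith
    have hfl : 2 ≤ ⌊x⌋₊ := Nat.le_floor (by exact_mod_cast hx)
    have hJ1 : 1 ≤ J := Nat.log_pos (by norm_num) hfl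
    have hJ0 : (0 : ℝ) < J := by exact_mod_cast hJ1
    have h1 : (2 : ℝ) ^ J ≤ x := by
      have : 2 ^ J ≤ ⌊x⌋₊ := Nat.pow_log_le_self 2 (by omega)
      exact (by exact_mod_cast this : (2 : ℝ) ^ J ≤ (⌊x⌋₊ : ℝ)).trans (Nat.floor_le hx0.le)
    have h2 : x ≤ (2 : ℝ) ^ (J + 1) := by
      have : ⌊x⌋₊ + 1 ≤ 2 ^ (J + 1) := Nat.lt_pow_succ_log_self (by norm_num) _
      exact (Nat.lt_floor_add_one x).le.trans (by exact_mod_cast this)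
    have hlog1 : J * Real.log 2 ≤ Real.log x := by
      rw [← Real.log_pow]; exact Real.log_le_log (by positivity) h1
    have hlog2 : Real.log x ≤ ((J : ℝ) + 1) * Real.log 2 := by
      have := Real.log_le_log hx0 h2
      rw [Real.log_pow] at this
      exact_mod_cast this
    have hlogpos : 0 < Real.log x := Real.log_pos (by linarith)
    simp only [Function.comp_apply, ← hJ]
    first
    | rw [div_mul_div_cancel₀ hJ0.ne', div_div]
      exact div_le_div₀ (hf0 _) (hf h1) hlogpos hlog2
    | rw [Nat.cast_add, Nat.cast_one, div_mul_div_cancel₀ (by positivity), div_div]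
      exact div_le_div₀ (hf0 _) (hf h2) (by positivity) hlog1

end MainAsymptotic

theorem mainTheorem2 (hEH : ElliottHalberstam) :
    lcmSum ~[atTop] fun x : ℝ =>
      2 * ((riemannZeta 2).re * (riemannZeta 3).re / (riemannZeta 6).re) * Real.log x := by
  rw [← totientConstant_eq]
  have hpos : 0 < totientConstant := by
    rw [totientConstant_eq]
    have h2 := riemannZeta_nat_re_pos (k := 2) (by norm_num)
    have h3 := riemannZeta_nat_re_pos (k := 3) (by norm_num)
    have h6 := riemannZeta_nat_re_pos (k := 6) (by norm_num)
    push_cast at h2 h3 h6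
    positivity
  have hlim : Tendsto (fun x : ℝ => lcmSum x / Real.log x) atTop (nhds (2 * totientConstant)) :=
    tendsto_div_log_of_tendsto_two_pow (fun _ _ h => lcmSum_mono h) lcmSum_nonneg
      (by simpa only [mul_assoc] using tendsto_lcmSum_two_pow_div hEH)
  have hne : 2 * totientConstant ≠ 0 := by positivity
  refine isEquivalent_of_tendsto_one ?_
  have := hlim.div_const (2 * totientConstant)
  rw [div_self hne] at this
  refine this.congr fun x => ?_
  simp only [Pi.div_apply]
  rw [div_div, mul_comm (Real.log x)]
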